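/- **Conventions.** The model of computation is the word-RAM with $O(\log n)$-bit words ($n$ the size of the input, respectively the number of vertices); algorithms may be randomized. The *eccentricity* of a vertex $u$ of a directed unweighted graph is $\max_v d(u,v)$, where $d(u,v)\in\mathbb N\cup\{\infty\}$ is the directed distance from $u$ to $v$; the *radius* $R$ is the minimum of all eccentricities. An *$\alpha$-approximation* of $R$ is an estimate $\hat R$ with $R\le\hat R\le\alpha R$ (and $\hat R$ is $\infty$ exactly if $R$ is). *Unbalanced 3-HS* is the following problem: given sets $U,V,W\subseteq\{0,1\}^d$ with $|U|=n$, $|V|=n^a$, $|W|=n^b$ (rounded down), are there $u\in U$ and $w\in W$ such that $\sum_{i=1}^d u[i]\,v[i]\,w[i]\ne 0$ for all $v\in V$? The *3-HS Hypothesis* states that for all constants $a,b>0$ and every $\delta>0$, no algorithm, even randomized with success probability at least $2/3$ on each instance, solves this problem in time $n^{1+a+b-\delta}\,\mathrm{poly}(d)$ on the word-RAM with $O(\log(n+d))$-bit words. A *dynamic Radius algorithm* first preprocesses a given directed unweighted loopless graph on $n$ vertices and then serves a sequence of operations, each of which inserts an edge, deletes an edge, or queries the radius of the current graph. It is *fully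 dynamic* if it supports both kinds of updates, *incremental* if it supports only insertions, *decremental* if it supports only deletions. For each fixed sequence of operations each query must be answered with a correct approximation with probability at least $2/3$. The preprocessing time $p(n)$ and the update and query times $u(n)$, $q(n)$ must hold for all outcomes of the random bits. *Worst-case* bounds hold for each operation separately; *amortized* bounds mean that the total time spent on preprocessing and on any sequence of $i$ updates and $j$ queries is at most $p(n)+i\,u(n)+j\,q(n)$. **Theorem.** Let $t$, $\epsilon$, $\epsilon'$ be positive constants. Let $c>0$ and let $k\ge 1$ be an integer. Assume the 3-HS Hypothesis. Then there is no fully dynamic algorithm for $(2-\epsilon)$-approximate Radius on directed unweighted graphs with $n$ vertices that have at all times at most $c\,n\log^k n$ edges, which has preprocessing time $p(n)=O(n^t)$, amortized update time $u(n)=O(n^{2-\epsilon'})$ and amortized query time $q(n)=O(n^{2-\epsilon'})$. Likewise, under the same hypothesis there is no incremental and no decremental algorithm for $(2-\epsilon)$-approximate Radius on these graphs which has preprocessing time $p(n)=O(n^t)$, worst-case update time $u(n)=O(n^{2-\epsilon'})$ and worst-case query time $q(n)=O(n^{2-\epsilon'})$. -/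

import Mathlib

open Asymptotics Filter

noncomputable section

/-! ## The word-RAM

Programs are structured commands over finitely many registers and finitely many arrays of words.
One command is executed per unit of time.  A word is a natural number below the bound `B = 2 ^ w`,
where `w` is the word size. -/

namespace WordRAM

/-- The constant-time operations on words (subtraction is truncated, division rounds down). -/
inductive BinOp
  | plus | minus | times | quot | rem | band | bor | bxor | shl | shr

/-- The value of a word operation. -/
def BinOp.eval : BinOp → ℕ → ℕ → ℕ
  | plus, x, y => x + y
  | minus, x, y => x - y
  | times, x, y => x * y
  | quot, x, y => x / y
  | rem, x, y => x % y
  | band, x, y => x &&& y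
  | bor, x, y => x ||| y
  | bxor, x, y => x ^^^ y
  | shl, x, y => x <<< y
  | shr, x, y => x >>> y

/-- Programs.  Registers `x y z` and arrays `a` are named by natural numbers. -/
inductive Cmd
  /-- do nothing -/
  | skip
  /-- `x := v` -/
  | const (x v : ℕ)
  /-- `x := y` -/
  | copy (x y : ℕ)
  /-- `x := y o z` -/
  | op (o : BinOp) (x y z : ℕ)
  /-- `x := a[y]` -/
  | load (x a y : ℕ)
  /-- `a[x] := y` -/
  | store (a x y : ℕ)
  /-- `x :=` a fresh fair random bit -/
  | flip (x : ℕ)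
  /-- `c; d` -/
  | seq (c d : Cmd)
  /-- `if x ≠ 0 then c else d` -/
  | ite (x : ℕ) (c d : Cmd)
  /-- `while x ≠ 0 do c` -/
  | loop (x : ℕ) (c : Cmd)

/-- The contents of the registers and of the arrays. -/
structure Store where
  var : ℕ → ℕ
  arr : ℕ → ℕ → ℕ

/-- The store in which register `x` has been overwritten by `v`. -/
def Store.setVar (s : Store) (x v : ℕ) : Store :=
  { s with var := Function.update s.var x v }

/-- The store in which cell `i` of array `a` has been overwritten by `v`. -/
def Store.setArr (s : Store) (a i v : ℕ) : Store :=
  { s with arr := Function.update s.arr a (Function.update (s.arr a) i v) }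

/-- A configuration: the commands still to be executed, and the store.  The machine has halted
when no command is left. -/
structure Config where
  todo : List Cmd
  mem : Store

/-- Assign `v` to register `x`, in executing the command `c` before the commands `k`.
If `v` does not fit into a word, the machine hangs (it stays where it is and never halts). -/
def assign (B : ℕ) (c : Cmd) (k : List Cmd) (s : Store) (x v : ℕ) : Config :=
  if v < B then ⟨k, s.setVar x v⟩ else ⟨c :: k, s⟩

/-- One time step of the machine with word bound `B`, executing the command `c` in store `s`, with
the commands `k` to follow. -/
def step (B : ℕ) (c : Cmd) (k : List Cmd) (s : Store) : PMF Config :=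
  match c with
  | .skip => PMF.pure ⟨k, s⟩
  | .const x v => PMF.pure (assign B c k s x v)
  | .copy x y => PMF.pure (assign B c k s x (s.var y))
  | .op o x y z => PMF.pure (assign B c k s x (o.eval (s.var y) (s.var z)))
  | .load x a y => PMF.pure (assign B c k s x (s.arr a (s.var y)))
  | .store a x y => PMF.pure ⟨k, s.setArr a (s.var x) (s.var y)⟩
  | .flip x => (PMF.uniformOfFintype Bool).map fun r => assign B c k s x r.toNat
  | .seq c₁ c₂ => PMF.pure ⟨c₁ :: c₂ :: k, s⟩
  | .ite x c₁ c₂ => PMF.pure ⟨(if s.var x ≠ 0 then c₁ else c₂) :: k, s⟩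
  | .loop x c₁ => PMF.pure ⟨if s.var x ≠ 0 then c₁ :: .loop x c₁ :: k else k, s⟩

/-- Run the machine with word bound `B` for at most `T` steps.  The outcome is the final store
together with the number of unused steps, or `none` if the machine does not halt within `T`
steps. -/
def exec (B : ℕ) : ℕ → Config → PMF (Option (Store × ℕ))
  | T, ⟨[], s⟩ => PMF.pure (some (s, T))
  | 0, ⟨_ :: _, _⟩ => PMF.pure none
  | T + 1, ⟨c :: k, s⟩ => (step B c k s).bind (exec B T)

end WordRAM

open WordRAM

/-! ## Unbalanced 3-HS -/

/-- The generalized inner product of three 0-1 vectors. -/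
def tripleProduct {d : ℕ} (u v w : Fin d → Bool) : ℕ :=
  ∑ i, (u i).toNat * (v i).toNat * (w i).toNat

/-- The instance `U, V, W` is a yes-instance of 3-HS. -/
def HasHittingSet {d n₁ n₂ n₃ : ℕ} (U : Fin n₁ → Fin d → Bool) (V : Fin n₂ → Fin d → Bool)
    (W : Fin n₃ → Fin d → Bool) : Prop :=
  ∃ i k, ∀ j, tripleProduct (U i) (V j) (W k) ≠ 0

open Classical in
/-- A list of `n` vectors of length `d` as an array of bits: bit `j` of vector `i` stands in
cell `i * d + j`. -/
def vectorArray {d n : ℕ} (X : Fin n → Fin d → Bool) (p : ℕ) : ℕ :=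
  if ∃ (i : Fin n) (j : Fin d), p = i * d + j ∧ X i j = true then 1 else 0

/-- The initial store for the 3-HS instance `U, V, W`: registers 0, 1, 2, 3 hold the numbers of
vectors and the dimension, arrays 0, 1, 2 hold the vectors. -/
def hsStore {d n₁ n₂ n₃ : ℕ} (U : Fin n₁ → Fin d → Bool) (V : Fin n₂ → Fin d → Bool)
    (W : Fin n₃ → Fin d → Bool) : Store where
  var x := match x with | 0 => n₁ | 1 => n₂ | 2 => n₃ | 3 => d | _ => 0
  arr a := match a with
    | 0 => vectorArray U | 1 => vectorArray V | 2 => vectorArray W | _ => fun _ => 0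

/-- The randomized program `P`, on the machine with word bound `B`, always halts within `T` steps
on the instance `U, V, W` and, with probability at least 2/3, is right on whether it is a
yes-instance (answer "yes" when register 0 is nonzero). -/
def DecidesHS (P : Cmd) (B T : ℕ) {d n₁ n₂ n₃ : ℕ} (U : Fin n₁ → Fin d → Bool)
    (V : Fin n₂ → Fin d → Bool) (W : Fin n₃ → Fin d → Bool) : Prop :=
  none ∉ (exec B T ⟨[P], hsStore U V W⟩).support ∧
  2 / 3 ≤ (exec B T ⟨[P], hsStore U V W⟩).toOuterMeasure
    {r | ∃ s b, r = some (s, b) ∧ (s.var 0 ≠ 0 ↔ HasHittingSet U V W)}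

/-- The unbalanced 3-HS Hypothesis: for all constants `a, b > 0`, no randomized word-RAM
algorithm with `O(log (n + d))`-bit words decides 3-HS for sets of `n`, `n ^ a`, `n ^ b` distinct
vectors from `{0,1}^d` in time `n ^ (1 + a + b - ε) * poly(d)`, for any `ε > 0`. -/
def ThreeHSHypothesis : Prop :=
  ∀ a b ε : ℝ, 0 < a → 0 < b → 0 < ε → ∀ (C : ℝ) (k r : ℕ), ¬ ∃ P : Cmd,
    ∀ (n d : ℕ), 1 ≤ n →
    ∀ (U : Fin n → Fin d → Bool) (V : Fin ⌊(n : ℝ) ^ a⌋₊ → Fin d → Bool)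
      (W : Fin ⌊(n : ℝ) ^ b⌋₊ → Fin d → Bool),
      Function.Injective U → Function.Injective V → Function.Injective W →
      DecidesHS P (2 ^ (r * (Nat.log 2 (n + d) + 1)))
        ⌊C * (n : ℝ) ^ (1 + a + b - ε) * ((d : ℝ) + 1) ^ k⌋₊ U V W

/-! ## Directed graphs and their radius

A directed unweighted graph on `n` vertices is given by its set of edges. -/

/-- There is a walk with the given number of edges between two vertices. -/
inductive HasWalk {n : ℕ} (E : Finset (Fin n × Fin n)) : Fin n → ℕ → Fin n → Prop
  | nil (u : Fin n) : HasWalk E u 0 u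
  | cons {u v w : Fin n} {k : ℕ} : (u, v) ∈ E → HasWalk E v k w → HasWalk E u (k + 1) w

/-- The directed distance, infinite if there is no path. -/
def ddist {n : ℕ} (E : Finset (Fin n × Fin n)) (u v : Fin n) : ℕ∞ :=
  ⨅ (k : ℕ) (_ : HasWalk E u k v), (k : ℕ∞)

/-- The (out-)eccentricity of a vertex. -/
def ecc {n : ℕ} (E : Finset (Fin n × Fin n)) (u : Fin n) : ℕ∞ := ⨆ v, ddist E u v

/-- The radius. -/
def radius {n : ℕ} (E : Finset (Fin n × Fin n)) : ℕ∞ := ⨅ u, ecc E u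

/-- `est` is an `α`-approximation of `R`: `R ≤ est ≤ α R`, where an infinite value has to be
reported as infinite. -/
def IsApprox (α : ℝ) (R est : ℕ∞) : Prop :=
  (R = ⊤ → est = ⊤) ∧ ∀ r : ℕ, R = r → ∃ e : ℕ, est = e ∧ r ≤ e ∧ (e : ℝ) ≤ α * r

/-- Loopless graphs on `n` vertices with at most `c n (log n) ^ k` edges. -/
def IsSparse (c : ℝ) (k : ℕ) {n : ℕ} (E : Finset (Fin n × Fin n)) : Prop :=
  (∀ v, (v, v) ∉ E) ∧ (E.card : ℝ) ≤ c * n * Real.log n ^ k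

/-! ## Dynamic algorithms -/

/-- The operations on a dynamic graph on `n` vertices. -/
inductive Op (n : ℕ)
  | insert (u v : Fin n)
  | delete (u v : Fin n)
  | query

/-- The three settings of dynamic algorithms. -/
inductive Setting
  | fullyDynamic | incremental | decremental

/-- The effect of an operation on the edge set. -/
def Op.apply {n : ℕ} (E : Finset (Fin n × Fin n)) : Op n → Finset (Fin n × Fin n)
  | .insert u v => Insert.insert (u, v) E
  | .delete u v => E.erase (u, v)
  | .query => E

/-- The operations that may be issued on the graph `E`: absent edges are inserted (not in the
decremental setting) and present edges are deleted (not in the incremental setting). -/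
def Op.Legal {n : ℕ} (S : Setting) (E : Finset (Fin n × Fin n)) : Op n → Prop
  | .insert u v => S ≠ .decremental ∧ (u, v) ∉ E
  | .delete u v => S ≠ .incremental ∧ (u, v) ∈ E
  | .query => True

/-- Sequences of legal operations along which the graph always stays sparse. -/
def LegalSeq {n : ℕ} (S : Setting) (c : ℝ) (k : ℕ) :
    Finset (Fin n × Fin n) → List (Op n) → Prop
  | E, [] => IsSparse c k E
  | E, o :: os => IsSparse c k E ∧ o.Legal S E ∧ LegalSeq S c k (o.apply E) os

/-- A (possibly randomized) dynamic algorithm: four programs that share one store. -/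
structure DynAlg where
  preprocess : Cmd
  onInsert : Cmd
  onDelete : Cmd
  onQuery : Cmd

/-- The initial store for the graph with the list of edges `L`: register 0 holds the number of
vertices, register 1 the number of edges, arrays 0 and 1 the tails and the heads of the edges. -/
def graphStore {n : ℕ} (L : List (Fin n × Fin n)) : Store where
  var x := match x with | 0 => n | 1 => L.length | _ => 0
  arr a := match a with
    | 0 => fun i => (L.map fun e => (e.1 : ℕ)).getD i 0
    | 1 => fun i => (L.map fun e => (e.2 : ℕ)).getD i 0
    | _ => fun _ => 0

/-- The configuration in which an operation is started from the store `s` left by the preceding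
one: the ends of an inserted or deleted edge are passed in registers 0 and 1. -/
def DynAlg.start (A : DynAlg) {n : ℕ} (s : Store) : Op n → Config
  | .insert u v => ⟨[A.onInsert], (s.setVar 0 u).setVar 1 v⟩
  | .delete u v => ⟨[A.onDelete], (s.setVar 0 u).setVar 1 v⟩
  | .query => ⟨[A.onQuery], s⟩

/-- The answer to a query: infinite if register 0 is zero, and the value of register 1 if not. -/
def answer (s : Store) : ℕ∞ := if s.var 0 = 0 then ⊤ else s.var 1

/-- How the time bounds for single operations are meant. -/
inductive Timing
  | amortized | worstCase

/-- The time granted to an operation with time bound `t` when `b` steps were left unused before.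
With amortized bounds unused time is carried over, so that the total time after any number of
operations is bounded by the sum of the bounds; with worst-case bounds it is lost. -/
def Timing.grant (M : Timing) (b t : ℕ) : ℕ :=
  match M with
  | .amortized => b + t
  | .worstCase => t

/-- The time bound of an operation, for bounds `tu` on updates and `tq` on queries. -/
def Op.bound {n : ℕ} (tu tq : ℕ) : Op n → ℕ
  | .insert _ _ => tu
  | .delete _ _ => tu
  | .query => tq

/-- Serve a sequence of operations, starting from a store and a number of unused steps.
The outcome is `none` if some operation exceeds the time that it is granted. -/
def DynAlg.serve (A : DynAlg) (M : Timing) (B tu tq : ℕ) {n : ℕ} :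
    List (Op n) → Store × ℕ → PMF (Option (Store × ℕ))
  | [], x => PMF.pure (some x)
  | o :: os, x => (exec B (M.grant x.2 (o.bound tu tq)) (A.start x.1 o)).bind fun r =>
      match r with
      | none => PMF.pure none
      | some y => A.serve M B tu tq os y

/-- A whole session: preprocess the graph with edge list `L` within `tp` steps, and then serve
the sequence of operations. -/
def DynAlg.session (A : DynAlg) (M : Timing) (B tp tu tq : ℕ) {n : ℕ}
    (L : List (Fin n × Fin n)) (os : List (Op n)) : PMF (Option (Store × ℕ)) :=
  (exec B tp ⟨[A.preprocess], graphStore L⟩).bind fun r =>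
    match r with
    | none => PMF.pure none
    | some y => A.serve M B tu tq os y

/-- `A` is an `α`-approximate dynamic Radius algorithm for directed graphs with `n` vertices and
at most `c n (log n) ^ k` edges, in the setting `S`, with words of `w n` bits, preprocessing time
`p n`, update time `u n` and query time `q n`: on every legal sequence of operations it always
keeps the time bounds, and every query is answered correctly with probability at least 2/3. -/
def DynAlg.ApproximatesRadius (A : DynAlg) (S : Setting) (M : Timing) (α c : ℝ) (k : ℕ)
    (w p u q : ℕ → ℕ) : Prop :=
  ∀ (n : ℕ), 1 ≤ n → ∀ (L : List (Fin n × Fin n)), L.Nodup → ∀ os : List (Op n),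
    LegalSeq S c k L.toFinset os →
      none ∉ (A.session M (2 ^ w n) (p n) (u n) (q n) L os).support ∧
      2 / 3 ≤ (A.session M (2 ^ w n) (p n) (u n) (q n) L (os ++ [.query])).toOuterMeasure
        {r | ∃ s b, r = some (s, b) ∧
          IsApprox α (radius (os.foldl Op.apply L.toFinset)) (answer s)}

/-- There is an `α`-approximate dynamic Radius algorithm with `O(log n)`-bit words, preprocessing
time `O(n ^ t)`, and update and query time `O(n ^ e)`. -/
def ExistsDynamicRadius (S : Setting) (M : Timing) (α c : ℝ) (k : ℕ) (t e : ℝ) : Prop :=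
  ∃ (A : DynAlg) (w p u q : ℕ → ℕ),
    (fun n => (w n : ℝ)) =O[atTop] (fun n : ℕ => Real.log n) ∧
    (fun n => (p n : ℝ)) =O[atTop] (fun n : ℕ => (n : ℝ) ^ t) ∧
    (fun n => (u n : ℝ)) =O[atTop] (fun n : ℕ => (n : ℝ) ^ e) ∧
    (fun n => (q n : ℝ)) =O[atTop] (fun n : ℕ => (n : ℝ) ^ e) ∧
    A.ApproximatesRadius S M α c k w p u q

end

/-! A fast dynamic algorithm would decide 3-HS too quickly for |U| = |V| = n and |W| = n^t. The
instance becomes one dynamic graph on N = Θ(n(d+1)) vertices, and each vector w of W becomes a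
stage: at most d updates and one query.

The gap. Choose q with (2-ε)(q+2) < 2q. A hub feeds four blocks of paths with q vertices, except the
paths of block 2 that stand for V. The ends of block 0 stand for U, the ends of blocks 1 and 3 for
two copies of the coordinates. Only the edges between the two copies depend on w. If some u together
with w hits all of V, then the end of the path of u reaches every vertex within q+2 steps
(`radius_le`): it is next to the hub, and it has a route over the coordinates to each path of V. If
not, every eccentricity is at least 2q (`le_radius`), as a function that drops by at most 1 along
edges shows. So a (2-ε)-approximation decides the stage. There are O(N) edges, and padding makes N
large enough for the sparsity bound.

The return to the basic graph. With both kinds of updates, the insertions of a stage are deleted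
again. With one kind only, the memory of the algorithm is rolled back to its state after the
preprocessing. This takes constant time, because the algorithm is simulated on arrays whose changed
cells carry stamps: raising the current stamp voids all changes of a layer (`SimRel`,
`costU_sim_le`, `runs_restore`). Restarting from the same state many times is harmless for
worst-case bounds; amortized bounds would allow saved time to be spent repeatedly.

Errors. Single answers are right with probability 2/3 only, so O(log n) rounds with fresh randomness
are run, and a majority is taken in each stage. In place of a tail bound each stage has a score,
multiplied by 3/2 for a wrong and by 2/3 for a right answer. A round changes its expectation by a
factor of at most 1/3 · 3/2 + 2/3 · 2/3 = 17/18. By linearity the sum of all scores shrinks by this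
factor, however dependent the stages of one round are (`Sound.improves`, `costU_rounds`). A wrong
final answer forces some score to be at least 1 (`costU_finish`), so the final expected sum bounds
the error. The operations depend on the instance and never on answers, so guarantees for fixed
sequences suffice.

Time. A round takes N^t + n^t · d · N^(2-ε') steps up to constants. This is n^(t+2-ε') poly(d) for
ε' ≤ 1, and half of ε' pays for the number of rounds.

Programs are treated by a calculus of expected costs: a run that may fail costs infinity, and
executing a command is an inequality between costs before and after it (`Reaches`, `Runs`). Hence
termination, time and error probability are bounded together. -/

noncomputable section

open WordRAM
open scoped ENNReal

/-! ## Expected costs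

A failing run has infinite cost, so that a finite expected cost certifies termination. -/

/-- The expected value of `g` under `μ`, where the outcome `none` counts as infinite. -/
def ex {X : Type*} (μ : PMF (Option X)) (g : X → ℝ≥0∞) : ℝ≥0∞ :=
  ∑' r, μ r * r.elim ⊤ g

section ex

variable {X Y : Type*}

theorem ex_pure_some (x : X) (g : X → ℝ≥0∞) : ex (PMF.pure (some x)) g = g x := by
  unfold ex
  rw [tsum_eq_single (some x)]
  · simp
  · intro b hb
    simp [PMF.pure_apply, hb]

theorem ex_pure_none (g : X → ℝ≥0∞) : ex (PMF.pure none) g = ⊤ := by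
  unfold ex
  rw [tsum_eq_single none]
  · simp
  · intro b hb
    simp [PMF.pure_apply, hb]

theorem ex_bind {Z : Type*} (μ : PMF Z) (ν : Z → PMF (Option X)) (g : X → ℝ≥0∞) :
    ex (μ.bind ν) g = ∑' a, μ a * ex (ν a) g := by
  unfold ex
  simp only [PMF.bind_apply, ← ENNReal.tsum_mul_right, ← ENNReal.tsum_mul_left]
  rw [ENNReal.tsum_comm]
  simp only [mul_assoc]

/-- `κ` is separated from `ν` so that the pattern matches in `DynAlg.serve` and `DynAlg.session` can
be plugged in as they stand. -/
theorem ex_bind_option (μ : PMF (Option X)) {κ : Option X → PMF (Option Y)} (ν : X → PMF (Option Y))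
    (h₀ : κ none = PMF.pure none) (h₁ : ∀ x, κ (some x) = ν x) (g : Y → ℝ≥0∞) :
    ex (μ.bind κ) g = ex μ fun y => ex (ν y) g := by
  rw [ex_bind]
  unfold ex
  refine tsum_congr fun a => ?_
  congr 1
  cases a with
  | none => rw [h₀]; exact ex_pure_none g
  | some y => rw [h₁]; rfl

theorem ex_mono (μ : PMF (Option X)) {g g' : X → ℝ≥0∞} (h : ∀ x, g x ≤ g' x) :
    ex μ g ≤ ex μ g' := by
  refine ENNReal.tsum_le_tsum fun r => mul_le_mul_right ?_ _
  cases r with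
  | none => exact le_rfl
  | some x => exact h x

theorem ex_add (μ : PMF (Option X)) (g g' : X → ℝ≥0∞) :
    ex μ (fun x => g x + g' x) = ex μ g + ex μ g' := by
  unfold ex
  rw [← ENNReal.tsum_add]
  refine tsum_congr fun r => ?_
  rw [← mul_add]
  cases r <;> simp

theorem ex_const (μ : PMF (Option X)) (h : none ∉ μ.support) (c : ℝ≥0∞) :
    ex μ (fun _ => c) = c := by
  unfold ex
  have h0 : μ none = 0 := by simpa [PMF.mem_support_iff] using h
  calc ∑' r, μ r * r.elim ⊤ (fun _ => c) = ∑' r, μ r * c := by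
        refine tsum_congr fun r => ?_
        cases r with
        | none => simp [h0]
        | some x => rfl
    _ = c := by rw [ENNReal.tsum_mul_right, μ.tsum_coe, one_mul]

/-- The factor 0 is excluded because it does not scale the infinite cost of a failure: the integrand
is still infinite at `none`. -/
theorem ex_const_mul (μ : PMF (Option X)) {c : ℝ≥0∞} (hc : c ≠ 0) (g : X → ℝ≥0∞) :
    ex μ (fun x => c * g x) = c * ex μ g := by
  unfold ex
  rw [← ENNReal.tsum_mul_left]
  refine tsum_congr fun r => ?_
  cases r with
  | none => simp [ENNReal.mul_top hc, mul_left_comm c]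
  | some x => simp [mul_left_comm c]

theorem none_notMem_of_ex_lt_top {μ : PMF (Option X)} {g : X → ℝ≥0∞} (h : ex μ g < ⊤) :
    none ∉ μ.support := by
  intro hn
  have h0 : μ none ≠ 0 := by simpa [PMF.mem_support_iff] using hn
  have := ENNReal.le_tsum (f := fun r => μ r * r.elim ⊤ g) none
  simp only [Option.elim_none, ENNReal.mul_top h0, top_le_iff] at this
  exact h.ne this

end ex

namespace WordRAM

/-! ## Costs of configurations -/

/-- The expected value of `f` in the final store, infinite if the machine may fail to halt within
`T` steps. -/
def cost (B T : ℕ) (k : List Cmd) (s : Store) (f : Store → ℝ≥0∞) : ℝ≥0∞ :=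
  ex (exec B T ⟨k, s⟩) fun x => f x.1

theorem exec_nil (B T : ℕ) (s : Store) : exec B T ⟨[], s⟩ = PMF.pure (some (s, T)) := by
  cases T <;> rfl

theorem exec_zero (B : ℕ) (c : Cmd) (k : List Cmd) (s : Store) :
    exec B 0 ⟨c :: k, s⟩ = PMF.pure none := rfl

theorem exec_succ (B T : ℕ) (c : Cmd) (k : List Cmd) (s : Store) :
    exec B (T + 1) ⟨c :: k, s⟩ = (step B c k s).bind (exec B T) := rfl

theorem cost_nil (B T : ℕ) (s : Store) (f : Store → ℝ≥0∞) : cost B T [] s f = f s := by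
  rw [cost, exec_nil, ex_pure_some]

theorem cost_zero (B : ℕ) (c : Cmd) (k : List Cmd) (s : Store) (f : Store → ℝ≥0∞) :
    cost B 0 (c :: k) s f = ⊤ := by
  rw [cost, exec_zero, ex_pure_none]

theorem cost_succ (B T : ℕ) (c : Cmd) (k : List Cmd) (s : Store) (f : Store → ℝ≥0∞) :
    cost B (T + 1) (c :: k) s f = ∑' x, step B c k s x * cost B T x.todo x.mem f := by
  rw [cost, exec_succ, ex_bind]
  rfl

theorem tsum_pure_mul {X : Type*} (x : X) (h : X → ℝ≥0∞) : ∑' y, PMF.pure x y * h y = h x := by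
  rw [tsum_eq_single x]
  · simp
  · intro b hb
    simp [PMF.pure_apply, hb]

theorem cost_succ_of_pure {B T : ℕ} {c : Cmd} {k : List Cmd} {s : Store} {x : Config}
    (h : step B c k s = PMF.pure x) (f : Store → ℝ≥0∞) :
    cost B (T + 1) (c :: k) s f = cost B T x.todo x.mem f := by
  rw [cost_succ, h, tsum_pure_mul]

/-- An additional step can only turn a failure, whose cost is infinite, into an outcome. -/
theorem cost_succ_le (B : ℕ) (f : Store → ℝ≥0∞) (T : ℕ) :
    ∀ (k : List Cmd) (s : Store), cost B (T + 1) k s f ≤ cost B T k s f := by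
  induction T with
  | zero =>
    intro k s
    cases k with
    | nil => simp [cost_nil]
    | cons c k => simp [cost_zero]
  | succ T ih =>
    intro k s
    cases k with
    | nil => simp [cost_nil]
    | cons c k =>
      rw [cost_succ, cost_succ B T]
      exact ENNReal.tsum_le_tsum fun x => mul_le_mul_right (ih _ _) _

theorem cost_anti {B T T' : ℕ} (h : T ≤ T') (k : List Cmd) (s : Store) (f : Store → ℝ≥0∞) :
    cost B T' k s f ≤ cost B T k s f := by
  induction h with
  | refl => exact le_rfl
  | step _ ih => exact (cost_succ_le B f _ k s).trans ih

/-- A command that may leave the configuration as it is, cannot be guaranteed to halt. -/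
theorem ex_exec_eq_top {B : ℕ} {c : Cmd} {k : List Cmd} {s : Store}
    (h : step B c k s ⟨c :: k, s⟩ ≠ 0) (T : ℕ) (g : Store × ℕ → ℝ≥0∞) :
    ex (exec B T ⟨c :: k, s⟩) g = ⊤ := by
  induction T with
  | zero => rw [exec_zero, ex_pure_none]
  | succ T ih =>
    rw [exec_succ, ex_bind, eq_top_iff]
    -- The self-loop has positive probability and, by induction, leads to infinite cost; this one
    -- summand is already infinite.
    calc (⊤ : ℝ≥0∞) = step B c k s ⟨c :: k, s⟩ * ex (exec B T ⟨c :: k, s⟩) g := by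
          rw [ih, ENNReal.mul_top h]
      _ ≤ _ := ENNReal.le_tsum (f := fun a => step B c k s a * ex (exec B T a) g) _

/-! ## Stores up to scratch registers -/

/-- The stores agree except for the registers from `t` on. -/
def Agree (t : ℕ) (s s' : Store) : Prop :=
  s'.arr = s.arr ∧ ∀ x < t, s'.var x = s.var x

theorem Agree.refl (t : ℕ) (s : Store) : Agree t s s := ⟨rfl, fun _ _ => rfl⟩

theorem Agree.trans {t : ℕ} {s s' s'' : Store} (h : Agree t s s') (h' : Agree t s' s'') :
    Agree t s s'' :=
  ⟨h'.1.trans h.1, fun x hx => (h'.2 x hx).trans (h.2 x hx)⟩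

theorem Agree.setVar {t : ℕ} {s s' : Store} (h : Agree t s s') (x v : ℕ) :
    Agree t (s.setVar x v) (s'.setVar x v) := by
  refine ⟨h.1, fun y hy => ?_⟩
  by_cases hxy : y = x
  · subst hxy; simp [Store.setVar]
  · simp [Store.setVar, hxy, h.2 y hy]

theorem Agree.setVar_of_le {t : ℕ} {s s' : Store} (h : Agree t s s') {x : ℕ} (hx : t ≤ x) (v : ℕ) :
    Agree t s (s'.setVar x v) := by
  refine ⟨h.1, fun y hy => ?_⟩
  have : y ≠ x := by omega
  simp [Store.setVar, this, h.2 y hy]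

theorem Agree.setArr {t : ℕ} {s s' : Store} (h : Agree t s s') (a i v : ℕ) :
    Agree t (s.setArr a i v) (s'.setArr a i v) :=
  ⟨by simp [Store.setArr, h.1], h.2⟩

/-- The cost, whatever the contents of the registers from `t` on. -/
def costU (t B T : ℕ) (k : List Cmd) (s : Store) (f : Store → ℝ≥0∞) : ℝ≥0∞ :=
  ⨆ (s' : Store) (_ : Agree t s s'), cost B T k s' f

theorem cost_le_costU {t B T : ℕ} {k : List Cmd} {s s' : Store} {f : Store → ℝ≥0∞}
    (h : Agree t s s') : cost B T k s' f ≤ costU t B T k s f :=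
  le_iSup₂_of_le s' h le_rfl

theorem costU_le {t B T : ℕ} {k : List Cmd} {s : Store} {f : Store → ℝ≥0∞} {y : ℝ≥0∞}
    (h : ∀ s', Agree t s s' → cost B T k s' f ≤ y) : costU t B T k s f ≤ y :=
  iSup₂_le h

theorem costU_anti {t B T T' : ℕ} (h : T ≤ T') (k : List Cmd) (s : Store) (f : Store → ℝ≥0∞) :
    costU t B T' k s f ≤ costU t B T k s f :=
  costU_le fun _ hs => (cost_anti h _ _ _).trans (cost_le_costU hs)

/-- In at most `n` steps the first configuration always reaches the second one, up to the
registers from `t` on. -/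
def Reaches (t B n : ℕ) (k : List Cmd) (s : Store) (k' : List Cmd) (s' : Store) : Prop :=
  ∀ T f, costU t B (T + n) k s f ≤ costU t B T k' s' f

/-- The command `c` always runs from `s` to `s'` in at most `n` steps, up to the registers from
`t` on. -/
def Runs (t B : ℕ) (c : Cmd) (s : Store) (n : ℕ) (s' : Store) : Prop :=
  ∀ k, Reaches t B n (c :: k) s k s'

theorem Reaches.trans {t B n n' : ℕ} {k k' k'' : List Cmd} {s s' s'' : Store}
    (h : Reaches t B n k s k' s') (h' : Reaches t B n' k' s' k'' s'') :
    Reaches t B (n + n') k s k'' s'' := fun T f => by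
  have := h (T + n') f
  rw [add_assoc, add_comm n'] at this
  exact this.trans (h' T f)

theorem Reaches.mono {t B n n' : ℕ} {k k' : List Cmd} {s s' : Store}
    (h : Reaches t B n k s k' s') (hn : n ≤ n') : Reaches t B n' k s k' s' := fun T f =>
  (costU_anti (by omega) _ _ _).trans (h T f)

theorem Reaches.refl (t B : ℕ) (k : List Cmd) (s : Store) : Reaches t B 0 k s k s :=
  fun _ _ => le_rfl

theorem Runs.mono {t B n n' : ℕ} {c : Cmd} {s s' : Store} (h : Runs t B c s n s') (hn : n ≤ n') :
    Runs t B c s n' s' := fun k => (h k).mono hn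

/-- Passing to a configuration reached by one step, whose store is known only up to scratch. -/
theorem reaches_of_step {t B : ℕ} {c : Cmd} {k k' : List Cmd} {s s' : Store}
    (h : ∀ s₁, Agree t s s₁ → ∃ s₂, step B c k s₁ = PMF.pure ⟨k', s₂⟩ ∧ Agree t s' s₂) :
    Reaches t B 1 (c :: k) s k' s' := fun T f => costU_le fun s₁ hs => by
  obtain ⟨s₂, h1, h2⟩ := h s₁ hs
  rw [cost_succ_of_pure h1]
  exact cost_le_costU h2

theorem Runs.skip (t B : ℕ) (s : Store) : Runs t B .skip s 1 s := fun _ =>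
  reaches_of_step fun s₁ hs => ⟨s₁, rfl, hs⟩

theorem Runs.const {t B x v : ℕ} (s : Store) (hv : v < B) :
    Runs t B (.const x v) s 1 (s.setVar x v) := fun _ =>
  reaches_of_step fun s₁ hs => ⟨s₁.setVar x v, by simp [step, assign, hv], hs.setVar x v⟩

theorem Runs.copy {t B x y : ℕ} {s : Store} (hy : y < t) (hv : s.var y < B) :
    Runs t B (.copy x y) s 1 (s.setVar x (s.var y)) := fun _ =>
  reaches_of_step fun s₁ hs => ⟨s₁.setVar x (s.var y), by simp [step, assign, hs.2 y hy, hv],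
    hs.setVar x _⟩

theorem Runs.op {t B x y z : ℕ} {o : BinOp} {s : Store} (hy : y < t) (hz : z < t)
    (hv : o.eval (s.var y) (s.var z) < B) :
    Runs t B (.op o x y z) s 1 (s.setVar x (o.eval (s.var y) (s.var z))) := fun _ =>
  reaches_of_step fun s₁ hs => ⟨s₁.setVar x (o.eval (s.var y) (s.var z)),
    by simp [step, assign, hs.2 y hy, hs.2 z hz, hv], hs.setVar x _⟩

theorem Runs.load {t B x a y : ℕ} {s : Store} (hy : y < t) (hv : s.arr a (s.var y) < B) :
    Runs t B (.load x a y) s 1 (s.setVar x (s.arr a (s.var y))) := fun _ =>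
  reaches_of_step fun s₁ hs => ⟨s₁.setVar x (s.arr a (s.var y)),
    by simp [step, assign, hs.2 y hy, hs.1, hv], hs.setVar x _⟩

theorem Runs.store {t B a x y : ℕ} {s : Store} (hx : x < t) (hy : y < t) :
    Runs t B (.store a x y) s 1 (s.setArr a (s.var x) (s.var y)) := fun _ =>
  reaches_of_step fun s₁ hs => ⟨s₁.setArr a (s.var x) (s.var y),
    by simp [step, hs.2 y hy, hs.2 x hx], hs.setArr a _ _⟩

theorem reaches_seq (t B : ℕ) (c d : Cmd) (k : List Cmd) (s : Store) :
    Reaches t B 1 (.seq c d :: k) s (c :: d :: k) s :=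
  reaches_of_step fun s₁ hs => ⟨s₁, rfl, hs⟩

theorem reaches_ite {t B x : ℕ} {s : Store} (hx : x < t) (c d : Cmd) (k : List Cmd) :
    Reaches t B 1 (.ite x c d :: k) s ((if s.var x ≠ 0 then c else d) :: k) s :=
  reaches_of_step fun s₁ hs => ⟨s₁, by simp [step, hs.2 x hx], hs⟩

theorem Runs.seq {t B n n' : ℕ} {c d : Cmd} {s s' s'' : Store} (h : Runs t B c s n s')
    (h' : Runs t B d s' n' s'') : Runs t B (.seq c d) s (n + n' + 1) s'' := fun k =>
  ((reaches_seq t B c d k s).trans ((h _).trans (h' k))).mono (by omega)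

/-! ## Expressions -/

/-- Arithmetic expressions over registers and arrays. -/
inductive Expr
  | reg (x : ℕ)
  | num (v : ℕ)
  | bin (o : BinOp) (e e' : Expr)
  | get (a : ℕ) (e : Expr)

namespace Expr

/-- The value of an expression. -/
def eval (s : Store) : Expr → ℕ
  | reg x => s.var x
  | num v => v
  | bin o e e' => o.eval (e.eval s) (e'.eval s)
  | get a e => s.arr a (e.eval s)

/-- Evaluate an expression into register `t`, with scratch registers from `t` on. -/
def compile : Expr → ℕ → Cmd
  | reg x, t => .copy t x
  | num v, t => .const t v
  | bin o e e', t => .seq (e.compile t) (.seq (e'.compile (t + 1)) (.op o t t (t + 1)))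
  | get a e, t => .seq (e.compile t) (.load t a t)

/-- The number of steps of an evaluation. -/
def time : Expr → ℕ
  | reg _ => 1
  | num _ => 1
  | bin _ e e' => e.time + e'.time + 3
  | get _ e => e.time + 2

/-- Only registers below `t` are read, and all intermediate values are words. -/
def Fits (t B : ℕ) (s : Store) : Expr → Prop
  | reg x => x < t ∧ s.var x < B
  | num v => v < B
  | bin o e e' => e.Fits t B s ∧ e'.Fits t B s ∧ o.eval (e.eval s) (e'.eval s) < B
  | get a e => e.Fits t B s ∧ s.arr a (e.eval s) < B

theorem eval_congr {t B : ℕ} {s s' : Store} (h : Agree t s s') {e : Expr} (he : e.Fits t B s) :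
    e.eval s' = e.eval s := by
  induction e with
  | reg x => exact h.2 x he.1
  | num v => rfl
  | bin o e e' ih ih' => simp [eval, ih he.1, ih' he.2.1]
  | get a e ih => simp [eval, ih he.1, h.1]

theorem Fits.congr {t B : ℕ} {s s' : Store} (h : Agree t s s') {e : Expr} (he : e.Fits t B s) :
    e.Fits t B s' := by
  induction e with
  | reg x => exact ⟨he.1, by rw [h.2 x he.1]; exact he.2⟩
  | num v => exact he
  | bin o e e' ih ih' =>
    refine ⟨ih he.1, ih' he.2.1, ?_⟩
    rw [eval_congr h he.1, eval_congr h he.2.1]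
    exact he.2.2
  | get a e ih =>
    refine ⟨ih he.1, ?_⟩
    rw [eval_congr h he.1, h.1]
    exact he.2

/-- The scratch registers act as a stack: the second operand is evaluated from `t' + 1` on, so the
first one survives in `t'`. Since evaluation is deterministic, the costs are equal and not merely
comparable. -/
theorem compile_spec {t B : ℕ} (e : Expr) :
    ∀ {t' : ℕ}, t ≤ t' → ∀ {s : Store}, e.Fits t B s → ∃ s', Agree t' s s' ∧
      s'.var t' = e.eval s ∧
      ∀ T k f, cost B (T + e.time) (e.compile t' :: k) s f = cost B T k s' f := by
  induction e with
  | reg x =>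
    intro t' ht s h
    refine ⟨s.setVar t' (s.var x), (Agree.refl _ _).setVar_of_le le_rfl _,
      by simp [Store.setVar, eval],
      fun T k f => ?_⟩
    exact cost_succ_of_pure (x := ⟨k, s.setVar t' (s.var x)⟩) (by simp [step, assign, compile, h.2]) f
  | num v =>
    intro t' ht s h
    refine ⟨s.setVar t' v, (Agree.refl _ _).setVar_of_le le_rfl _,
      by simp [Store.setVar, eval],
      fun T k f => ?_⟩
    exact cost_succ_of_pure (x := ⟨k, s.setVar t' v⟩)
      (by simp [step, assign, compile, show v < B from h]) f
  | bin o e e' ih ih' =>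
    intro t' ht s h
    obtain ⟨s₁, a₁, v₁, c₁⟩ := ih ht h.1
    have a₁' : Agree t s s₁ := ⟨a₁.1, fun x hx => a₁.2 x (by omega)⟩
    obtain ⟨s₂, a₂, v₂, c₂⟩ := ih' (t' := t' + 1) (by omega) (h.2.1.congr a₁')
    have v₁' : s₂.var t' = e.eval s := by rw [a₂.2 t' (by omega), v₁]
    rw [eval_congr a₁' h.2.1] at v₂
    refine ⟨s₂.setVar t' (o.eval (e.eval s) (e'.eval s)), ?_, by simp [Store.setVar, eval],
      fun T k f => ?_⟩
    · exact (a₁.trans ⟨a₂.1, fun x hx => a₂.2 x (by omega)⟩).setVar_of_le le_rfl _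
    · have e1 : T + (bin o e e').time = (((T + 1) + e'.time) + 1 + e.time) + 1 := by
        simp only [time]; omega
      rw [e1, compile, cost_succ_of_pure (x := ⟨_, s⟩) rfl, c₁,
        cost_succ_of_pure (x := ⟨_, s₁⟩) rfl, c₂]
      exact cost_succ_of_pure (x := ⟨k, s₂.setVar t' (o.eval (e.eval s) (e'.eval s))⟩)
        (by simp [step, assign, v₁', v₂, h.2.2]) f
  | get a e ih =>
    intro t' ht s h
    obtain ⟨s₁, a₁, v₁, c₁⟩ := ih ht h.1
    refine ⟨s₁.setVar t' (s.arr a (e.eval s)), a₁.setVar_of_le le_rfl _,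
      by simp [Store.setVar, eval], fun T k f => ?_⟩
    have e1 : T + (get a e).time = ((T + 1) + e.time) + 1 := by simp only [time]; omega
    rw [e1, compile, cost_succ_of_pure (x := ⟨_, s⟩) rfl, c₁]
    exact cost_succ_of_pure (x := ⟨k, s₁.setVar t' (s.arr a (e.eval s))⟩)
      (by simp [step, assign, v₁, a₁.1, h.2]) f

end Expr

/-! ## Derived commands -/

/-- `x := e` -/
def Cmd.set (t x : ℕ) (e : Expr) : Cmd := .seq (e.compile t) (.copy x t)

/-- `a[i] := e` -/
def Cmd.put (t a : ℕ) (i e : Expr) : Cmd :=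
  .seq (i.compile t) (.seq (e.compile (t + 1)) (.store a t (t + 1)))

/-- `if e ≠ 0 then c else d` -/
def Cmd.cond (t : ℕ) (e : Expr) (c d : Cmd) : Cmd := .seq (e.compile t) (.ite t c d)

/-- `while e ≠ 0 do c` -/
def Cmd.while (t : ℕ) (e : Expr) (c : Cmd) : Cmd :=
  .seq (e.compile t) (.loop t (.seq c (e.compile t)))

/-- What is left to do at the head of a while loop. -/
def whileTail (t : ℕ) (e : Expr) (c : Cmd) (k : List Cmd) : List Cmd :=
  e.compile t :: .loop t (.seq c (e.compile t)) :: k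

theorem Runs.set {t B x : ℕ} {e : Expr} {s : Store} (h : e.Fits t B s) (hv : e.eval s < B) :
    Runs t B (.set t x e) s (e.time + 2) (s.setVar x (e.eval s)) := fun k T f =>
  costU_le fun s₁ hs => by
    obtain ⟨s₂, a₂, v₂, c₂⟩ := e.compile_spec le_rfl (h.congr hs)
    rw [Expr.eval_congr hs h] at v₂
    rw [show T + (e.time + 2) = ((T + 1) + e.time) + 1 by omega, Cmd.set,
      cost_succ_of_pure (x := ⟨_, s₁⟩) rfl, c₂,
      cost_succ_of_pure (x := ⟨k, s₂.setVar x (e.eval s)⟩) (by simp [step, assign, v₂, hv])]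
    exact cost_le_costU ((hs.trans a₂).setVar x _)

theorem Runs.put {t B a : ℕ} {i e : Expr} {s : Store} (hi : i.Fits t B s) (he : e.Fits t B s) :
    Runs t B (.put t a i e) s (i.time + e.time + 3) (s.setArr a (i.eval s) (e.eval s)) :=
  fun k T f => costU_le fun s₁ hs => by
    obtain ⟨s₂, a₂, v₂, c₂⟩ := i.compile_spec le_rfl (hi.congr hs)
    rw [Expr.eval_congr hs hi] at v₂
    have a₂' := hs.trans a₂
    obtain ⟨s₃, a₃, v₃, c₃⟩ := e.compile_spec (t' := t + 1) (by omega) (he.congr a₂')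
    rw [Expr.eval_congr a₂' he] at v₃
    rw [show T + (i.time + e.time + 3) = (((T + 1) + e.time) + 1 + i.time) + 1 by omega, Cmd.put,
      cost_succ_of_pure (x := ⟨_, s₁⟩) rfl, c₂, cost_succ_of_pure (x := ⟨_, s₂⟩) rfl, c₃,
      cost_succ_of_pure (x := ⟨k, s₃.setArr a (i.eval s) (e.eval s)⟩)
        (by simp [step, v₃, a₃.2 t (by omega), v₂])]
    exact cost_le_costU ((a₂'.trans ⟨a₃.1, fun x hx => a₃.2 x (by omega)⟩).setArr a _ _)

/-- The common core of `Cmd.cond` and `Cmd.while`: `c` is the branching command that reads the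
freshly computed value in register `t`. -/
theorem reaches_compile {t B : ℕ} {e : Expr} {s : Store} (h : e.Fits t B s) {c : Cmd}
    {k k' : List Cmd} (hs : ∀ s₁, s₁.var t = e.eval s →
      step B c k s₁ = PMF.pure ⟨k', s₁⟩) :
    Reaches t B (e.time + 1) (e.compile t :: c :: k) s k' s := fun T f =>
  costU_le fun s₁ hs₁ => by
    obtain ⟨s₂, a₂, v₂, c₂⟩ := e.compile_spec le_rfl (h.congr hs₁)
    rw [Expr.eval_congr hs₁ h] at v₂
    rw [show T + (e.time + 1) = (T + 1) + e.time by omega, c₂, cost_succ_of_pure (hs s₂ v₂)]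
    exact cost_le_costU (hs₁.trans a₂)

theorem reaches_cond {t B : ℕ} {e : Expr} {s : Store} (h : e.Fits t B s) (c d : Cmd)
    (k : List Cmd) :
    Reaches t B (e.time + 2) (.cond t e c d :: k) s ((if e.eval s ≠ 0 then c else d) :: k) s :=
  ((reaches_seq _ _ _ _ _ _).trans (reaches_compile h fun s₁ hs => by
    simp [step, hs])).mono (by omega)

theorem Runs.cond_true {t B n : ℕ} {e : Expr} {s s' : Store} {c d : Cmd} (h : e.Fits t B s)
    (h0 : e.eval s ≠ 0) (hc : Runs t B c s n s') : Runs t B (.cond t e c d) s (e.time + 2 + n) s' :=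
  fun k => (by simpa [h0] using reaches_cond h c d k : Reaches _ _ _ _ _ (c :: k) s).trans (hc k)

theorem Runs.cond_false {t B n : ℕ} {e : Expr} {s s' : Store} {c d : Cmd} (h : e.Fits t B s)
    (h0 : e.eval s = 0) (hd : Runs t B d s n s') :
    Runs t B (.cond t e c d) s (e.time + 2 + n) s' :=
  fun k => (by simpa [h0] using reaches_cond h c d k : Reaches _ _ _ _ _ (d :: k) s).trans (hd k)

theorem reaches_while (t B : ℕ) (e : Expr) (c : Cmd) (k : List Cmd) (s : Store) :
    Reaches t B 1 (.while t e c :: k) s (whileTail t e c k) s :=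
  reaches_seq _ _ _ _ _ _

theorem reaches_whileTail {t B : ℕ} {e : Expr} {s : Store} (h : e.Fits t B s) (c : Cmd)
    (k : List Cmd) (h0 : e.eval s ≠ 0) :
    Reaches t B (e.time + 2) (whileTail t e c k) s (c :: whileTail t e c k) s :=
  ((reaches_compile h fun s₁ hs => by simp [step, hs, h0]).trans
    (reaches_seq _ _ _ _ _ _)).mono (by omega)

theorem reaches_whileTail_end {t B : ℕ} {e : Expr} {s : Store} (h : e.Fits t B s) (c : Cmd)
    (k : List Cmd) (h0 : e.eval s = 0) :
    Reaches t B (e.time + 1) (whileTail t e c k) s k s :=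
  reaches_compile h fun s₁ hs => by simp [step, hs, h0]

/-- The rule for deterministic loops. -/
theorem Runs.while {t B n m : ℕ} {e : Expr} {c : Cmd} (st : ℕ → Store)
    (hf : ∀ i ≤ m, e.Fits t B (st i)) (h0 : ∀ i < m, e.eval (st i) ≠ 0) (hm : e.eval (st m) = 0)
    (hc : ∀ i < m, Runs t B c (st i) n (st (i + 1))) :
    Runs t B (.while t e c) (st 0) (m * (n + e.time + 2) + e.time + 2) (st m) := fun k => by
  have key : ∀ j ≤ m, Reaches t B (j * (n + e.time + 2)) (whileTail t e c k) (st 0)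
      (whileTail t e c k) (st j) := by
    intro j
    induction j with
    | zero => intro _; simpa using Reaches.refl _ _ _ _
    | succ j ih =>
      intro hj
      refine ((ih (by omega)).trans ((reaches_whileTail (hf j (by omega)) c k (h0 j hj)).trans
        (hc j hj _))).mono ?_
      rw [add_mul]; omega
  exact ((reaches_while t B e c k _).trans ((key m le_rfl).trans
    (reaches_whileTail_end (hf m le_rfl) c k hm))).mono (by omega)

end WordRAM

namespace WordRAM

/-! ## Simulating a program with a memory that can be rolled back

The registers of the simulated program are shifted by 40, and each of its arrays is represented by
five arrays: the initial contents, and two layers of changed cells.  A cell of a layer is valid if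
its stamp is current; the current stamps are kept in registers 31 and 32. -/

/-- All registers and arrays of a program have numbers below `ρ`. -/
def Cmd.Below (ρ : ℕ) : Cmd → Prop
  | .skip => True
  | .const x _ => x < ρ
  | .copy x y => x < ρ ∧ y < ρ
  | .op _ x y z => x < ρ ∧ y < ρ ∧ z < ρ
  | .load x a y => x < ρ ∧ a < ρ ∧ y < ρ
  | .store a x y => a < ρ ∧ x < ρ ∧ y < ρ
  | .flip x => x < ρ
  | .seq c d => c.Below ρ ∧ d.Below ρ
  | .ite x c d => x < ρ ∧ c.Below ρ ∧ d.Below ρ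
  | .loop x c => x < ρ ∧ c.Below ρ

theorem Cmd.Below.mono {ρ ρ' : ℕ} (h : ρ ≤ ρ') {c : Cmd} (hc : c.Below ρ) : c.Below ρ' := by
  induction c with
  | skip => trivial
  | seq c d ih ih' => exact ⟨ih hc.1, ih' hc.2⟩
  | ite x c d ih ih' => exact ⟨lt_of_lt_of_le hc.1 h, ih hc.2.1, ih' hc.2.2⟩
  | loop x c ih => exact ⟨lt_of_lt_of_le hc.1 h, ih hc.2⟩
  | _ => simp only [Cmd.Below] at hc ⊢; omega

theorem Cmd.exists_below (c : Cmd) : ∃ ρ, c.Below ρ := by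
  induction c with
  | skip => exact ⟨0, trivial⟩
  | const x v => exact ⟨x + 1, Nat.lt_succ_self x⟩
  | copy x y => exact ⟨x + y + 1, by simp only [Cmd.Below]; omega⟩
  | op o x y z => exact ⟨x + y + z + 1, by simp only [Cmd.Below]; omega⟩
  | load x a y => exact ⟨x + a + y + 1, by simp only [Cmd.Below]; omega⟩
  | store a x y => exact ⟨a + x + y + 1, by simp only [Cmd.Below]; omega⟩
  | flip x => exact ⟨x + 1, Nat.lt_succ_self x⟩
  | seq c d ih ih' =>
    obtain ⟨a, ha⟩ := ih
    obtain ⟨b, hb⟩ := ih'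
    exact ⟨max a b, ha.mono (le_max_left _ _), hb.mono (le_max_right _ _)⟩
  | ite x c d ih ih' =>
    obtain ⟨a, ha⟩ := ih
    obtain ⟨b, hb⟩ := ih'
    exact ⟨max (x + 1) (max a b), by simp, ha.mono (by simp), hb.mono (by simp)⟩
  | loop x c ih =>
    obtain ⟨a, ha⟩ := ih
    exact ⟨max (x + 1) a, by simp, ha.mono (by simp)⟩

/-- The register with the current stamp of the upper or lower layer. -/
def stampReg (up : Bool) : ℕ := if up then 31 else 32

/-- The array with the values of a layer. -/
def layer (up : Bool) (a : ℕ) : ℕ := if up then 13 + 5 * a else 11 + 5 * a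

/-- An expression that is zero iff the cell of the layer is valid. -/
def staleExpr (up : Bool) (a y : ℕ) : Expr :=
  .bin .minus (.reg (stampReg up)) (.get (layer up a + 1) (.reg (y + 40)))

/-- The program that simulates a program, storing in the upper or the lower layer. -/
def simCmd (t : ℕ) (up : Bool) : Cmd → Cmd
  | .skip => .skip
  | .const x v => .const (x + 40) v
  | .copy x y => .copy (x + 40) (y + 40)
  | .op o x y z => .op o (x + 40) (y + 40) (z + 40)
  | .load x a y => .cond t (staleExpr true a y)
      (.cond t (staleExpr false a y) (.load (x + 40) (10 + 5 * a) (y + 40))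
        (.load (x + 40) (layer false a) (y + 40)))
      (.load (x + 40) (layer true a) (y + 40))
  | .store a x y => .seq (.store (layer up a) (x + 40) (y + 40))
      (.store (layer up a + 1) (x + 40) (stampReg up))
  | .flip x => .flip (x + 40)
  | .seq c d => .seq (simCmd t up c) (simCmd t up d)
  | .ite x c d => .ite (x + 40) (simCmd t up c) (simCmd t up d)
  | .loop x c => .loop (x + 40) (simCmd t up c)

/-- The contents of the simulated array `a`. -/
def view (s : Store) (a i : ℕ) : ℕ :=
  if s.var 31 ≤ s.arr (14 + 5 * a) i then s.arr (13 + 5 * a) i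
  else if s.var 32 ≤ s.arr (12 + 5 * a) i then s.arr (11 + 5 * a) i
  else s.arr (10 + 5 * a) i

/-- The store `s'` represents the store `s` of the simulated program, whose registers hold words. -/
def SimRel (ρ B : ℕ) (s s' : Store) : Prop :=
  (∀ x < ρ, s'.var (x + 40) = s.var x ∧ s.var x < B) ∧ ∀ a < ρ, ∀ i, view s' a i = s.arr a i

/-- What a simulated program (and a loop with counter 29 around it) does not change. -/
structure SimFrame (up : Bool) (ρ : ℕ) (s s' : Store) : Prop where
  var : ∀ x, x ≠ 29 → (x < 40 ∨ 40 + ρ ≤ x) → s'.var x = s.var x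
  low : ∀ a < 10, s'.arr a = s.arr a
  init : ∀ a, s'.arr (10 + 5 * a) = s.arr (10 + 5 * a)
  other : ∀ a, s'.arr (layer (!up) a) = s.arr (layer (!up) a)
  otherStamp : ∀ a, s'.arr (layer (!up) a + 1) = s.arr (layer (!up) a + 1)
  stamp : ∀ a i, s'.arr (layer up a + 1) i = s.arr (layer up a + 1) i ∨
    s'.arr (layer up a + 1) i = s.var (stampReg up)

theorem SimFrame.refl (up : Bool) (ρ : ℕ) (s : Store) : SimFrame up ρ s s :=
  ⟨fun _ _ _ => rfl, fun _ _ => rfl, fun _ => rfl, fun _ => rfl, fun _ => rfl,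
    fun _ _ => Or.inl rfl⟩

theorem SimFrame.var_stampReg {up : Bool} {ρ : ℕ} {s s' : Store} (h : SimFrame up ρ s s')
    (up' : Bool) : s'.var (stampReg up') = s.var (stampReg up') := by
  cases up' <;> exact h.var _ (by simp [stampReg]) (by simp [stampReg])

theorem SimFrame.setVar {up : Bool} {ρ x : ℕ} {s s' : Store} (h : SimFrame up ρ s s') (v : ℕ)
    (hx : x = 29 ∨ (40 ≤ x ∧ x < 40 + ρ)) : SimFrame up ρ s (s'.setVar x v) where
  var y hy hy' := by
    have : y ≠ x := by omega
    simp [Store.setVar, this, h.var y hy hy']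
  low := h.low
  init := h.init
  other := h.other
  otherStamp := h.otherStamp
  stamp := h.stamp

/-- The five arrays of each simulated array lie in different residue classes modulo 5, and all of
them are above the arrays of the main program; so a write disturbs nothing but its own layer. -/
theorem SimFrame.write {up : Bool} {ρ a i v : ℕ} {s s' : Store} (h : SimFrame up ρ s s') :
    SimFrame up ρ s ((s'.setArr (layer up a) i v).setArr (layer up a + 1) i
      (s'.var (stampReg up))) where
  var := h.var
  low b hb := by
    have h1 : b ≠ layer up a := by unfold layer; split <;> omega
    have h2 : b ≠ layer up a + 1 := by unfold layer; split <;> omega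
    simp [Store.setArr, h1, h2, h.low b hb]
  init b := by
    have h1 : 10 + 5 * b ≠ layer up a := by unfold layer; split <;> omega
    have h2 : 10 + 5 * b ≠ layer up a + 1 := by unfold layer; split <;> omega
    simp [Store.setArr, h1, h2, h.init b]
  other b := by
    have h1 : layer (!up) b ≠ layer up a := by cases up <;> simp [layer] <;> omega
    have h2 : layer (!up) b ≠ layer up a + 1 := by cases up <;> simp [layer] <;> omega
    simp [Store.setArr, h1, h2, h.other b]
  otherStamp b := by
    have h1 : layer (!up) b + 1 ≠ layer up a := by cases up <;> simp [layer] <;> omega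
    have h2 : layer (!up) b ≠ layer up a := by cases up <;> simp [layer] <;> omega
    simp [Store.setArr, h1, h2, h.otherStamp b]
  stamp b j := by
    have h1 : layer up b + 1 ≠ layer up a := by cases up <;> simp [layer] <;> omega
    by_cases hb : layer up b = layer up a
    · by_cases hj : j = i
      · right; simp [Store.setArr, hb, hj, h.var_stampReg]
      · have := h.stamp b j
        rw [hb] at this
        simpa [Store.setArr, h1, hb, hj] using this
    · simpa [Store.setArr, h1, hb] using h.stamp b j

theorem SimRel.setVar {ρ B x v : ℕ} {s s' : Store} (h : SimRel ρ B s s') (hv : v < B) :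
    SimRel ρ B (s.setVar x v) (s'.setVar (x + 40) v) := by
  refine ⟨fun y hy => ?_, fun a ha i => ?_⟩
  · by_cases hxy : y = x
    · simp [Store.setVar, hxy, hv]
    · simpa [Store.setVar, hxy] using h.1 y hy
  · have h1 : 31 ≠ x + 40 := by omega
    have h2 : 32 ≠ x + 40 := by omega
    have := h.2 a ha i
    simpa [view, Store.setVar, h1, h2] using this

theorem SimRel.setVar_low {ρ B x : ℕ} {s s' : Store} (h : SimRel ρ B s s') (v : ℕ) (hx : x < 31) :
    SimRel ρ B s (s'.setVar x v) := by
  refine ⟨fun y hy => ?_, fun a ha i => ?_⟩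
  · have h1 : y + 40 ≠ x := by omega
    simpa [Store.setVar, h1] using h.1 y hy
  · have h1 : 31 ≠ x := by omega
    have h2 : 32 ≠ x := by omega
    have := h.2 a ha i
    simpa [view, Store.setVar, h1, h2] using this

/-- A write to the upper layer is seen at once, because that layer is consulted first. A write to
the lower layer would be shadowed by a valid upper cell; `hup` rules this out by making the whole
upper layer stale. -/
theorem SimRel.write {ρ B a v : ℕ} {s s' : Store} (h : SimRel ρ B s s') (up : Bool)
    (hup : up = false → ∀ a i, s'.arr (14 + 5 * a) i < s'.var 31) (i : ℕ) :
    SimRel ρ B (s.setArr a i v) ((s'.setArr (layer up a) i v).setArr (layer up a + 1) i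
      (s'.var (stampReg up))) := by
  refine ⟨h.1, fun b hb j => ?_⟩
  have hv := h.2 b hb j
  have hl : layer up a = 13 + 5 * a ∨ layer up a = 11 + 5 * a := by
    unfold layer; split <;> simp
  set s'' := (s'.setArr (layer up a) i v).setArr (layer up a + 1) i (s'.var (stampReg up))
    with hs''
  have e : ∀ c, c ≠ layer up a → c ≠ layer up a + 1 → s''.arr c = s'.arr c := by
    intro c h1 h2
    simp [hs'', Store.setArr, h1, h2]
  have e1 : s''.arr (layer up a) j = if j = i then v else s'.arr (layer up a) j := by
    simp [hs'', Store.setArr, Function.update_apply]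
  have e2 : s''.arr (layer up a + 1) j =
      if j = i then s'.var (stampReg up) else s'.arr (layer up a + 1) j := by
    simp [hs'', Store.setArr, Function.update_apply]
  have ev : s''.var = s'.var := rfl
  unfold view at hv ⊢
  rw [ev]
  by_cases hba : b = a
  · subst hba
    have e' : (s.setArr b i v).arr b j = if j = i then v else s.arr b j := by
      simp [Store.setArr, Function.update_apply]
    rw [e', ← hv]
    cases up with
    | true =>
      simp only [layer, stampReg, if_true, show 13 + 5 * b + 1 = 14 + 5 * b by omega] at e e1 e2
      rw [e1, e2, e _ (by omega) (by omega), e _ (by omega) (by omega), e _ (by omega) (by omega)]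
      by_cases hj : j = i <;> simp [hj]
    | false =>
      simp only [layer, stampReg, Bool.false_eq_true, if_false,
        show 11 + 5 * b + 1 = 12 + 5 * b by omega] at e e1 e2
      have := hup rfl b j
      rw [e1, e2, e _ (by omega) (by omega), e _ (by omega) (by omega), e _ (by omega) (by omega)]
      by_cases hj : j = i
      · subst hj; simp [this]
      · simp [hj]
  · have e' : (s.setArr a i v).arr b = s.arr b := by simp [Store.setArr, hba]
    rw [e', ← hv, e _ (by omega) (by omega), e _ (by omega) (by omega), e _ (by omega) (by omega),
      e _ (by omega) (by omega), e _ (by omega) (by omega)]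

/-- The hypotheses on the stamps in a store in which a simulation is started. -/
structure StampsOK (up : Bool) (B : ℕ) (s : Store) : Prop where
  lt31 : s.var 31 < B
  lt32 : s.var 32 < B
  le31 : ∀ a i, s.arr (14 + 5 * a) i ≤ s.var 31
  le32 : ∀ a i, s.arr (12 + 5 * a) i ≤ s.var 32
  fresh : up = false → ∀ a i, s.arr (14 + 5 * a) i < s.var 31

/-- A simulation leaves every stamp as it is or sets it to the current one, so no stamp gets ahead
of the stamp registers. -/
theorem StampsOK.of_frame {up : Bool} {B ρ : ℕ} {s s' : Store} (h : StampsOK up B s)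
    (hf : SimFrame up ρ s s') : StampsOK up B s' := by
  have e1 : s'.var 31 = s.var 31 := hf.var 31 (by simp) (by simp)
  have e2 : s'.var 32 = s.var 32 := hf.var 32 (by simp) (by simp)
  have l1 : ∀ a, 13 + 5 * a + 1 = 14 + 5 * a := by intro a; omega
  have l2 : ∀ a, 11 + 5 * a + 1 = 12 + 5 * a := by intro a; omega
  refine ⟨by rw [e1]; exact h.lt31, by rw [e2]; exact h.lt32, fun a i => ?_, fun a i => ?_,
    fun hu a i => ?_⟩
  · rw [e1]
    cases up with
    | true =>
      have := hf.stamp a i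
      simp only [layer, stampReg, if_true, l1] at this
      have := h.le31 a i
      omega
    | false =>
      have := hf.otherStamp a
      simp only [layer, Bool.not_false, if_true, l1] at this
      rw [this]; exact h.le31 a i
  · rw [e2]
    cases up with
    | false =>
      have := hf.stamp a i
      simp only [layer, stampReg, Bool.false_eq_true, if_false, l2] at this
      have := h.le32 a i
      omega
    | true =>
      have := hf.otherStamp a
      simp only [layer, Bool.not_true, Bool.false_eq_true, if_false, l2] at this
      rw [this]; exact h.le32 a i
  · subst hu
    have := hf.otherStamp a
    simp only [layer, Bool.not_false, if_true, l1] at this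
    rw [e1, this]; exact h.fresh rfl a i

/-- The truncated difference in `staleExpr` vanishes iff the cell is valid, and the branches follow
the case distinction of `view`. Two tests of 9 steps and the load itself give the 19 steps that set
the slowdown of the whole simulation. -/
theorem runs_sim_load {t B ρ x a y : ℕ} {up : Bool} {s s' : Store} (hs : StampsOK up B s')
    (hr : SimRel ρ B s s') (ha : a < ρ) (hy : y < ρ) (ht : 40 + ρ ≤ t)
    (hB : s.arr a (s.var y) < B) :
    Runs t B (simCmd t up (.load x a y)) s' 19 (s'.setVar (x + 40) (s.arr a (s.var y))) := by
  obtain ⟨hy', hv⟩ := hr.1 y hy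
  have h2 : (staleExpr true a y).Fits t B s' := by
    refine ⟨⟨by simp [stampReg]; omega, hs.lt31⟩, ⟨⟨by omega, ?_⟩, ?_⟩, ?_⟩
    · rw [hy']; exact hv
    · exact lt_of_le_of_lt (by simpa [layer, add_right_comm] using hs.le31 a _) hs.lt31
    · exact lt_of_le_of_lt (Nat.sub_le _ _) hs.lt31
  have h1 : (staleExpr false a y).Fits t B s' := by
    refine ⟨⟨by simp [stampReg]; omega, hs.lt32⟩, ⟨⟨by omega, ?_⟩, ?_⟩, ?_⟩
    · rw [hy']; exact hv
    · exact lt_of_le_of_lt (by simpa [layer, add_right_comm] using hs.le32 a _) hs.lt32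
    · exact lt_of_le_of_lt (Nat.sub_le _ _) hs.lt32
  have ev2 : (staleExpr true a y).eval s' = s'.var 31 - s'.arr (14 + 5 * a) (s.var y) := by
    simp [staleExpr, Expr.eval, stampReg, layer, BinOp.eval, hy', add_right_comm]
  have ev1 : (staleExpr false a y).eval s' = s'.var 32 - s'.arr (12 + 5 * a) (s.var y) := by
    simp [staleExpr, Expr.eval, stampReg, layer, BinOp.eval, hy', add_right_comm]
  have hview := hr.2 a ha (s.var y)
  have e : ∀ c, s'.arr c (s'.var (y + 40)) = s.arr a (s.var y) →
      Runs t B (.load (x + 40) c (y + 40)) s' 1 (s'.setVar (x + 40) (s.arr a (s.var y))) := by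
    intro c hc
    rw [← hc]
    exact Runs.load (by omega) (by rw [hc]; exact hB)
  unfold view at hview
  rw [simCmd]
  by_cases c2 : s'.var 31 ≤ s'.arr (14 + 5 * a) (s.var y)
  · rw [if_pos c2] at hview
    exact (Runs.cond_false h2 (by rw [ev2]; omega)
      (e _ (by rw [hy', ← hview]; rfl))).mono (by simp [staleExpr, Expr.time])
  · rw [if_neg c2] at hview
    refine (Runs.cond_true h2 (by rw [ev2]; omega) (n := 10) ?_).mono
      (by simp [staleExpr, Expr.time])
    by_cases c1 : s'.var 32 ≤ s'.arr (12 + 5 * a) (s.var y)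
    · rw [if_pos c1] at hview
      exact (Runs.cond_false h1 (by rw [ev1]; omega)
        (e _ (by rw [hy', ← hview]; rfl))).mono (by simp [staleExpr, Expr.time])
    · rw [if_neg c1] at hview
      exact (Runs.cond_true h1 (by rw [ev1]; omega)
        (e _ (by rw [hy', ← hview]))).mono (by simp [staleExpr, Expr.time])

theorem ex_exec_pure {B T : ℕ} {c : Cmd} {k : List Cmd} {s : Store} {x : Config}
    (h : step B c k s = PMF.pure x) (g : Store × ℕ → ℝ≥0∞) :
    ex (exec B (T + 1) ⟨c :: k, s⟩) g = ex (exec B T x) g := by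
  rw [exec_succ, h, PMF.pure_bind]

/-- Only an inequality is available: on the right the worst scratch contents are chosen separately
for each value of the bit. -/
theorem costU_flip {t B T x : ℕ} {k : List Cmd} {s : Store} (f : Store → ℝ≥0∞) (hB : 1 < B) :
    costU t B (T + 1) (.flip x :: k) s f ≤
      ∑' r : Bool, PMF.uniformOfFintype Bool r * costU t B T k (s.setVar x r.toNat) f :=
  costU_le fun s₁ hs => by
    have : step B (.flip x) k s₁ = (PMF.uniformOfFintype Bool).bind fun r =>
        PMF.pure ⟨k, s₁.setVar x r.toNat⟩ := by
      rw [step, PMF.map]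
      congr 1
      ext1 r
      have : r.toNat < B := lt_of_le_of_lt (Bool.toNat_le r) hB
      simp [assign, this]
    rw [cost, exec_succ, this, PMF.bind_bind, ex_bind]
    refine ENNReal.tsum_le_tsum fun r => mul_le_mul_right ?_ _
    rw [PMF.pure_bind]
    exact cost_le_costU (hs.setVar _ _)

/-- A simulated program runs in 19 times the time, with the same expected cost. -/
theorem costU_sim_le {t B B' ρ : ℕ} (up : Bool) {s₀ : Store} (hB : B ≤ B') (ht : 40 + ρ ≤ t)
    (h₀ : StampsOK up B' s₀) {T₀ : ℕ} {k : List Cmd} {f : Store → ℝ≥0∞} {g : Store × ℕ → ℝ≥0∞}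
    {v₂₉ : ℕ} (hg : ∀ s b s', SimRel ρ B' s s' → SimFrame up ρ s₀ s' → s'.var 29 = v₂₉ →
      costU t B' (19 * b + T₀) k s' f ≤ g (s, b)) (T : ℕ) :
    ∀ (cs : List Cmd) (s s' : Store), (∀ c ∈ cs, c.Below ρ) → SimRel ρ B' s s' →
      SimFrame up ρ s₀ s' → s'.var 29 = v₂₉ →
      costU t B' (19 * T + T₀) (cs.map (simCmd t up) ++ k) s' f ≤ ex (exec B T ⟨cs, s⟩) g := by
  induction T with
  | zero =>
    intro cs s s' hc hr hf hv₂₉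
    cases cs with
    | nil => rw [exec_nil, ex_pure_some]; exact hg _ _ _ hr hf hv₂₉
    | cons c cs => rw [exec_zero, ex_pure_none]; exact le_top
  | succ T ih =>
    intro cs s s' hc hr hf hv₂₉
    cases cs with
    | nil => rw [exec_nil, ex_pure_some]; exact hg _ _ _ hr hf hv₂₉
    | cons c cs =>
      have hcs : ∀ c ∈ cs, c.Below ρ := fun c' h' => hc c' (List.mem_cons_of_mem _ h')
      have hcb : c.Below ρ := hc c List.mem_cons_self
      have hst := h₀.of_frame hf
      have det : ∀ {cs' : List Cmd} {s₁ s₁' : Store},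
          step B c cs s = PMF.pure ⟨cs', s₁⟩ →
          Reaches t B' 19 (simCmd t up c :: (cs.map (simCmd t up) ++ k)) s'
            (cs'.map (simCmd t up) ++ k) s₁' →
          (∀ c ∈ cs', c.Below ρ) → SimRel ρ B' s₁ s₁' → SimFrame up ρ s₀ s₁' → s₁'.var 29 = v₂₉ →
          costU t B' (19 * (T + 1) + T₀) ((c :: cs).map (simCmd t up) ++ k) s' f ≤
            ex (exec B (T + 1) ⟨c :: cs, s⟩) g := by
        intro cs' s₁ s₁' h1 h2 h3 h4 h5 h6
        rw [ex_exec_pure h1, show 19 * (T + 1) + T₀ = (19 * T + T₀) + 19 by omega]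
        exact (h2 _ _).trans (ih cs' s₁ s₁' h3 h4 h5 h6)
      have asg : ∀ {x v : ℕ}, step B c cs s = PMF.pure (assign B c cs s x v) → x < ρ →
          (v < B → Runs t B' (simCmd t up c) s' 19 (s'.setVar (x + 40) v)) →
          costU t B' (19 * (T + 1) + T₀) ((c :: cs).map (simCmd t up) ++ k) s' f ≤
            ex (exec B (T + 1) ⟨c :: cs, s⟩) g := by
        intro x v h1 hx h2
        by_cases hv : v < B
        · rw [assign, if_pos hv] at h1
          exact det h1 (h2 hv _) hcs (hr.setVar (by omega)) (hf.setVar v (by omega))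
            (by simpa [Store.setVar, show 29 ≠ x + 40 by omega] using hv₂₉)
        · rw [assign, if_neg hv] at h1
          -- A value that overflows the words of the simulated machine makes that machine hang; its
          -- cost is infinite, and the simulation owes nothing.
          rw [ex_exec_eq_top (by rw [h1]; simp)]
          exact le_top
      cases c with
      | skip => exact det rfl ((Runs.skip t B' s' _).mono (by omega)) hcs hr hf hv₂₉
      | const x v =>
        exact asg rfl hcb fun hv => (Runs.const s' (by omega)).mono (by omega)
      | copy x y =>
        refine asg rfl hcb.1 fun hv => ?_
        have := (hr.1 y hcb.2).1
        rw [← this] at hv ⊢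
        exact (Runs.copy (by have := hcb.2; omega) (by omega)).mono (by omega)
      | op o x y z =>
        refine asg rfl hcb.1 fun hv => ?_
        have h1 := (hr.1 y hcb.2.1).1
        have h2 := (hr.1 z hcb.2.2).1
        rw [← h1, ← h2] at hv ⊢
        exact (Runs.op (by have := hcb.2; omega) (by have := hcb.2; omega) (by omega)).mono
          (by omega)
      | load x a y =>
        exact asg rfl hcb.1 fun hv => runs_sim_load hst hr hcb.2.1 hcb.2.2 ht (by omega)
      | store a x y =>
        have h1 := (hr.1 x hcb.2.1).1
        have h2 := (hr.1 y hcb.2.2).1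
        have hst' : stampReg up < t := by unfold stampReg; split <;> omega
        refine det (s₁' := (s'.setArr (layer up a) (s.var x) (s.var y)).setArr (layer up a + 1)
          (s.var x) (s'.var (stampReg up))) rfl ?_ hcs (hr.write up hst.fresh _) hf.write
          hv₂₉
        rw [← h1, ← h2]
        exact ((Runs.store (by have := hcb.2; omega) (by have := hcb.2; omega)).seq
          (Runs.store (s := s'.setArr (layer up a) (s'.var (x + 40)) (s'.var (y + 40)))
            (by have := hcb.2; omega) hst') _).mono (by omega)
      | flip x =>
        by_cases hB1 : 1 < B
        · rw [show 19 * (T + 1) + T₀ = (19 * T + T₀) + 18 + 1 by omega, exec_succ, step, PMF.map,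
            PMF.bind_bind, ex_bind]
          refine (costU_flip f (by omega)).trans ?_
          refine ENNReal.tsum_le_tsum fun r => mul_le_mul_right ?_ _
          have hr1 : r.toNat < B := lt_of_le_of_lt (Bool.toNat_le r) hB1
          rw [Function.comp, PMF.pure_bind, assign, if_pos hr1]
          exact (costU_anti (by omega) _ _ _).trans (ih cs _ _ hcs (hr.setVar (by omega))
            (hf.setVar _ (by have : x < ρ := hcb; omega))
            (by simpa [Store.setVar, show 29 ≠ x + 40 by omega] using hv₂₉))
        -- With word bound at most 1 the bit 1 does not fit, so the simulated machine hangs with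
        -- positive probability.
        · refine le_trans le_top (ex_exec_eq_top ?_ _ _).ge
          rw [step, ← PMF.mem_support_iff, PMF.support_map]
          refine ⟨true, by simp, ?_⟩
          simp [assign, hB1]
      | seq c d =>
        refine det rfl ((reaches_seq _ _ _ _ _ _).mono (by omega)) ?_ hr hf hv₂₉
        simp only [List.mem_cons, forall_eq_or_imp]
        exact ⟨hcb.1, hcb.2, hcs⟩
      | ite x c d =>
        have hx := (hr.1 x hcb.1).1
        refine det rfl ((?_ : Reaches _ _ _ _ _ _ s').mono (by omega : 1 ≤ 19)) ?_ hr hf hv₂₉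
        · have := reaches_ite (B := B') (s := s') (x := x + 40) (t := t)
            (by have := hcb.1; omega) (simCmd t up c) (simCmd t up d) (cs.map (simCmd t up) ++ k)
          rw [hx] at this
          simp only [List.map_cons, List.cons_append]
          rw [apply_ite (simCmd t up)]
          exact this
        · simp only [List.mem_cons, forall_eq_or_imp]
          refine ⟨?_, hcs⟩
          split
          · exact hcb.2.1
          · exact hcb.2.2
      | loop x c =>
        have hx := (hr.1 x hcb.1).1
        refine det rfl ((?_ : Reaches _ _ _ _ _ _ s').mono (by omega : 1 ≤ 19)) ?_ hr hf hv₂₉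
        · refine reaches_of_step fun s₁ hs => ⟨s₁, ?_, hs⟩
          rw [simCmd, step, hs.2 _ (by have := hcb.1; omega), hx]
          split <;> rfl
        · split
          · simp only [List.mem_cons, forall_eq_or_imp]
            exact ⟨hcb.2, hcb, hcs⟩
          · exact hcs

end WordRAM

namespace Gadget

/-! ## The graphs of the reduction

There are four blocks of `S` paths with `q` vertices each, and a hub.  The last vertices of block 0
stand for the vectors of `U`, the last vertices of the blocks 1 and 3 for the coordinates, and the
first vertices of block 2 for the vectors of `V`.  The vectors of `W` are switched by edges between
the two copies of the coordinates. -/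

/-- The number of vertex `j` on path `i` of block `b`. -/
def code (q S b j i : ℕ) : ℕ := (b * q + j) * S + i

/-- The number of the hub. -/
def hub (q S : ℕ) : ℕ := 4 * q * S

/-- The edges, for the bits `u`, `v` of the vectors and the set `w` of switched coordinates. -/
inductive Edge (q S n d n₂ : ℕ) (u v : ℕ → ℕ → Prop) (w : ℕ → Prop) : ℕ → ℕ → Prop
  | path {b j i : ℕ} : b < 4 → j + 1 < q → i < S →
      Edge q S n d n₂ u v w (code q S b j i) (code q S b (j + 1) i)
  | root {b i : ℕ} : b < 4 → i < S → (b = 2 → n₂ ≤ i) →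
      Edge q S n d n₂ u v w (hub q S) (code q S b 0 i)
  | back {i : ℕ} : i < S → Edge q S n d n₂ u v w (code q S 0 (q - 1) i) (hub q S)
  | left {x k : ℕ} : x < n → k < d → u x k →
      Edge q S n d n₂ u v w (code q S 0 (q - 1) x) (code q S 1 (q - 1) k)
  | right {y k : ℕ} : y < n₂ → k < d → v y k →
      Edge q S n d n₂ u v w (code q S 3 (q - 1) k) (code q S 2 0 y)
  | switch {k : ℕ} : k < d → w k →
      Edge q S n d n₂ u v w (code q S 1 (q - 1) k) (code q S 3 (q - 1) k)

/-! ### Arithmetic of vertex numbers -/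

section code

variable {q S b j i b' j' i' : ℕ}

theorem code_div_block (hj : j < q) (hi : i < S) : code q S b j i / (q * S) = b := by
  have h : code q S b j i = q * S * b + (j * S + i) := by unfold code; ring
  have h2 : j * S + i < q * S := by nlinarith
  rw [h, Nat.mul_add_div (by omega), Nat.div_eq_of_lt h2, add_zero]

theorem code_div (hi : i < S) : code q S b j i / S = b * q + j := by
  rw [code, mul_comm, Nat.mul_add_div (by omega), Nat.div_eq_of_lt hi, add_zero]

theorem code_mod (hi : i < S) : code q S b j i % S = i := by
  rw [code, Nat.mul_add_mod_self_right, Nat.mod_eq_of_lt hi]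

theorem code_row (hj : j < q) (hi : i < S) : code q S b j i / S % q = j := by
  rw [code_div hi, Nat.mul_add_mod_self_right, Nat.mod_eq_of_lt hj]

theorem code_lt_hub (hb : b < 4) (hj : j < q) (hi : i < S) : code q S b j i < hub q S := by
  have h1 : b * q + j + 1 ≤ 4 * q := by nlinarith
  have h2 : (b * q + j + 1) * S ≤ 4 * q * S := Nat.mul_le_mul_right _ h1
  unfold code hub
  rw [add_mul] at h2
  omega

theorem code_inj (hj : j < q) (hi : i < S) (hj' : j' < q) (hi' : i' < S)
    (h : code q S b j i = code q S b' j' i') : b = b' ∧ j = j' ∧ i = i' := by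
  refine ⟨?_, ?_, ?_⟩
  · rw [← code_div_block (b := b) hj hi, h, code_div_block hj' hi']
  · rw [← code_row (b := b) hj hi, h, code_row hj' hi']
  · rw [← code_mod (q := q) (b := b) (j := j) hi, h, code_mod hi']

theorem exists_code {x : ℕ} (hx : x < hub q S) :
    ∃ b < 4, ∃ j < q, ∃ i < S, x = code q S b j i := by
  have hS : 0 < S := by
    rcases Nat.eq_zero_or_pos S with h | h
    · simp [hub, h] at hx
    · exact h
  have hq : 0 < q := by
    rcases Nat.eq_zero_or_pos q with h | h
    · simp [hub, h] at hx
    · exact h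
  have h1 : x / S < 4 * q := Nat.div_lt_of_lt_mul (by rw [mul_comm]; exact hx)
  refine ⟨x / S / q, Nat.div_lt_of_lt_mul (by rwa [mul_comm]), x / S % q, Nat.mod_lt _ hq, x % S,
    Nat.mod_lt _ hS, ?_⟩
  rw [code, Nat.div_add_mod', Nat.div_add_mod']

/-- The hub counts as a fifth block, number 4. This is what lets `edgeKey` treat edges at the hub
like those between blocks. -/
theorem hub_div (hq : 0 < q) (hS : 0 < S) : hub q S / (q * S) = 4 := by
  rw [hub, mul_assoc, Nat.mul_div_cancel _ (Nat.mul_pos hq hS)]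

end code

/-! ### The gap between radius q + 2 and radius 2q -/

section radius

variable {q S n d n₂ : ℕ} {u v : ℕ → ℕ → Prop} {w : ℕ → Prop}

theorem Edge.lt (hq : 0 < q) (hn : n ≤ S) (hd : d ≤ S) (hn₂ : n₂ ≤ S) {a b : ℕ}
    (h : Edge q S n d n₂ u v w a b) : a ≤ hub q S ∧ b ≤ hub q S := by
  cases h with
  | path hb hj hi => exact ⟨(code_lt_hub hb (by omega) hi).le, (code_lt_hub hb hj hi).le⟩
  | root hb hi _ => exact ⟨le_rfl, (code_lt_hub hb hq hi).le⟩
  | back hi => exact ⟨(code_lt_hub (by omega) (by omega) hi).le, le_rfl⟩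
  | left hx hk _ => exact ⟨(code_lt_hub (by omega) (by omega) (by omega)).le,
      (code_lt_hub (by omega) (by omega) (by omega)).le⟩
  | right hx hk _ => exact ⟨(code_lt_hub (by omega) (by omega) (by omega)).le,
      (code_lt_hub (by omega) (by omega) (by omega)).le⟩
  | switch hk _ => exact ⟨(code_lt_hub (by omega) (by omega) (by omega)).le,
      (code_lt_hub (by omega) (by omega) (by omega)).le⟩

/-- The set of edges is described by `Edge`. -/
def IsGraph (q S n d n₂ : ℕ) (u v : ℕ → ℕ → Prop) (w : ℕ → Prop)
    (E : Finset (Fin (hub q S + 1) × Fin (hub q S + 1))) : Prop :=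
  ∀ a b, (a, b) ∈ E ↔ Edge q S n d n₂ u v w a b

variable {E : Finset (Fin (hub q S + 1) × Fin (hub q S + 1))}

theorem HasWalk.append {N : ℕ} {E : Finset (Fin N × Fin N)} {a b c : Fin N} {k l : ℕ}
    (h : HasWalk E a k b) (h' : HasWalk E b l c) : HasWalk E a (k + l) c := by
  induction h with
  | nil => simpa using h'
  | cons he _ ih =>
    rw [add_right_comm]
    exact .cons he (ih h')

theorem ddist_le {N : ℕ} {E : Finset (Fin N × Fin N)} {a b : Fin N} {k l : ℕ}
    (h : HasWalk E a k b) (hk : k ≤ l) : ddist E a b ≤ l :=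
  (iInf₂_le k h).trans (by exact_mod_cast hk)

theorem walk_path (hE : IsGraph q S n d n₂ u v w E) {b i : ℕ} (hb : b < 4) (hi : i < S) :
    ∀ {j : ℕ} (hj : j < q), HasWalk E
      ⟨code q S b 0 i, (code_lt_hub hb (by omega) hi).trans (Nat.lt_succ_self _)⟩ j
      ⟨code q S b j i, (code_lt_hub hb hj hi).trans (Nat.lt_succ_self _)⟩ := by
  intro j
  induction j with
  | zero => intro _; exact .nil _
  | succ j ih =>
    intro hj
    exact HasWalk.append (ih (by omega)) (.cons ((hE _ _).2 (.path hb hj hi)) (.nil _))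

/-- The centre is the end of path x in block 0. One edge leads to the hub, one more to the start of
any path that the hub feeds, and at most q - 1 edges along it: q + 1 in all. A path of block 2 that
stands for a vector of V is entered over a common coordinate, by the edges `left`, `switch` and
`right`, which gives 3 + (q - 1). -/
theorem radius_le (hq : 0 < q) (hn : n ≤ S) (hd : d ≤ S)
    (hE : IsGraph q S n d n₂ u v w E)
    (h : ∃ x < n, ∀ y < n₂, ∃ k < d, u x k ∧ w k ∧ v y k) : radius E ≤ (q + 2 : ℕ) := by
  obtain ⟨x, hx, h⟩ := h
  have hlt : ∀ {b j i : ℕ}, b < 4 → j < q → i < S → code q S b j i < hub q S + 1 :=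
    fun hb hj hi => (code_lt_hub hb hj hi).trans (Nat.lt_succ_self _)
  have hxS : x < S := by omega
  have hq1 : q - 1 < q := by omega
  have w0 : HasWalk E ⟨_, hlt (b := 0) (by omega) hq1 hxS⟩ 1 ⟨hub q S, Nat.lt_succ_self _⟩ :=
    .cons ((hE _ _).2 (.back hxS)) (.nil _)
  refine (iInf_le _ ⟨_, hlt (b := 0) (by omega) hq1 hxS⟩).trans (iSup_le fun z => ?_)
  obtain ⟨z, hz⟩ := z
  rcases Nat.lt_succ_iff_lt_or_eq.1 hz with hz' | rfl
  · obtain ⟨b, hb, j, hj, i, hi, rfl⟩ := exists_code hz'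
    by_cases hroot : b = 2 → n₂ ≤ i
    · exact ddist_le (HasWalk.append w0 (.cons ((hE _ ⟨_, hlt hb hq hi⟩).2 (.root hb hi hroot))
        (walk_path hE hb hi hj))) (by omega)
    · have hb2 : b = 2 := by tauto
      have hi2 : i < n₂ := by by_contra hc; exact hroot fun _ => by omega
      subst hb2
      obtain ⟨k, hk, hu, hw, hv⟩ := h i hi2
      have hkS : k < S := by omega
      refine ddist_le
        (.cons ((hE _ ⟨_, hlt (b := 1) (by omega) hq1 hkS⟩).2 (.left hx hk hu))
          (.cons ((hE _ ⟨_, hlt (b := 3) (by omega) hq1 hkS⟩).2 (.switch hk hw))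
            (.cons ((hE _ ⟨_, hlt hb hq hi⟩).2 (.right hi2 hk hv)) (walk_path hE hb hi hj))))
        (by omega)
  · exact ddist_le w0 (by omega)

theorem le_of_walk {N : ℕ} {E : Finset (Fin N × Fin N)} {F : Fin N → ℕ}
    (hF : ∀ a b, (a, b) ∈ E → F a ≤ F b + 1) {a b : Fin N} {k : ℕ} (h : HasWalk E a k b) :
    F a ≤ F b + k := by
  induction h with
  | nil => simp
  | cons he _ ih =>
    have := hF _ _ he
    omega

/-- A function that drops by at most 1 along each edge and vanishes at `b` bounds the distance to
`b` from below. Unreachable targets need no separate treatment. -/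
theorem le_ecc {N : ℕ} {E : Finset (Fin N × Fin N)} {F : Fin N → ℕ}
    (hF : ∀ a b, (a, b) ∈ E → F a ≤ F b + 1) (a b : Fin N) (hb : F b = 0) :
    (F a : ℕ∞) ≤ ecc E a := by
  refine le_trans ?_ (le_iSup _ b)
  refine le_iInf₂ fun k hk => ?_
  have := le_of_walk hF hk
  rw [hb, zero_add] at this
  exact_mod_cast this

/-- A function of the position of a vertex as a function of its number. -/
def onCode (q S : ℕ) (h : ℕ) (G : ℕ → ℕ → ℕ → ℕ) (z : ℕ) : ℕ :=
  if z = hub q S then h else G (z / (q * S)) (z / S % q) (z % S)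

theorem onCode_hub (h : ℕ) (G : ℕ → ℕ → ℕ → ℕ) : onCode q S h G (hub q S) = h := by
  simp [onCode]

theorem onCode_code {b j i : ℕ} (hb : b < 4) (hj : j < q) (hi : i < S) (h : ℕ)
    (G : ℕ → ℕ → ℕ → ℕ) : onCode q S h G (code q S b j i) = G b j i := by
  rw [onCode, if_neg (code_lt_hub hb hj hi).ne, code_div_block hj hi, code_row hj hi, code_mod hi]

open Classical in
/-- A lower bound for the distance from a vertex to the end of path `y` of block 2, provided that
vector `x` of `U` misses vector `y` of `V`. -/
def far (q d : ℕ) (v : ℕ → ℕ → Prop) (w : ℕ → Prop) (x y b j i : ℕ) : ℕ :=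
  if b = 0 then if i = x then 2 * q else 2 * q - j
  else if b = 1 then if j + 1 = q ∧ ¬ (i < d ∧ w i ∧ v y i) then 2 * q else 2 * q - j
  else if b = 2 then if i = y then q - 1 - j else 2 * q
  else if j + 1 = q ∧ ¬ (i < d ∧ v y i) then 2 * q else 2 * q - 1 - j

theorem far_le (d : ℕ) (v : ℕ → ℕ → Prop) (w : ℕ → Prop) (x y b j i : ℕ) :
    far q d v w x y b j i ≤ 2 * q := by
  unfold far
  split_ifs <;> omega

theorem le_far_one (d : ℕ) (v : ℕ → ℕ → Prop) (w : ℕ → Prop) (x y j i : ℕ) :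
    2 * q - j ≤ far q d v w x y 1 j i := by
  simp only [far]
  split_ifs <;> omega

/-- The target is the end of path y in block 2. Away from path x the values of `far` allow for the
quickest conceivable routes. The vertices of path x and the hub still get 2q: each coordinate that x
can enter fails for w or for y, and the end of block 1 at such a coordinate has value 2q as well. -/
theorem far_edge (hq : 1 < q) (hn : n ≤ S) (hd : d ≤ S) (hn₂ : n₂ ≤ S) {x y : ℕ} (hy : y < n₂)
    (hxy : x < n → ∀ k < d, ¬ (u x k ∧ w k ∧ v y k)) {a b : ℕ}
    (h : Edge q S n d n₂ u v w a b) :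
    onCode q S (2 * q) (far q d v w x y) a ≤ onCode q S (2 * q) (far q d v w x y) b + 1 := by
  cases h with
  | @path b j i hb hj hi =>
    rw [onCode_code hb (by omega) hi, onCode_code hb hj hi]
    have h1 : ¬ (j + 1 = q) := by omega
    have hb' : b = 0 ∨ b = 1 ∨ b = 2 ∨ b = 3 := by omega
    rcases hb' with rfl | rfl | rfl | rfl <;> simp only [far, h1] <;> split_ifs <;> simp_all <;>
      omega
  | @root b i hb hi hn =>
    rw [onCode_hub, onCode_code hb (by omega) hi]
    have h1 : ¬ (0 + 1 = q) := by omega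
    have hb' : b = 0 ∨ b = 1 ∨ b = 2 ∨ b = 3 := by omega
    rcases hb' with rfl | rfl | rfl | rfl
    · simp only [far]; split_ifs <;> omega
    · simp only [far, h1]; simp
    · have : i ≠ y := by have := hn rfl; omega
      simp [far, this]
    -- The tight case: from the hub the fastest route runs through block 3, of length 1 + (q - 1) +
    -- 1 + (q - 1) = 2q.
    · have h3 : 2 * q - 1 ≤ far q d v w x y 3 0 i := by
        simp only [far]
        split_ifs <;> omega
      omega
  | @back i hi =>
    rw [onCode_hub]
    exact (show _ ≤ 2 * q by rw [onCode_code (by omega) (by omega) hi]; exact far_le ..).trans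
      (Nat.le_succ _)
  | @left x' k hx hk hu =>
    rw [onCode_code (by omega) (by omega) (by omega), onCode_code (by omega) (by omega) (by omega)]
    by_cases hxx : x' = x
    · subst hxx
      have hno : ¬ (k < d ∧ w k ∧ v y k) := fun hc => hxy hx k hk ⟨hu, hc.2⟩
      have hq1 : q - 1 + 1 = q := by omega
      simp only [far, hno, hq1]
      simp
    · have := le_far_one (q := q) d v w x y (q - 1) k
      have h2 : far q d v w x y 0 (q - 1) x' = 2 * q - (q - 1) := by simp [far, hxx]
      omega
  | @right y' k hy' hk hv =>
    rw [onCode_code (by omega) (by omega) (by omega), onCode_code (by omega) (by omega) (by omega)]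
    by_cases hyy : y' = y
    · subst hyy
      have h1 : far q d v w x y' 3 (q - 1) k = 2 * q - 1 - (q - 1) := by simp [far, hk, hv]
      have h2 : far q d v w x y' 2 0 y' = q - 1 - 0 := by simp [far]
      omega
    · have h2 : far q d v w x y 2 0 y' = 2 * q := by simp [far, hyy]
      rw [h2]
      exact (far_le ..).trans (Nat.le_succ _)
  | @switch k hk hw =>
    rw [onCode_code (by omega) (by omega) (by omega), onCode_code (by omega) (by omega) (by omega)]
    have hq1 : q - 1 + 1 = q := by omega
    by_cases hv : v y k
    · have h1 : far q d v w x y 1 (q - 1) k = 2 * q - (q - 1) := by simp [far, hk, hv, hw]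
      have h2 : far q d v w x y 3 (q - 1) k = 2 * q - 1 - (q - 1) := by simp [far, hk, hv]
      omega
    · have h2 : far q d v w x y 3 (q - 1) k = 2 * q := by simp [far, hv, hq1]
      rw [h2]
      exact (far_le ..).trans (Nat.le_succ _)

/-- No edge leads from the blocks 1, 2, 3 back to block 0 or to the hub, so the hub cannot be
reached from there. The value 2q is simply as much as is needed. -/
theorem trap_edge (hq : 1 < q) (hn : n ≤ S) (hd : d ≤ S) (hn₂ : n₂ ≤ S) {a b : ℕ}
    (h : Edge q S n d n₂ u v w a b) :
    onCode q S 0 (fun b _ _ => if b = 0 then 0 else 2 * q) a ≤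
      onCode q S 0 (fun b _ _ => if b = 0 then 0 else 2 * q) b + 1 := by
  cases h with
  | path hb hj hi => rw [onCode_code hb (by omega) hi, onCode_code hb hj hi]; omega
  | root hb hi hn => rw [onCode_hub]; omega
  | back hi => rw [onCode_code (by omega) (by omega) hi]; simp
  | left hx hk hu => rw [onCode_code (by omega) (by omega) (by omega)]; simp
  | right hy hk hv =>
    rw [onCode_code (by omega) (by omega) (by omega), onCode_code (by omega) (by omega) (by omega)]
    simp
  | switch hk hw =>
    rw [onCode_code (by omega) (by omega) (by omega), onCode_code (by omega) (by omega) (by omega)]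
    simp

/-- A vertex on path x of block 0 is far from the end of a path y that x misses, and so is the hub,
for which any x will do. The vertices of the other blocks never reach the hub. -/
theorem le_radius (hq : 1 < q) (hn : n ≤ S) (hd : d ≤ S) (hn₂ : n₂ ≤ S) (hn₂' : 0 < n₂)
    (hE : IsGraph q S n d n₂ u v w E)
    (h : ∀ x < n, ∃ y < n₂, ∀ k < d, ¬ (u x k ∧ w k ∧ v y k)) : (2 * q : ℕ) ≤ radius E := by
  -- The paths from n on are padding without edges to coordinates; any y serves them, and 0 exists
  -- since V is not empty.
  have h' : ∀ x, ∃ y < n₂, x < n → ∀ k < d, ¬ (u x k ∧ w k ∧ v y k) := by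
    intro x
    by_cases hx : x < n
    · obtain ⟨y, hy, hxy⟩ := h x hx
      exact ⟨y, hy, fun _ => hxy⟩
    · exact ⟨0, hn₂', fun hc => absurd hc hx⟩
  have hlt : ∀ {b j i : ℕ}, b < 4 → j < q → i < S → code q S b j i < hub q S + 1 :=
    fun hb hj hi => (code_lt_hub hb hj hi).trans (Nat.lt_succ_self _)
  have key : ∀ (x : ℕ) (a : Fin (hub q S + 1)),
      (∀ y, onCode q S (2 * q) (far q d v w x y) a = 2 * q) → (2 * q : ℕ) ≤ ecc E a := by
    intro x a ha
    obtain ⟨y, hy, hxy⟩ := h' x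
    rw [← ha y]
    refine le_ecc (F := fun z => onCode q S (2 * q) (far q d v w x y) z)
      (fun a b hab => far_edge hq hn hd hn₂ hy hxy ((hE a b).1 hab)) a
      ⟨code q S 2 (q - 1) y, hlt (by omega) (by omega) (by omega)⟩ ?_
    change onCode q S (2 * q) (far q d v w x y) (code q S 2 (q - 1) y) = 0
    rw [onCode_code (by omega) (by omega) (by omega)]
    simp [far]
  refine le_iInf fun a => ?_
  obtain ⟨z, hz⟩ := a
  rcases Nat.lt_succ_iff_lt_or_eq.1 hz with hz' | rfl
  · obtain ⟨b, hb, j, hj, i, hi, rfl⟩ := exists_code hz'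
    by_cases hb0 : b = 0
    · subst hb0
      refine key i _ fun y => ?_
      change onCode q S _ _ (code q S 0 j i) = _
      rw [onCode_code hb hj hi]
      simp [far]
    · have e : onCode q S 0 (fun b _ _ => if b = 0 then 0 else 2 * q) (code q S b j i) =
          2 * q := by
        rw [onCode_code hb hj hi, if_neg hb0]
      rw [← e]
      refine le_ecc (F := fun z => onCode q S 0 (fun b _ _ => if b = 0 then 0 else 2 * q) z)
        (fun a b hab => trap_edge hq hn hd hn₂ ((hE a b).1 hab)) ⟨code q S b j i, hz⟩
        ⟨hub q S, Nat.lt_succ_self _⟩ (onCode_hub _ _)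
  · exact key 0 _ fun y => onCode_hub _ _

end radius

/-! ## Switching -/

section switch

variable {q S n d n₂ : ℕ} {u v : ℕ → ℕ → Prop} {w : ℕ → Prop}

theorem Edge.ne (hq : 1 < q) (hn : n ≤ S) (hd : d ≤ S) (_hn₂ : n₂ ≤ S) {a b : ℕ}
    (h : Edge q S n d n₂ u v w a b) : a ≠ b := by
  cases h with
  | path hb hj hi =>
    intro h; have := (code_inj (by omega) hi hj hi h).2.1; omega
  | root hb hi _ => exact (code_lt_hub hb (by omega) hi).ne'
  | back hi => exact (code_lt_hub (by omega) (by omega) hi).ne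
  | left hx hk _ =>
    intro h; have := (code_inj (by omega) (by omega) (by omega) (by omega) h).1; omega
  | right hy hk _ =>
    intro h; have := (code_inj (by omega) (by omega) (by omega) (by omega) h).1; omega
  | switch hk _ =>
    intro h; have := (code_inj (by omega) (by omega) (by omega) (by omega) h).1; omega

theorem edge_switch_iff (hq : 1 < q) (hn : n ≤ S) (hd : d ≤ S) (hn₂ : n₂ ≤ S) {k : ℕ}
    (hk : k < d) :
    Edge q S n d n₂ u v w (code q S 1 (q - 1) k) (code q S 3 (q - 1) k) ↔ w k := by
  refine ⟨fun h => ?_, fun h => .switch hk h⟩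
  generalize ha : code q S 1 (q - 1) k = a at h
  generalize hb : code q S 3 (q - 1) k = b at h
  cases h with
  | path hb' hj hi =>
    have h1 := (code_inj (by omega) (by omega) (by omega) (by omega) ha).1
    have h2 := (code_inj (by omega) (by omega) (by omega) (by omega) hb).1
    omega
  | root hb' hi _ => exact absurd ha (code_lt_hub (by omega) (by omega) (by omega)).ne
  | back hi => exact absurd hb (code_lt_hub (by omega) (by omega) (by omega)).ne
  | left hx hk' _ =>
    have h1 := (code_inj (by omega) (by omega) (by omega) (by omega) ha).1; omega
  | right hy hk' _ =>
    have h1 := (code_inj (by omega) (by omega) (by omega) (by omega) ha).1; omega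
  | switch hk' hw =>
    have h1 := (code_inj (by omega) (by omega) (by omega) (by omega) ha).2.2
    rwa [h1]

/-- Only the constructor `switch` depends on `w`. All comparisons of graphs with different switched
coordinates go through this dichotomy. -/
theorem edge_of_switch {w' : ℕ → Prop} {a b : ℕ} (h : Edge q S n d n₂ u v w a b) :
    Edge q S n d n₂ u v w' a b ∨
      ∃ k < d, w k ∧ a = code q S 1 (q - 1) k ∧ b = code q S 3 (q - 1) k := by
  cases h with
  | path hb hj hi => exact .inl (.path hb hj hi)
  | root hb hi h => exact .inl (.root hb hi h)
  | back hi => exact .inl (.back hi)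
  | left hx hk h => exact .inl (.left hx hk h)
  | right hx hk h => exact .inl (.right hx hk h)
  | switch hk h => exact .inr ⟨_, hk, h, rfl, rfl⟩

theorem Edge.mono {w' : ℕ → Prop} (hw : ∀ k < d, w k → w' k) {a b : ℕ}
    (h : Edge q S n d n₂ u v w a b) : Edge q S n d n₂ u v w' a b := by
  rcases edge_of_switch (w' := w') h with h | ⟨k, hk, hwk, rfl, rfl⟩
  · exact h
  · exact .switch hk (hw k hk hwk)

/-- The vertex with a given number. -/
def vertex (q S x : ℕ) : Fin (hub q S + 1) := Fin.ofNat _ x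

theorem vertex_val {x : ℕ} (hx : x ≤ hub q S) : (vertex q S x : ℕ) = x :=
  Nat.mod_eq_of_lt (Nat.lt_succ_of_le hx)

theorem vertex_code_val {b j i : ℕ} (hb : b < 4) (hj : j < q) (hi : i < S) :
    (vertex q S (code q S b j i) : ℕ) = code q S b j i :=
  vertex_val (code_lt_hub hb hj hi).le

/-- The tail of the edge that switches a coordinate. -/
def switchTail (q S k : ℕ) : Fin (hub q S + 1) := vertex q S (code q S 1 (q - 1) k)

/-- The head of the edge that switches a coordinate. -/
def switchHead (q S k : ℕ) : Fin (hub q S + 1) := vertex q S (code q S 3 (q - 1) k)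

variable {E : Finset (Fin (hub q S + 1) × Fin (hub q S + 1))}

theorem mem_switch_iff (hq : 1 < q) (hn : n ≤ S) (hd : d ≤ S) (hn₂ : n₂ ≤ S) {k : ℕ}
    (hk : k < d) (hE : IsGraph q S n d n₂ u v w E) :
    (switchTail q S k, switchHead q S k) ∈ E ↔ w k := by
  rw [hE, switchTail, switchHead, vertex_code_val (by omega) (by omega) (by omega),
    vertex_code_val (by omega) (by omega) (by omega), edge_switch_iff hq hn hd hn₂ hk]

theorem eq_switch_iff (hq : 1 < q) (hd : d ≤ S) {k : ℕ} (hk : k < d)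
    (a b : Fin (hub q S + 1)) : (a, b) = (switchTail q S k, switchHead q S k) ↔
      (a : ℕ) = code q S 1 (q - 1) k ∧ (b : ℕ) = code q S 3 (q - 1) k := by
  rw [Prod.mk.injEq, Fin.ext_iff, Fin.ext_iff, switchTail, switchHead,
    vertex_code_val (by omega) (by omega) (by omega),
    vertex_code_val (by omega) (by omega) (by omega)]

theorem IsGraph.insert (hq : 1 < q) (hd : d ≤ S) {k : ℕ} (hk : k < d)
    (hE : IsGraph q S n d n₂ u v w E) :
    IsGraph q S n d n₂ u v (fun i => i = k ∨ w i)
      (insert (switchTail q S k, switchHead q S k) E) := by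
  intro a b
  rw [Finset.mem_insert, hE, eq_switch_iff hq hd hk]
  constructor
  · rintro (⟨ha, hb⟩ | h)
    · rw [ha, hb]; exact .switch hk (.inl rfl)
    · exact h.mono fun i _ hi => .inr hi
  · intro h
    rcases edge_of_switch (w' := w) h with h | ⟨i, hi, hwi, ha, hb⟩
    · exact .inr h
    · rcases hwi with rfl | hwi
      · exact .inl ⟨ha, hb⟩
      · rw [ha, hb]; exact .inr (.switch hi hwi)

theorem IsGraph.erase (hq : 1 < q) (hn : n ≤ S) (hd : d ≤ S) (hn₂ : n₂ ≤ S) {k : ℕ} (hk : k < d)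
    (hE : IsGraph q S n d n₂ u v w E) :
    IsGraph q S n d n₂ u v (fun i => i ≠ k ∧ w i)
      (E.erase (switchTail q S k, switchHead q S k)) := by
  intro a b
  rw [Finset.mem_erase, hE, Ne, eq_switch_iff hq hd hk]
  constructor
  · rintro ⟨hne, h⟩
    rcases edge_of_switch (w' := fun i => i ≠ k ∧ w i) h with h | ⟨i, hi, hwi, ha, hb⟩
    · exact h
    · rw [ha, hb]
      refine .switch hi ⟨?_, hwi⟩
      rintro rfl
      exact hne ⟨ha, hb⟩
  · intro h
    refine ⟨fun hc => ?_, h.mono fun i _ hi => hi.2⟩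
    rw [hc.1, hc.2, edge_switch_iff hq hn hd hn₂ hk] at h
    exact h.1 rfl

theorem IsGraph.congr {w' : ℕ → Prop} (hw : ∀ k < d, w k ↔ w' k)
    (hE : IsGraph q S n d n₂ u v w E) : IsGraph q S n d n₂ u v w' E := fun a b =>
  (hE a b).trans ⟨Edge.mono fun k hk => (hw k hk).1, Edge.mono fun k hk => (hw k hk).2⟩

end switch

end Gadget

namespace Gadget

/-! ## The list of edges -/

/-- A rule that generates an edge from each number below a bound that satisfies a condition. -/
structure Rule where
  tag : ℕ
  bound : ℕ
  cond : ℕ → ℕ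
  tail : ℕ → ℕ
  head : ℕ → ℕ

/-- The edges generated by a rule. -/
def Rule.edges (r : Rule) : List (ℕ × ℕ) :=
  ((List.range r.bound).filter fun e => r.cond e ≠ 0).map fun e => (r.tail e, r.head e)

theorem Rule.mem_edges {r : Rule} {x : ℕ × ℕ} :
    x ∈ r.edges ↔ ∃ e < r.bound, r.cond e ≠ 0 ∧ r.tail e = x.1 ∧ r.head e = x.2 := by
  simp [Rule.edges, Prod.ext_iff, and_assoc]

theorem Rule.length_edges_le (r : Rule) : r.edges.length ≤ r.bound := by
  rw [Rule.edges, List.length_map]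
  exact (List.length_filter_le _ _).trans (by simp)

theorem Rule.nodup_edges {r : Rule} (h : ∀ e < r.bound, ∀ e' < r.bound, r.tail e = r.tail e' →
    r.head e = r.head e' → e = e') : r.edges.Nodup := by
  refine List.Nodup.map_on ?_ (List.nodup_range.filter _)
  intro e he e' he' hee
  simp only [List.mem_filter, List.mem_range] at he he'
  exact h e he.1 e' he'.1 (Prod.mk.inj hee).1 (Prod.mk.inj hee).2

/-- The key of an edge reveals which rule generated it, so lists of different rules are disjoint. -/
theorem nodup_flatMap_edges {l : List Rule} (key : ℕ × ℕ → ℕ) (h : ∀ r ∈ l, r.edges.Nodup)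
    (hk : ∀ r ∈ l, ∀ x ∈ r.edges, key x = r.tag) (ht : (l.map Rule.tag).Nodup) :
    (l.flatMap Rule.edges).Nodup := by
  rw [List.nodup_flatMap]
  refine ⟨h, ?_⟩
  rw [List.Nodup, List.pairwise_map] at ht
  refine ht.imp_of_mem fun {a b} ha hb hab => ?_
  rw [Function.onFun, List.disjoint_left]
  intro x hxa hxb
  exact hab ((hk a ha x hxa).symm.trans (hk b hb x hxb))

/-- The rules for the graph, without and with the edges that switch coordinates. -/
def rules (q S n d n₂ : ℕ) (u v : ℕ → ℕ) (full : Bool) : List Rule :=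
  [⟨0, 4 * q * S, fun x => (x / S + 1) % q, fun x => x, fun x => x + S⟩,
   ⟨20, S, fun _ => 1, fun _ => hub q S, fun i => code q S 0 0 i⟩,
   ⟨21, S, fun _ => 1, fun _ => hub q S, fun i => code q S 1 0 i⟩,
   ⟨22, S, fun i => i + 1 - n₂, fun _ => hub q S, fun i => code q S 2 0 i⟩,
   ⟨23, S, fun _ => 1, fun _ => hub q S, fun i => code q S 3 0 i⟩,
   ⟨4, S, fun _ => 1, fun i => code q S 0 (q - 1) i, fun _ => hub q S⟩,
   ⟨1, n * d, u, fun e => code q S 0 (q - 1) (e / d), fun e => code q S 1 (q - 1) (e % d)⟩,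
   ⟨17, n₂ * d, v, fun e => code q S 3 (q - 1) (e % d), fun e => code q S 2 0 (e / d)⟩,
   ⟨8, if full then d else 0, fun _ => 1, fun k => code q S 1 (q - 1) k,
    fun k => code q S 3 (q - 1) k⟩]

/-- The list of edges as pairs of numbers. -/
def edgeCodes (q S n d n₂ : ℕ) (u v : ℕ → ℕ) (full : Bool) : List (ℕ × ℕ) :=
  (rules q S n d n₂ u v full).flatMap Rule.edges

/-- A key that distinguishes the edges of different rules. -/
def edgeKey (q S : ℕ) (x : ℕ × ℕ) : ℕ :=
  if x.1 / (q * S) = x.2 / (q * S) then 0 else 5 * (x.1 / (q * S)) + x.2 / (q * S)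

section list

variable {q S n d n₂ : ℕ} {u v : ℕ → ℕ} {full : Bool}

theorem div_lt_and_mod_lt {e : ℕ} (h : e < n * d) : e / d < n ∧ e % d < d := by
  have hd : 0 < d := by
    rcases Nat.eq_zero_or_pos d with h' | h'
    · simp [h'] at h
    · exact h'
  exact ⟨Nat.div_lt_of_lt_mul (by rwa [mul_comm]), Nat.mod_lt _ hd⟩

theorem eq_of_div_mod {e e' : ℕ} (h : e / d = e' / d) (h' : e % d = e' % d) : e = e' := by
  rw [← Nat.div_add_mod e d, h, h', Nat.div_add_mod]

/-- Adding S moves one row down on the same path. The condition excludes the last row of each block,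
whose lower neighbour would belong to the next block. -/
theorem path_cond {x : ℕ} (hx : x < 4 * q * S) :
    (x / S + 1) % q ≠ 0 → ∃ b < 4, ∃ j, j + 1 < q ∧ ∃ i < S, x = code q S b j i ∧
      x + S = code q S b (j + 1) i := by
  intro h
  obtain ⟨b, hb, j, hj, i, hi, rfl⟩ := exists_code (q := q) (S := S) hx
  refine ⟨b, hb, j, ?_, i, hi, rfl, by unfold code; ring⟩
  by_contra hc
  have hj' : j + 1 = q := by omega
  rw [code_div hi, add_assoc, hj', Nat.mul_add_mod_self_right] at h
  simp at h

theorem path_cond' {b j i : ℕ} (hj : j + 1 < q) (hi : i < S) :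
    (code q S b j i / S + 1) % q ≠ 0 := by
  rw [code_div hi, add_assoc, Nat.mul_add_mod_self_right, Nat.mod_eq_of_lt hj]
  omega

/-- Within one rule, the ends of an edge determine the argument of the rule. Rules are told apart by
the blocks of the two ends: the tags are 5 · (block of the tail) + (block of the head), with the hub
as block 4, and 0 for path edges. -/
theorem nodup_edgeCodes (hq : 1 < q) (hS : 0 < S) (hn : n ≤ S) (hd : d ≤ S) (hn₂ : n₂ ≤ S) :
    (edgeCodes q S n d n₂ u v full).Nodup := by
  have hdb : ∀ {b j i}, j < q → i < S → code q S b j i / (q * S) = b := code_div_block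
  have hh : hub q S / (q * S) = 4 := hub_div (by omega) hS
  refine nodup_flatMap_edges (edgeKey q S) ?_ ?_ (by simp [rules])
  · intro r hr
    refine Rule.nodup_edges fun e he e' he' ht hh => ?_
    simp only [rules, List.mem_cons, List.not_mem_nil, or_false] at hr
    rcases hr with rfl | rfl | rfl | rfl | rfl | rfl | rfl | rfl | rfl
    · exact ht
    · exact (code_inj (by omega) he (by omega) he' hh).2.2
    · exact (code_inj (by omega) he (by omega) he' hh).2.2
    · exact (code_inj (by omega) he (by omega) he' hh).2.2
    · exact (code_inj (by omega) he (by omega) he' hh).2.2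
    · exact (code_inj (by omega) he (by omega) he' ht).2.2
    · have h1 := div_lt_and_mod_lt he
      have h2 := div_lt_and_mod_lt he'
      exact eq_of_div_mod
        (code_inj (by omega) (by omega) (by omega) (by omega) ht).2.2
        (code_inj (by omega) (by omega) (by omega) (by omega) hh).2.2
    · have h1 := div_lt_and_mod_lt he
      have h2 := div_lt_and_mod_lt he'
      exact eq_of_div_mod
        (code_inj (by omega) (by omega) (by omega) (by omega) hh).2.2
        (code_inj (by omega) (by omega) (by omega) (by omega) ht).2.2
    · have hf : (if full = true then d else 0) ≤ S := by split <;> omega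
      exact (code_inj (by omega) (lt_of_lt_of_le he hf) (by omega) (lt_of_lt_of_le he' hf) ht).2.2
  · intro r hr x hx
    obtain ⟨a, b⟩ := x
    obtain ⟨e, he, hc, h1, h2⟩ := Rule.mem_edges.1 hx
    simp only at h1 h2
    subst h1 h2
    simp only [rules, List.mem_cons, List.not_mem_nil, or_false] at hr
    rcases hr with rfl | rfl | rfl | rfl | rfl | rfl | rfl | rfl | rfl <;>
      simp only [edgeKey] at he hc ⊢
    · obtain ⟨b, hb, j, hj, i, hi, h1, h2⟩ := path_cond he hc
      rw [h2, h1, hdb (by omega) hi, hdb (by omega) hi, if_pos rfl]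
    · rw [hh, hdb (by omega) he]; rfl
    · rw [hh, hdb (by omega) he]; rfl
    · rw [hh, hdb (by omega) he]; rfl
    · rw [hh, hdb (by omega) he]; rfl
    · rw [hh, hdb (by omega) he]; rfl
    · have h1 := div_lt_and_mod_lt he
      rw [hdb (by omega) (by omega), hdb (by omega) (by omega)]; rfl
    · have h1 := div_lt_and_mod_lt he
      rw [hdb (by omega) (by omega), hdb (by omega) (by omega)]; rfl
    · have : e < S := by split at he <;> omega
      rw [hdb (by omega) this, hdb (by omega) this]; rfl

theorem mem_edgeCodes (hq : 1 < q) {a b : ℕ} :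
    (a, b) ∈ edgeCodes q S n d n₂ u v full ↔ Edge q S n d n₂ (fun x k => u (x * d + k) ≠ 0)
      (fun y k => v (y * d + k) ≠ 0) (fun _ => full = true) a b := by
  have hdm : ∀ {x k}, k < d → (x * d + k) / d = x ∧ (x * d + k) % d = k := fun {x k} hk =>
    ⟨by rw [mul_comm, Nat.mul_add_div (by omega), Nat.div_eq_of_lt hk, add_zero],
      by rw [Nat.mul_add_mod_self_right, Nat.mod_eq_of_lt hk]⟩
  have hlt : ∀ {m x k}, x < m → k < d → x * d + k < m * d := fun {m x k} hx hk =>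
    calc x * d + k < (x + 1) * d := by rw [add_mul]; omega
      _ ≤ m * d := Nat.mul_le_mul_right _ hx
  simp only [edgeCodes, List.mem_flatMap]
  constructor
  · rintro ⟨r, hr, hx⟩
    obtain ⟨e, he, hc, h1, h2⟩ := Rule.mem_edges.1 hx
    simp only at h1 h2
    subst h1 h2
    simp only [rules, List.mem_cons, List.not_mem_nil, or_false] at hr
    rcases hr with rfl | rfl | rfl | rfl | rfl | rfl | rfl | rfl | rfl <;> simp only at he hc ⊢
    · obtain ⟨b, hb, j, hj, i, hi, h1, h2⟩ := path_cond he hc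
      rw [h2, h1]
      exact .path hb hj hi
    · exact .root (by omega) he (by omega)
    · exact .root (by omega) he (by omega)
    · exact .root (by omega) he (by omega)
    · exact .root (by omega) he (by omega)
    · exact .back he
    · have h1 := div_lt_and_mod_lt he
      exact .left h1.1 h1.2 (by rwa [Nat.div_add_mod'])
    · have h1 := div_lt_and_mod_lt he
      exact .right h1.1 h1.2 (by rwa [Nat.div_add_mod'])
    · by_cases hf : full = true
      · rw [if_pos hf] at he
        exact .switch he hf
      · rw [if_neg hf] at he; omega
  · intro h
    simp only [rules, List.mem_cons, List.not_mem_nil, or_false, exists_eq_or_imp,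
      exists_eq_left, Rule.mem_edges]
    cases h with
    | @path b j i hb hj hi =>
      exact .inl ⟨_, code_lt_hub hb (by omega) hi, path_cond' hj hi, rfl, by unfold code; ring⟩
    | @root b i hb hi h =>
      have hb' : b = 0 ∨ b = 1 ∨ b = 2 ∨ b = 3 := by omega
      rcases hb' with rfl | rfl | rfl | rfl
      · exact .inr (.inl ⟨i, hi, by simp, rfl, rfl⟩)
      · exact .inr (.inr (.inl ⟨i, hi, by simp, rfl, rfl⟩))
      · exact .inr (.inr (.inr (.inl ⟨i, hi, by have := h rfl; omega, rfl, rfl⟩)))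
      · exact .inr (.inr (.inr (.inr (.inl ⟨i, hi, by simp, rfl, rfl⟩))))
    | @back i hi => exact .inr (.inr (.inr (.inr (.inr (.inl ⟨i, hi, by simp, rfl, rfl⟩)))))
    | @left x k hx hk h =>
      exact .inr (.inr (.inr (.inr (.inr (.inr (.inl ⟨x * d + k, hlt hx hk, h,
        by rw [(hdm hk).1], by rw [(hdm hk).2]⟩))))))
    | @right y k hy hk h =>
      exact .inr (.inr (.inr (.inr (.inr (.inr (.inr (.inl ⟨y * d + k, hlt hy hk, h,
        by rw [(hdm hk).2], by rw [(hdm hk).1]⟩)))))))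
    | @switch k hk h =>
      exact .inr (.inr (.inr (.inr (.inr (.inr (.inr (.inr ⟨k, by rwa [if_pos h], by simp, rfl,
        rfl⟩)))))))

/-- Each of the eight rules other than the one for paths has at most S arguments, whatever the bits
are; this is why S must dominate n · d and n₂ · d. -/
theorem length_edgeCodes_le (hn : n * d ≤ S) (hd : d ≤ S) (hn₂ : n₂ * d ≤ S) :
    (edgeCodes q S n d n₂ u v full).length ≤ 4 * q * S + 8 * S := by
  have h := fun r => Rule.length_edges_le r
  simp only [edgeCodes, rules, List.length_flatMap, List.map_cons, List.map_nil, List.sum_cons,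
    List.sum_nil]
  have hf : (if full = true then d else 0) ≤ S := by split <;> omega
  have key : ∀ {a₀ a₁ a₂ a₃ a₄ a₅ a₆ a₇ a₈ b c e f : ℕ}, a₀ ≤ b → a₁ ≤ S → a₂ ≤ S → a₃ ≤ S →
      a₄ ≤ S → a₅ ≤ S → a₆ ≤ c → c ≤ S → a₇ ≤ e → e ≤ S → a₈ ≤ f → f ≤ S →
      a₀ + (a₁ + (a₂ + (a₃ + (a₄ + (a₅ + (a₆ + (a₇ + (a₈ + 0)))))))) ≤ b + 8 * S := by
    intros; omega
  exact key (h _) (h _) (h _) (h _) (h _) (h _) (h _) hn (h _) hn₂ (h _) hf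

/-- The list of edges. -/
def edgeList (q S n d n₂ : ℕ) (u v : ℕ → ℕ) (full : Bool) :
    List (Fin (hub q S + 1) × Fin (hub q S + 1)) :=
  (edgeCodes q S n d n₂ u v full).map fun x => (vertex q S x.1, vertex q S x.2)

theorem edgeCodes_le (hq : 1 < q) (hn : n ≤ S) (hd : d ≤ S) (hn₂ : n₂ ≤ S) {x : ℕ × ℕ}
    (hx : x ∈ edgeCodes q S n d n₂ u v full) : x.1 ≤ hub q S ∧ x.2 ≤ hub q S :=
  ((mem_edgeCodes hq).1 hx).lt (by omega) hn hd hn₂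

theorem nodup_edgeList (hq : 1 < q) (hS : 0 < S) (hn : n ≤ S) (hd : d ≤ S) (hn₂ : n₂ ≤ S) :
    (edgeList q S n d n₂ u v full).Nodup := by
  refine List.Nodup.map_on ?_ (nodup_edgeCodes hq hS hn hd hn₂)
  intro x hx y hy hxy
  have h1 := edgeCodes_le hq hn hd hn₂ hx
  have h2 := edgeCodes_le hq hn hd hn₂ hy
  simp only [Prod.mk.injEq, Fin.ext_iff, vertex_val h1.1, vertex_val h1.2, vertex_val h2.1,
    vertex_val h2.2] at hxy
  exact Prod.ext hxy.1 hxy.2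

theorem isGraph_edgeList (hq : 1 < q) (hn : n ≤ S) (hd : d ≤ S) (hn₂ : n₂ ≤ S) :
    IsGraph q S n d n₂ (fun x k => u (x * d + k) ≠ 0) (fun y k => v (y * d + k) ≠ 0)
      (fun _ => full = true) (edgeList q S n d n₂ u v full).toFinset := by
  intro a b
  rw [List.mem_toFinset, edgeList, List.mem_map, ← mem_edgeCodes hq]
  constructor
  · rintro ⟨x, hx, hab⟩
    have h1 := edgeCodes_le hq hn hd hn₂ hx
    simp only [Prod.mk.injEq, Fin.ext_iff, vertex_val h1.1, vertex_val h1.2] at hab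
    rwa [← hab.1, ← hab.2]
  · intro h
    refine ⟨_, h, ?_⟩
    simp only [Prod.mk.injEq, Fin.ext_iff]
    exact ⟨vertex_val (Nat.lt_succ_iff.1 a.2), vertex_val (Nat.lt_succ_iff.1 b.2)⟩

end list

/-! ## Legal sequences of operations -/

section ops

variable {q S n d n₂ : ℕ} {u v : ℕ → ℕ} {w : ℕ → Prop}
  {E : Finset (Fin (hub q S + 1) × Fin (hub q S + 1))}

/-- The sizes of the graph are suitable. -/
structure Sizes (q S n d n₂ : ℕ) : Prop where
  one_lt : 1 < q
  pos : 0 < S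
  n_le : n ≤ S
  d_le : d ≤ S
  n₂_le : n₂ ≤ S
  nd_le : n * d ≤ S
  n₂d_le : n₂ * d ≤ S

/-- `IsGraph` for vectors given as arrays of bits. -/
abbrev IsBitGraph (q S n d n₂ : ℕ) (u v : ℕ → ℕ) (w : ℕ → Prop)
    (E : Finset (Fin (hub q S + 1) × Fin (hub q S + 1))) : Prop :=
  IsGraph q S n d n₂ (fun x k => u (x * d + k) ≠ 0) (fun y k => v (y * d + k) ≠ 0) w E

/-- There is room for all the edges. -/
def Roomy (c : ℝ) (k q S : ℕ) : Prop :=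
  ((4 * q * S + 8 * S : ℕ) : ℝ) ≤ c * (hub q S + 1 : ℕ) * Real.log (hub q S + 1 : ℕ) ^ k

/-- Every graph that occurs is contained in the one with all coordinates switched on, so a single
count covers all stages. -/
theorem isSparse (h : Sizes q S n d n₂) (hE : IsBitGraph q S n d n₂ u v w E) {c : ℝ} {k : ℕ}
    (hc : Roomy c k q S) : IsSparse c k E := by
  refine ⟨fun a ha => ((hE a a).1 ha).ne h.one_lt h.n_le h.d_le h.n₂_le rfl, le_trans ?_ hc⟩
  have hsub : E ⊆ (edgeList q S n d n₂ u v true).toFinset := by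
    rintro ⟨a, b⟩ hab
    rw [isGraph_edgeList h.one_lt h.n_le h.d_le h.n₂_le]
    exact ((hE a b).1 hab).mono fun _ _ _ => rfl
  have h1 := (Finset.card_le_card hsub).trans (List.toFinset_card_le _)
  rw [edgeList, List.length_map] at h1
  exact_mod_cast h1.trans (length_edgeCodes_le h.nd_le h.d_le h.n₂d_le)

/-- The insertion or deletion of the edge that switches coordinate `i`. -/
def switchOp (q S : ℕ) (ins : Bool) (i : ℕ) : Op (hub q S + 1) :=
  if ins then .insert (switchTail q S i) (switchHead q S i)
  else .delete (switchTail q S i) (switchHead q S i)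

/-- The setting admits insertions, or deletions. -/
def Admits (M : Setting) (ins : Bool) : Prop :=
  if ins then M ≠ .decremental else M ≠ .incremental

theorem foldl_switch (h : Sizes q S n d n₂) (ins : Bool) (l : List ℕ) :
    ∀ {w : ℕ → Prop} {E}, (∀ i ∈ l, i < d) → IsBitGraph q S n d n₂ u v w E →
      IsBitGraph q S n d n₂ u v (fun i => if i ∈ l then ins = true else w i)
        ((l.map (switchOp q S ins)).foldl Op.apply E) := by
  induction l with
  | nil => intro w E _ hE; simpa using hE
  | cons j l ih =>
    intro w E hl hE
    have hj : j < d := hl j List.mem_cons_self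
    have hl' : ∀ i ∈ l, i < d := fun i hi => hl i (List.mem_cons_of_mem _ hi)
    rw [List.map_cons, List.foldl_cons]
    cases ins with
    | true =>
      refine (ih hl' (hE.insert h.one_lt h.d_le hj)).congr fun k _ => ?_
      by_cases hkl : k ∈ l <;> by_cases hkj : k = j <;> simp [hkl, hkj]
    | false =>
      refine (ih hl' (hE.erase h.one_lt h.n_le h.d_le h.n₂_le hj)).congr fun k _ => ?_
      by_cases hkl : k ∈ l <;> by_cases hkj : k = j <;> simp [hkl, hkj]

/-- Since the coordinates in `l` are distinct, an operation does not touch the edges of the later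
ones: these stay absent before their insertion and present before their deletion. -/
theorem legal_switch (h : Sizes q S n d n₂) {c : ℝ} {kk : ℕ} (hc : Roomy c kk q S)
    {M : Setting} {ins : Bool} (hM : Admits M ins) {os : List (Op (hub q S + 1))} (l : List ℕ) :
    ∀ {w : ℕ → Prop} {E}, l.Nodup → (∀ i ∈ l, i < d ∧ (w i ↔ ins = false)) →
      IsBitGraph q S n d n₂ u v w E →
      LegalSeq M c kk ((l.map (switchOp q S ins)).foldl Op.apply E) os →
      LegalSeq M c kk E (l.map (switchOp q S ins) ++ os) := by
  induction l with
  | nil => intro w E _ _ _ h; exact h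
  | cons j l ih =>
    intro w E hnd hl hE hos
    have hj := hl j List.mem_cons_self
    have hnd' := List.nodup_cons.1 hnd
    have hjl : ∀ i ∈ l, i ≠ j := fun i hi hij => hnd'.1 (hij ▸ hi)
    have hmem := mem_switch_iff (n := n) (n₂ := n₂) (v := fun y k => v (y * d + k) ≠ 0)
      (u := fun x k => u (x * d + k) ≠ 0) h.one_lt h.n_le h.d_le h.n₂_le hj.1 hE
    rw [List.map_cons, List.cons_append]
    refine ⟨isSparse h hE hc, ?_, ?_⟩
    · cases ins with
      | true => exact ⟨hM, by rw [hmem]; simp [hj.2]⟩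
      | false => exact ⟨hM, by rw [hmem]; simp [hj.2]⟩
    · cases ins with
      | true =>
        refine ih hnd'.2 (fun i hi => ⟨(hl i (List.mem_cons_of_mem _ hi)).1, ?_⟩)
          (hE.insert h.one_lt h.d_le hj.1) hos
        simpa [hjl i hi] using (hl i (List.mem_cons_of_mem _ hi)).2
      | false =>
        refine ih hnd'.2 (fun i hi => ⟨(hl i (List.mem_cons_of_mem _ hi)).1, ?_⟩)
          (hE.erase h.one_lt h.n_le h.d_le h.n₂_le hj.1) hos
        simpa [hjl i hi] using (hl i (List.mem_cons_of_mem _ hi)).2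

/-- The coordinates that are switched on, or off, by a vector given as an array of bits. -/
def coords (d : ℕ) (w : ℕ → ℕ) (on : Bool) : List ℕ :=
  (List.range d).filter fun i => decide (w i ≠ 0) == on

theorem mem_coords {w : ℕ → ℕ} {on : Bool} {i : ℕ} :
    i ∈ coords d w on ↔ i < d ∧ (w i ≠ 0 ↔ on = true) := by
  cases on <;> simp [coords]

theorem nodup_coords (w : ℕ → ℕ) (on : Bool) : (coords d w on).Nodup := List.nodup_range.filter _

/-- The operations that switch from the basic graph to the graph of a vector: insertions of the
edges for its ones, or deletions of the edges for its zeros. -/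
def forth (q S d : ℕ) (w : ℕ → ℕ) (ins : Bool) : List (Op (hub q S + 1)) :=
  (coords d w ins).map (switchOp q S ins)

/-- The operations that undo the insertions again, in the fully dynamic setting. -/
def back (q S d : ℕ) (w : ℕ → ℕ) : List (Op (hub q S + 1)) :=
  (coords d w true).map (switchOp q S false)

theorem isBitGraph_forth (h : Sizes q S n d n₂) (w : ℕ → ℕ) (ins : Bool)
    (hE : IsBitGraph q S n d n₂ u v (fun _ => ins = false) E) :
    IsBitGraph q S n d n₂ u v (fun i => w i ≠ 0) ((forth q S d w ins).foldl Op.apply E) := by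
  refine (foldl_switch h ins _ (fun i hi => (mem_coords.1 hi).1) hE).congr fun k hk => ?_
  cases ins <;> by_cases hw : w k = 0 <;> simp [mem_coords, hk, hw]

theorem isBitGraph_back (h : Sizes q S n d n₂) (w : ℕ → ℕ)
    (hE : IsBitGraph q S n d n₂ u v (fun i => w i ≠ 0) E) :
    IsBitGraph q S n d n₂ u v (fun _ => true = false) ((back q S d w).foldl Op.apply E) := by
  refine (foldl_switch h false _ (fun i hi => (mem_coords.1 hi).1) hE).congr fun k hk => ?_
  by_cases hw : w k = 0 <;> simp [mem_coords, hk, hw]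

theorem legal_forth (h : Sizes q S n d n₂) {c : ℝ} {kk : ℕ} (hc : Roomy c kk q S)
    {M : Setting} {ins : Bool} (hM : Admits M ins) {os : List (Op (hub q S + 1))} {w : ℕ → ℕ}
    (hE : IsBitGraph q S n d n₂ u v (fun _ => ins = false) E)
    (hos : LegalSeq M c kk ((forth q S d w ins).foldl Op.apply E) os) :
    LegalSeq M c kk E (forth q S d w ins ++ os) :=
  legal_switch h hc hM _ (nodup_coords _ _) (fun _ hi => ⟨(mem_coords.1 hi).1, Iff.rfl⟩) hE hos

theorem legal_back (h : Sizes q S n d n₂) {c : ℝ} {kk : ℕ} (hc : Roomy c kk q S)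
    {M : Setting} (hM : Admits M false) {os : List (Op (hub q S + 1))} {w : ℕ → ℕ}
    (hE : IsBitGraph q S n d n₂ u v (fun i => w i ≠ 0) E)
    (hos : LegalSeq M c kk ((back q S d w).foldl Op.apply E) os) :
    LegalSeq M c kk E (back q S d w ++ os) :=
  legal_switch h hc hM _ (nodup_coords _ _)
    (fun i hi => ⟨(mem_coords.1 hi).1, by simpa using (mem_coords.1 hi).2⟩) hE hos

theorem legalSeq_query {M : Setting} {c : ℝ} {kk : ℕ} {os : List (Op (hub q S + 1))}
    (h : IsSparse c kk E) (hos : LegalSeq M c kk E os) : LegalSeq M c kk E (.query :: os) :=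
  ⟨h, trivial, hos⟩

end ops

end Gadget

namespace Gadget

/-! ## Building the list of edges -/

theorem Store.ext' {s s' : Store} (h : ∀ x, s.var x = s'.var x) (h' : ∀ a i, s.arr a i = s'.arr a i) :
    s = s' := by
  cases s; cases s'
  simp only [Store.mk.injEq]
  exact ⟨funext h, funext fun a => funext (h' a)⟩

/-- A rule in terms of expressions; the argument is passed in register 6. -/
structure RuleExpr where
  bound : Expr
  cond : Expr
  tail : Expr
  head : Expr

/-- A bound for the number of steps per argument of a rule. -/
def RuleExpr.time (r : RuleExpr) : ℕ :=
  r.bound.time + r.cond.time + r.tail.time + r.head.time + 50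

/-- Append the edges generated by a rule to the list in the arrays 10 and 15, whose length is kept
in register 8. -/
def RuleExpr.cmd (t : ℕ) (r : RuleExpr) : Cmd :=
  .seq (.set t 7 r.bound) (.seq (.set t 6 (.num 0))
    (.while t (.bin .minus (.reg 7) (.reg 6))
      (.seq (.cond t r.cond
        (.seq (.put t 10 (.reg 8) r.tail) (.seq (.put t 15 (.reg 8) r.head)
          (.set t 8 (.bin .plus (.reg 8) (.num 1))))) .skip)
        (.set t 6 (.bin .plus (.reg 6) (.num 1))))))

/-- The store with the list `l` in the arrays 10 and 15, in iteration `e` of `b`. -/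
def listStore (s : Store) (l : List (ℕ × ℕ)) (b e : ℕ) : Store where
  var x := if x = 6 then e else if x = 7 then b else if x = 8 then l.length else s.var x
  arr a i := if a = 10 then (l.map Prod.fst).getD i 0
    else if a = 15 then (l.map Prod.snd).getD i 0 else s.arr a i

/-- The value of an expression, and that it can be computed. -/
def Computes (t B : ℕ) (s : Store) (e : Expr) (x : ℕ) : Prop := e.Fits t B s ∧ e.eval s = x

theorem Computes.num {t B v : ℕ} (s : Store) (h : v < B) : Computes t B s (.num v) v := ⟨h, rfl⟩

theorem Computes.reg {t B x v : ℕ} {s : Store} (hx : x < t) (h : s.var x = v) (hv : v < B) :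
    Computes t B s (.reg x) v := ⟨⟨hx, by rwa [h]⟩, h⟩

theorem Computes.bin {t B x y z : ℕ} {s : Store} {o : BinOp} {e e' : Expr} (h : Computes t B s e x)
    (h' : Computes t B s e' y) (hz : o.eval x y = z) (hB : z < B) :
    Computes t B s (.bin o e e') z :=
  ⟨⟨h.1, h'.1, by rw [h.2, h'.2, hz]; exact hB⟩, by rw [Expr.eval, h.2, h'.2, hz]⟩

theorem Computes.get {t B a x z : ℕ} {s : Store} {e : Expr} (h : Computes t B s e x)
    (hz : s.arr a x = z) (hB : z < B) : Computes t B s (.get a e) z :=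
  ⟨⟨h.1, by rw [h.2, hz]; exact hB⟩, by rw [Expr.eval, h.2, hz]⟩

/-- The expressions describe the rule, for lists of length at most `m`. -/
structure Implements (t B : ℕ) (s : Store) (m : ℕ) (re : RuleExpr) (r : Rule) : Prop where
  bound : ∀ l b e, l.length ≤ m → b < B → e < B →
    Computes t B (listStore s l b e) re.bound r.bound
  cond : ∀ l e, l.length ≤ m → e < r.bound →
    Computes t B (listStore s l r.bound e) re.cond (r.cond e)
  tail : ∀ l e, l.length ≤ m → e < r.bound →
    Computes t B (listStore s l r.bound e) re.tail (r.tail e)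
  head : ∀ l e i x, l.length ≤ m → e < r.bound →
    Computes t B ((listStore s l r.bound e).setArr 10 i x) re.head (r.head e)
  lt : r.bound < B

theorem getD_append_singleton (l : List (ℕ × ℕ)) (x : ℕ × ℕ) (f : ℕ × ℕ → ℕ) (i : ℕ) :
    ((l ++ [x]).map f).getD i 0 = if i = l.length then f x else (l.map f).getD i 0 := by
  rw [List.map_append, List.getD_eq_getElem?_getD, List.getD_eq_getElem?_getD]
  by_cases h1 : i < l.length
  · rw [List.getElem?_append_left (by simpa using h1), if_neg h1.ne]
  · by_cases h2 : i = l.length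
    · simp [h2]
    · rw [List.getElem?_eq_none (by simp; omega), if_neg h2,
        List.getElem?_eq_none (by simp; omega)]

theorem listStore_append (s : Store) (l : List (ℕ × ℕ)) (b e x y : ℕ) :
    (((listStore s l b e).setArr 10 l.length x).setArr 15 l.length y).setVar 8 (l.length + 1) =
      listStore s (l ++ [(x, y)]) b e := by
  refine Store.ext' (fun z => ?_) fun a i => ?_
  · simp only [Store.setVar, Store.setArr, listStore, Function.update_apply, List.length_append,
      List.length_singleton]
    split_ifs <;> first | rfl | omega
  · simp only [Store.setVar, Store.setArr, listStore, Function.update_apply,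
      getD_append_singleton]
    split_ifs <;> first | rfl | simp_all

theorem listStore_setVar_six (s : Store) (l : List (ℕ × ℕ)) (b e e' : ℕ) :
    (listStore s l b e).setVar 6 e' = listStore s l b e' := by
  refine Store.ext' (fun z => ?_) fun a i => rfl
  simp only [Store.setVar, listStore, Function.update_apply]
  split_ifs <;> rfl

theorem listStore_setVar_seven (s : Store) (l : List (ℕ × ℕ)) (b e b' : ℕ) :
    (listStore s l b e).setVar 7 b' = listStore s l b' e := by
  refine Store.ext' (fun z => ?_) fun a i => rfl
  simp only [Store.setVar, listStore, Function.update_apply]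
  split_ifs <;> first | rfl | omega

/-- Per argument there is one test and at most one append. The assumption on `l` and the bound of
the rule keeps the length within `m`, so the counter remains a word. -/
theorem runs_rule {t B m : ℕ} {s : Store} {re : RuleExpr} {r : Rule}
    (h : Implements t B s m re r) (ht : 40 ≤ t) (hB : m + 1 < B) (l : List (ℕ × ℕ)) {b e : ℕ}
    (hl : l.length + r.bound ≤ m) (hb : b < B) (he : e < B) :
    Runs t B (re.cmd t) (listStore s l b e) ((r.bound + 1) * re.time)
      (listStore s (l ++ r.edges) r.bound r.bound) := by
  have h0 := h.bound l b e (by omega) hb he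
  have r1 : Runs t B (.set t 7 re.bound) (listStore s l b e) (re.bound.time + 2)
      (listStore s l r.bound e) := by
    have := Runs.set (x := 7) h0.1 (by rw [h0.2]; exact h.lt)
    rwa [h0.2, listStore_setVar_seven] at this
  have r2 : Runs t B (.set t 6 (.num 0)) (listStore s l r.bound e) 3
      (listStore s l r.bound 0) := by
    have := Runs.set (t := t) (B := B) (x := 6) (e := .num 0) (s := listStore s l r.bound e)
      (show 0 < B by omega) (show 0 < B by omega)
    rwa [Expr.eval, listStore_setVar_six] at this
  -- The edges from arguments below `e`; the loop invariant is that exactly these have been appended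
  -- to `l`.
  let part : ℕ → List (ℕ × ℕ) := fun e =>
    ((List.range e).filter fun e => r.cond e ≠ 0).map fun e => (r.tail e, r.head e)
  have hpart : ∀ e, (part e).length ≤ e := fun e => by
    simp only [part, List.length_map]
    exact (List.length_filter_le _ _).trans (by simp)
  let st : ℕ → Store := fun e => listStore s (l ++ part e) r.bound e
  have hlen : ∀ e ≤ r.bound, (l ++ part e).length ≤ m := fun e he => by
    rw [List.length_append]; have := hpart e; omega
  have r3 : Runs t B (.while t (.bin .minus (.reg 7) (.reg 6))
      (.seq (.cond t re.cond
        (.seq (.put t 10 (.reg 8) re.tail) (.seq (.put t 15 (.reg 8) re.head)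
          (.set t 8 (.bin .plus (.reg 8) (.num 1))))) .skip)
        (.set t 6 (.bin .plus (.reg 6) (.num 1))))) (st 0)
      (r.bound * (re.cond.time + re.tail.time + re.head.time + 37) + 7) (st r.bound) := by
    refine (Runs.while (n := re.cond.time + re.tail.time + re.head.time + 30) st ?_ ?_ ?_ ?_)
    · intro e he
      have := h.lt
      simp [Expr.Fits, Expr.eval, BinOp.eval, st, listStore]
      omega
    · intro e he
      simp [Expr.eval, BinOp.eval, st, listStore]
      omega
    · simp [Expr.eval, BinOp.eval, st, listStore]
    · intro e he
      have hl' := hlen e he.le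
      obtain ⟨c1, c2⟩ := h.cond _ e hl' he
      obtain ⟨t1, t2⟩ := h.tail _ e hl' he
      have hlt := h.lt
      have inc : ∀ l', Runs t B (.set t 6 (.bin .plus (.reg 6) (.num 1)))
          (listStore s l' r.bound e) 7 (listStore s l' r.bound (e + 1)) := by
        intro l'
        have := Runs.set (t := t) (B := B) (x := 6) (e := .bin .plus (.reg 6) (.num 1))
          (s := listStore s l' r.bound e)
          (by simp [Expr.Fits, Expr.eval, BinOp.eval, listStore]; omega)
          (by simp [Expr.eval, BinOp.eval, listStore]; omega)
        have e6 : (Expr.bin .plus (.reg 6) (.num 1)).eval (listStore s l' r.bound e) = e + 1 := by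
          simp [Expr.eval, BinOp.eval, listStore]
        rw [e6, listStore_setVar_six] at this
        exact this
      have hpe : part (e + 1) = if r.cond e ≠ 0 then part e ++ [(r.tail e, r.head e)]
          else part e := by
        simp only [part, List.range_succ, List.filter_append, List.map_append]
        split_ifs with hc <;> simp [hc]
      by_cases hc : r.cond e = 0
      · rw [if_neg (by simpa using hc)] at hpe
        have := ((Runs.cond_false (c := .seq (.put t 10 (.reg 8) re.tail)
          (.seq (.put t 15 (.reg 8) re.head)
          (.set t 8 (.bin .plus (.reg 8) (.num 1))))) c1 (by rw [c2, hc])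
          (Runs.skip t B _)).seq (inc _))
        simp only [st, hpe]
        exact this.mono (by omega)
      · rw [if_pos hc] at hpe
        set s₁ := listStore s (l ++ part e) r.bound e with hs₁
        have e8 : (Expr.reg 8).eval s₁ = (l ++ part e).length := by
          simp [Expr.eval, hs₁, listStore]
        have f8 : (Expr.reg 8).Fits t B s₁ := by
          refine ⟨by omega, ?_⟩
          change (Expr.reg 8).eval s₁ < B
          rw [e8]; omega
        have p1 := Runs.put (a := 10) f8 t1
        rw [t2, e8] at p1
        obtain ⟨d1, d2⟩ := h.head _ e (l ++ part e).length (r.tail e) hl' he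
        rw [← hs₁] at d1 d2
        have p2 := Runs.put (a := 15) (s := s₁.setArr 10 (l ++ part e).length (r.tail e))
          (i := .reg 8) f8 d1
        rw [d2, show (Expr.reg 8).eval (s₁.setArr 10 (l ++ part e).length (r.tail e)) =
          (l ++ part e).length from e8] at p2
        have e9 : (Expr.bin .plus (.reg 8) (.num 1)).eval
            ((s₁.setArr 10 (l ++ part e).length (r.tail e)).setArr 15 (l ++ part e).length
              (r.head e)) = (l ++ part e).length + 1 := by
          simp only [Expr.eval, BinOp.eval] at e8 ⊢
          exact congrArg (· + 1) e8
        have p3 := Runs.set (t := t) (B := B) (x := 8) (e := .bin .plus (.reg 8) (.num 1))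
          (s := (s₁.setArr 10 (l ++ part e).length (r.tail e)).setArr 15 (l ++ part e).length
            (r.head e)) ⟨f8, show 1 < B by omega, e9.trans_lt (by omega)⟩ (by rw [e9]; omega)
        rw [e9, hs₁, listStore_append] at p3
        have := (Runs.cond_true (d := .skip) c1 (by rw [c2]; exact hc)
          (p1.seq (p2.seq p3))).seq (inc _)
        simp only [st, hpe, ← List.append_assoc]
        refine this.mono ?_
        simp only [Expr.time]
        omega
  have hst : st 0 = listStore s l r.bound 0 := by simp [st, part]
  have hfin : st r.bound = listStore s (l ++ r.edges) r.bound r.bound := rfl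
  rw [hst, hfin] at r3
  refine (r1.seq (r2.seq r3)).mono ?_
  rw [RuleExpr.time, add_mul, one_mul]
  have : r.bound * (re.cond.time + re.tail.time + re.head.time + 37) ≤
      r.bound * (re.bound.time + re.cond.time + re.tail.time + re.head.time + 50) :=
    Nat.mul_le_mul_left _ (by omega)
  omega

end Gadget

namespace Gadget

/-- Run a list of rules. -/
def rulesCmd (t : ℕ) : List RuleExpr → Cmd
  | [] => .skip
  | r :: rs => .seq (r.cmd t) (rulesCmd t rs)

/-- The existential values are the leftovers in registers 6 and 7. The next rule overwrites them, so
only that they are words is needed. -/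
theorem runs_rules {t B m X : ℕ} {s : Store} (ht : 40 ≤ t) (hB : m + 1 < B)
    {res : List RuleExpr} {rs : List Rule} (h : List.Forall₂ (Implements t B s m) res rs) :
    ∀ (l : List (ℕ × ℕ)) {b e : ℕ}, l.length + (rs.map Rule.bound).sum ≤ m → b < B → e < B →
      (∀ r ∈ rs, r.bound ≤ X) →
      ∃ b' e', Runs t B (rulesCmd t res) (listStore s l b e)
        ((X + 1) * ((res.map RuleExpr.time).sum + res.length) + 1)
        (listStore s (l ++ rs.flatMap Rule.edges) b' e') := by
  induction h with
  | nil =>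
    intro l b e _ _ _ _
    exact ⟨b, e, by simpa [rulesCmd] using Runs.skip t B _⟩
  | @cons re r res rs h _ ih =>
    intro l b e hl hb he hX
    simp only [List.map_cons, List.sum_cons] at hl
    have h1 := runs_rule h ht hB l (b := b) (e := e) (by omega) hb he
    have hlen : (l ++ r.edges).length + (rs.map Rule.bound).sum ≤ m := by
      rw [List.length_append]
      have := r.length_edges_le
      omega
    obtain ⟨b', e', h2⟩ := ih (l ++ r.edges) hlen h.lt h.lt
      fun r' hr' => hX r' (List.mem_cons_of_mem _ hr')
    refine ⟨b', e', ?_⟩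
    rw [List.flatMap_cons, ← List.append_assoc]
    refine (h1.seq h2).mono ?_
    have h3 : (r.bound + 1) * re.time ≤ (X + 1) * re.time :=
      Nat.mul_le_mul_right _ (Nat.succ_le_succ (hX r List.mem_cons_self))
    simp only [List.map_cons, List.sum_cons, List.length_cons]
    nlinarith

/-- The number of a vertex in a given row. -/
def codeExpr (row : ℕ) (e : Expr) : Expr := .bin .plus (.bin .times (.num row) (.reg 4)) e

/-- The rules as expressions; the registers 0, 1, 3, 4, 5 hold the number of vectors in `U` and in
`V`, the dimension, the number of paths in a block and the hub. -/
def ruleExprs (q : ℕ) (full : Bool) : List RuleExpr :=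
  [⟨.reg 5, .bin .rem (.bin .plus (.bin .quot (.reg 6) (.reg 4)) (.num 1)) (.num q), .reg 6,
    .bin .plus (.reg 6) (.reg 4)⟩,
   ⟨.reg 4, .num 1, .reg 5, codeExpr (0 * q + 0) (.reg 6)⟩,
   ⟨.reg 4, .num 1, .reg 5, codeExpr (1 * q + 0) (.reg 6)⟩,
   ⟨.reg 4, .bin .minus (.bin .plus (.reg 6) (.num 1)) (.reg 1), .reg 5,
    codeExpr (2 * q + 0) (.reg 6)⟩,
   ⟨.reg 4, .num 1, .reg 5, codeExpr (3 * q + 0) (.reg 6)⟩,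
   ⟨.reg 4, .num 1, codeExpr (0 * q + (q - 1)) (.reg 6), .reg 5⟩,
   ⟨.bin .times (.reg 0) (.reg 3), .get 0 (.reg 6),
    codeExpr (0 * q + (q - 1)) (.bin .quot (.reg 6) (.reg 3)),
    codeExpr (1 * q + (q - 1)) (.bin .rem (.reg 6) (.reg 3))⟩,
   ⟨.bin .times (.reg 1) (.reg 3), .get 1 (.reg 6),
    codeExpr (3 * q + (q - 1)) (.bin .rem (.reg 6) (.reg 3)),
    codeExpr (2 * q + 0) (.bin .quot (.reg 6) (.reg 3))⟩,
   ⟨if full then .reg 3 else .num 0, .num 1, codeExpr (1 * q + (q - 1)) (.reg 6),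
    codeExpr (3 * q + (q - 1)) (.reg 6)⟩]

/-- The registers and arrays that the rules read. -/
structure BuildEnv (s : Store) (q S n d n₂ : ℕ) (u v : ℕ → ℕ) : Prop where
  v0 : s.var 0 = n
  v1 : s.var 1 = n₂
  v3 : s.var 3 = d
  v4 : s.var 4 = S
  v5 : s.var 5 = hub q S
  a0 : s.arr 0 = u
  a1 : s.arr 1 = v

section implement

variable {t B q S n d n₂ : ℕ} {u v : ℕ → ℕ} {s : Store}

theorem Computes.code {t B S b q j i : ℕ} {s : Store} {e : Expr} (ht : 4 < t) (h : s.var 4 = S)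
    (he : Computes t B s e i) (hS : S < B) (hrow : b * q + j < B) (hB : code q S b j i < B) :
    Computes t B s (codeExpr (b * q + j) e) (code q S b j i) := by
  have h1 : (b * q + j) * S + i < B := hB
  exact .bin (.bin (.num s hrow) (.reg ht h hS) rfl (lt_of_le_of_lt (Nat.le_add_right _ _) h1)) he
    rfl hB

/-- All intermediate results are vertex numbers, row numbers, bits, or list sizes, which the
assumption on `B` covers. The primed facts are about the store after the tail has been written to
array 10, because the head is evaluated only then. -/
theorem implements_rules (hs : Sizes q S n d n₂) (ht : 40 ≤ t) (full : Bool)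
    (hB : 4 * q * S + 8 * S + 4 * q + 8 < B) (henv : BuildEnv s q S n d n₂ u v)
    (hu : ∀ i, u i ≤ 1) (hv : ∀ i, v i ≤ 1) :
    List.Forall₂ (Implements t B s (4 * q * S + 8 * S)) (ruleExprs q full)
      (rules q S n d n₂ u v full) := by
  obtain ⟨hq, hS, hn, hd, hn₂, hnd, hnd₂⟩ := hs
  have hhub : hub q S = 4 * q * S := rfl
  have hcode : ∀ {b j i : ℕ}, b < 4 → j < q → i < S → code q S b j i < B := fun hb hj hi =>
    (code_lt_hub hb hj hi).trans (by omega)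
  have hrow : ∀ {b j : ℕ}, b < 4 → j < q → b * q + j < B := fun {b j} hb hj => by
    have : b * q ≤ 3 * q := Nat.mul_le_mul_right _ (by omega)
    omega
  have g0 : ∀ l b e, (listStore s l b e).var 0 = n := fun l b e => henv.v0
  have g1 : ∀ l b e, (listStore s l b e).var 1 = n₂ := fun l b e => henv.v1
  have g3 : ∀ l b e, (listStore s l b e).var 3 = d := fun l b e => henv.v3
  have g4 : ∀ l b e, (listStore s l b e).var 4 = S := fun l b e => henv.v4
  have g5 : ∀ l b e, (listStore s l b e).var 5 = hub q S := fun l b e => henv.v5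
  have g6 : ∀ l b e, (listStore s l b e).var 6 = e := fun l b e => rfl
  have g3' : ∀ l b e i x, ((listStore s l b e).setArr 10 i x).var 3 = d :=
    fun l b e _ _ => henv.v3
  have g4' : ∀ l b e i x, ((listStore s l b e).setArr 10 i x).var 4 = S :=
    fun l b e _ _ => henv.v4
  have k0 : ∀ l b e, (listStore s l b e).arr 0 = u := fun l b e => henv.a0
  have k1 : ∀ l b e, (listStore s l b e).arr 1 = v := fun l b e => henv.a1
  have c1 : ∀ s, Computes t B s (.num 1) 1 := fun s => .num s (by omega)
  have c4 : ∀ l b e, Computes t B (listStore s l b e) (.reg 4) S := fun l b e =>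
    .reg (by omega) (g4 l b e) (by omega)
  have c5 : ∀ l b e, Computes t B (listStore s l b e) (.reg 5) (hub q S) := fun l b e =>
    .reg (by omega) (g5 l b e) (by omega)
  have c6 : ∀ l b e, e < B → Computes t B (listStore s l b e) (.reg 6) e := fun l b e he =>
    .reg (by omega) (g6 l b e) he
  have c5' : ∀ l b e i x, Computes t B ((listStore s l b e).setArr 10 i x) (.reg 5) (hub q S) :=
    fun l b e i x => .reg (by omega) (g5 l b e) (by omega)
  have c6' : ∀ l b e i x, e < B → Computes t B ((listStore s l b e).setArr 10 i x) (.reg 6) e :=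
    fun l b e i x he => .reg (by omega) (g6 l b e) he
  have cd : ∀ {b j i : ℕ} {s' : Store} {e : Expr}, s'.var 4 = S → Computes t B s' e i → b < 4 →
      j < q → i < S → Computes t B s' (codeExpr (b * q + j) e) (code q S b j i) :=
    fun h4 he hb hj hi => .code (by omega) h4 he (by omega) (hrow hb hj) (hcode hb hj hi)
  refine .cons ⟨?_, ?_, ?_, ?_, ?_⟩ <| .cons ⟨?_, ?_, ?_, ?_, ?_⟩ <| .cons ⟨?_, ?_, ?_, ?_, ?_⟩ <|
    .cons ⟨?_, ?_, ?_, ?_, ?_⟩ <| .cons ⟨?_, ?_, ?_, ?_, ?_⟩ <| .cons ⟨?_, ?_, ?_, ?_, ?_⟩ <|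
    .cons ⟨?_, ?_, ?_, ?_, ?_⟩ <| .cons ⟨?_, ?_, ?_, ?_, ?_⟩ <| .cons ⟨?_, ?_, ?_, ?_, ?_⟩ .nil
  · exact fun l b e _ _ _ => c5 _ _ _
  · intro l e _ (he : e < 4 * q * S)
    have h1 : e / S < 4 * q := Nat.div_lt_of_lt_mul (by rwa [mul_comm])
    have h2 : (e / S + 1) % q ≤ e / S + 1 := Nat.mod_le _ _
    exact .bin (.bin (.bin (c6 _ _ _ (by omega)) (c4 _ _ _) rfl (z := e / S) (by omega)) (c1 _)
      rfl (z := e / S + 1) (by omega)) (.num _ (by omega)) rfl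
      (show (e / S + 1) % q < B by omega)
  · exact fun l e _ (he : e < 4 * q * S) => c6 _ _ _ (by omega)
  · exact fun l e i x _ (he : e < 4 * q * S) => .bin (c6' _ _ _ _ _ (by omega))
      (.reg (by omega) (g4' _ _ _ _ _) (by omega)) rfl (show e + S < B by omega)
  · exact (show 4 * q * S < B by omega)
  · exact fun l b e _ _ _ => c4 _ _ _
  · exact fun l e _ _ => c1 _
  · exact fun l e _ _ => c5 _ _ _
  · exact fun l e i x _ (he : e < S) => cd (g4' _ _ _ _ _) (c6' _ _ _ _ _ (by omega)) (by omega)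
      (by omega) he
  · exact (show S < B by omega)
  · exact fun l b e _ _ _ => c4 _ _ _
  · exact fun l e _ _ => c1 _
  · exact fun l e _ _ => c5 _ _ _
  · exact fun l e i x _ (he : e < S) => cd (g4' _ _ _ _ _) (c6' _ _ _ _ _ (by omega)) (by omega)
      (by omega) he
  · exact (show S < B by omega)
  · exact fun l b e _ _ _ => c4 _ _ _
  · exact fun l e _ (he : e < S) => .bin (.bin (c6 _ _ _ (by omega)) (c1 _) rfl
      (show e + 1 < B by omega)) (.reg (by omega) (g1 _ _ _) (by omega)) rfl
      (show e + 1 - n₂ < B by omega)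
  · exact fun l e _ _ => c5 _ _ _
  · exact fun l e i x _ (he : e < S) => cd (g4' _ _ _ _ _) (c6' _ _ _ _ _ (by omega)) (by omega)
      (by omega) he
  · exact (show S < B by omega)
  · exact fun l b e _ _ _ => c4 _ _ _
  · exact fun l e _ _ => c1 _
  · exact fun l e _ _ => c5 _ _ _
  · exact fun l e i x _ (he : e < S) => cd (g4' _ _ _ _ _) (c6' _ _ _ _ _ (by omega)) (by omega)
      (by omega) he
  · exact (show S < B by omega)
  · exact fun l b e _ _ _ => c4 _ _ _
  · exact fun l e _ _ => c1 _
  · exact fun l e _ (he : e < S) => cd (g4 _ _ _) (c6 _ _ _ (by omega)) (by omega)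
      (by omega) he
  · exact fun l e i x _ _ => c5' _ _ _ _ _
  · exact (show S < B by omega)
  · exact fun l b e _ _ _ => .bin (.reg (by omega) (g0 _ _ _) (by omega))
      (.reg (by omega) (g3 _ _ _) (by omega)) rfl (show n * d < B by omega)
  · exact fun l e _ (he : e < n * d) => .get (c6 _ _ _ (by omega)) (by rw [k0])
      (by have := hu e; simp only; omega)
  · intro l e _ (he : e < n * d)
    have h1 := div_lt_and_mod_lt he
    exact cd (g4 _ _ _) (.bin (c6 _ _ _ (by omega)) (.reg (by omega) (g3 _ _ _) (by omega)) rfl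
      (show e / d < B by omega)) (by omega) (by omega) (show e / d < S by omega)
  · intro l e i x _ (he : e < n * d)
    have h1 := div_lt_and_mod_lt he
    exact cd (g4' _ _ _ _ _) (.bin (c6' _ _ _ _ _ (by omega)) (.reg (by omega) (g3' _ _ _ _ _) (by omega))
      rfl (show e % d < B by omega)) (by omega) (by omega) (show e % d < S by omega)
  · exact (show n * d < B by omega)
  · exact fun l b e _ _ _ => .bin (.reg (by omega) (g1 _ _ _) (by omega))
      (.reg (by omega) (g3 _ _ _) (by omega)) rfl (show n₂ * d < B by omega)
  · exact fun l e _ (he : e < n₂ * d) => .get (c6 _ _ _ (by omega)) (by rw [k1])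
      (by have := hv e; simp only; omega)
  · intro l e _ (he : e < n₂ * d)
    have h1 := div_lt_and_mod_lt he
    exact cd (g4 _ _ _) (.bin (c6 _ _ _ (by omega)) (.reg (by omega) (g3 _ _ _) (by omega)) rfl
      (show e % d < B by omega)) (by omega) (by omega) (show e % d < S by omega)
  · intro l e i x _ (he : e < n₂ * d)
    have h1 := div_lt_and_mod_lt he
    exact cd (g4' _ _ _ _ _) (.bin (c6' _ _ _ _ _ (by omega)) (.reg (by omega) (g3' _ _ _ _ _) (by omega))
      rfl (show e / d < B by omega)) (by omega) (by omega) (show e / d < S by omega)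
  · exact (show n₂ * d < B by omega)
  · intro l b e _ _ _
    cases full with
    | true => exact .reg (by omega) (g3 _ _ _) (show d < B by omega)
    | false => exact .num _ (show 0 < B by omega)
  · exact fun l e _ _ => c1 _
  · intro l e _ (he : e < if full = true then d else 0)
    have : e < S := lt_of_lt_of_le he (by split <;> omega)
    exact cd (g4 _ _ _) (c6 _ _ _ (by omega)) (by omega) (by omega) this
  · intro l e i x _ (he : e < if full = true then d else 0)
    have : e < S := lt_of_lt_of_le he (by split <;> omega)
    exact cd (g4' _ _ _ _ _) (c6' _ _ _ _ _ (by omega)) (by omega) (by omega) this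
  · exact (show (if full = true then d else 0) < B by split <;> omega)

end implement

/-- Compute the number `Z * (n * (d + 1))` of paths in a block, the hub, and the list of edges. -/
def buildCmd (t q Z : ℕ) (full : Bool) : Cmd :=
  .seq (.set t 4 (.bin .times (.num Z) (.bin .times (.reg 0) (.bin .plus (.reg 3) (.num 1)))))
    (.seq (.set t 5 (.bin .times (.num (4 * q)) (.reg 4))) (rulesCmd t (ruleExprs q full)))

/-- The store after the construction of the graph. -/
def builtStore (s : Store) (q S : ℕ) (l : List (ℕ × ℕ)) (b e : ℕ) : Store :=
  listStore ((s.setVar 4 S).setVar 5 (hub q S)) l b e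

theorem runs_build (q Z : ℕ) (full : Bool) (t : ℕ) (ht : 40 ≤ t) : ∃ C : ℕ,
    ∀ {B S n d n₂ : ℕ} {s : Store}, Sizes q S n d n₂ → S = Z * (n * (d + 1)) →
    4 * q * S + 8 * S + 4 * q + 8 < B → s.var 0 = n → s.var 1 = n₂ → s.var 3 = d →
    (∀ i, s.arr 0 i ≤ 1) → (∀ i, s.arr 1 i ≤ 1) → s.var 6 = 0 → s.var 7 = 0 → s.var 8 = 0 →
    s.arr 10 = (fun _ => 0) → s.arr 15 = (fun _ => 0) →
    ∃ b e, Runs t B (buildCmd t q Z full) s (C * (S + 1))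
      (builtStore s q S (edgeCodes q S n d n₂ (s.arr 0) (s.arr 1) full) b e) := by
  refine ⟨4 * q * (((ruleExprs q full).map RuleExpr.time).sum + (ruleExprs q full).length) + 40 +
    (((ruleExprs q full).map RuleExpr.time).sum + (ruleExprs q full).length), ?_⟩
  intro B S n d n₂ s hs hS hB h0 h1 h3 hu hv h6 h7 h8 h10 h15
  have hsz := hs
  obtain ⟨hq, hSp, hn, hd, hn₂, hnd, hnd₂⟩ := hs
  have hZ : Z ≤ S := by
    rcases Nat.eq_zero_or_pos (n * (d + 1)) with h | h
    · rw [h, mul_zero] at hS; omega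
    · rw [hS]; exact Nat.le_mul_of_pos_right _ h
  have hnd1 : n * (d + 1) ≤ S := by
    rcases Nat.eq_zero_or_pos Z with h | h
    · rw [h, zero_mul] at hS; omega
    · rw [hS]; exact Nat.le_mul_of_pos_left _ h
  have c1 : Computes t B s (.bin .times (.num Z) (.bin .times (.reg 0)
      (.bin .plus (.reg 3) (.num 1)))) S :=
    .bin (.num _ (by omega)) (.bin (.reg (by omega) h0 (by omega))
      (.bin (.reg (by omega) h3 (by omega)) (.num _ (by omega)) rfl (show d + 1 < B by omega))
      rfl (show n * (d + 1) < B by omega)) hS.symm (by omega)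
  have r1 := Runs.set (x := 4) c1.1 (by rw [c1.2]; omega)
  rw [c1.2] at r1
  have c2 : Computes t B (s.setVar 4 S) (.bin .times (.num (4 * q)) (.reg 4)) (hub q S) :=
    .bin (.num _ (by omega)) (.reg (by omega) (by simp [Store.setVar]) (v := S) (by omega)) rfl
      (show 4 * q * S < B by omega)
  have r2 := Runs.set (x := 5) c2.1 (by rw [c2.2]; exact (show 4 * q * S < B by omega))
  rw [c2.2] at r2
  set s₂ := (s.setVar 4 S).setVar 5 (hub q S) with hs₂
  -- Registers 6, 7, 8 and arrays 10, 15 are still zero, so the store already represents the empty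
  -- list.
  have e0 : s₂ = listStore s₂ [] 0 0 := by
    refine Store.ext' (fun x => ?_) fun a i => ?_
    · simp only [listStore, List.length_nil]
      split_ifs with a b c
      · subst a; simpa [hs₂, Store.setVar] using h6
      · subst b; simpa [hs₂, Store.setVar] using h7
      · subst c; simpa [hs₂, Store.setVar] using h8
      · rfl
    · simp only [listStore, List.map_nil, List.getD_nil]
      split_ifs with a b
      · subst a; exact congrFun h10 i
      · subst b; exact congrFun h15 i
      · rfl
  have henv : BuildEnv s₂ q S n d n₂ (s.arr 0) (s.arr 1) :=
    ⟨by simpa [hs₂, Store.setVar] using h0, by simpa [hs₂, Store.setVar] using h1,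
      by simpa [hs₂, Store.setVar] using h3, by simp [hs₂, Store.setVar],
      by simp [hs₂, Store.setVar], rfl, rfl⟩
  have himp := implements_rules hsz ht full hB henv hu hv
  have hf : (if full = true then d else 0) ≤ S := by split <;> omega
  have hSq : S ≤ 4 * q * S := Nat.le_mul_of_pos_left _ (by omega)
  obtain ⟨b, e, r3⟩ := runs_rules (X := 4 * q * S) ht (by omega) himp [] (b := 0) (e := 0)
    (by
      simp only [rules, List.map_cons, List.map_nil, List.sum_cons, List.sum_nil, List.length_nil]
      omega)
    (by omega) (by omega)
    (by
      intro r hr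
      simp only [rules, List.mem_cons, List.not_mem_nil, or_false] at hr
      rcases hr with rfl | rfl | rfl | rfl | rfl | rfl | rfl | rfl | rfl <;> simp only <;> omega)
  rw [← e0, List.nil_append] at r3
  refine ⟨b, e, (r1.seq (r2.seq r3)).mono ?_⟩
  simp only [Expr.time]
  generalize ((ruleExprs q full).map RuleExpr.time).sum + (ruleExprs q full).length = K
  have : (4 * q * K + 40 + K) * (S + 1) =
      (4 * q * S + 1) * K + (4 * q * K + 40 * S + 40 + K * S) := by ring
  omega

end Gadget

/-! ## The program that decides 3-HS with a dynamic algorithm -/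

/-- Constants can be pulled out even without knowing that the run halts: if it may fail, the right
side is infinite. -/
theorem ex_affine_le {X : Type*} (μ : PMF (Option X)) {c : ℝ≥0∞} (hc : c ≠ 0) (a : ℝ≥0∞)
    (g : X → ℝ≥0∞) : ex μ (fun x => c * (a + g x)) ≤ c * (a + ex μ g) := by
  rw [ex_const_mul μ hc, ex_add]
  by_cases h : none ∈ μ.support
  · have : ex μ g = ⊤ := by
      by_contra hne
      exact none_notMem_of_ex_lt_top (lt_top_iff_ne_top.2 hne) h
    rw [this, add_top, add_top]
  · rw [ex_const μ h]

namespace WordRAM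

/-- Execute `f 0`, ..., `f (n - 1)`. -/
def Cmd.each (f : ℕ → Cmd) : ℕ → Cmd
  | 0 => .skip
  | n + 1 => .seq (Cmd.each f n) (f n)

/-- The loop over the registers of the dynamic algorithm is unrolled, as their number ρ is a
constant. Each register is treated in one step, and the registers outside the target range are
preserved. -/
theorem runs_each {t B a ρ : ℕ} {f : ℕ → Cmd} {v : ℕ → ℕ} {s : Store}
    (hf : ∀ x < ρ, ∀ s₁ : Store, (∀ y, (y < a ∨ a + ρ ≤ y) → s₁.var y = s.var y) →
      s₁.arr = s.arr → Runs t B (f x) s₁ 1 (s₁.setVar (x + a) (v x))) :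
    ∀ n ≤ ρ, ∃ s', Runs t B (Cmd.each f n) s (2 * n + 1) s' ∧ (∀ x < n, s'.var (x + a) = v x) ∧
      (∀ y, (y < a ∨ a + n ≤ y) → s'.var y = s.var y) ∧ s'.arr = s.arr := by
  intro n
  induction n with
  | zero => exact fun _ => ⟨s, Runs.skip t B s, by simp, fun _ _ => rfl, rfl⟩
  | succ n ih =>
    intro hn
    obtain ⟨s', h1, h2, h3, h4⟩ := ih (by omega)
    refine ⟨s'.setVar (n + a) (v n),
      (h1.seq (hf n hn s' (fun y hy => h3 y (by omega)) h4)).mono (by omega), ?_, ?_, h4⟩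
    · intro x hx
      by_cases hxn : x = n
      · simp [hxn, Store.setVar]
      · have : x + a ≠ n + a := by omega
        change Function.update s'.var (n + a) (v n) (x + a) = v x
        rw [Function.update_of_ne this, h2 x (by omega)]
    · intro y hy
      have : y ≠ n + a := by omega
      simp [Store.setVar, this, h3 y (by omega)]

end WordRAM

namespace Gadget

/-- A dynamic algorithm and an instance to which it is to be applied. -/
structure Job where
  A : DynAlg
  M : Timing
  /-- switch to the graph of a vector by insertions -/
  ins : Bool
  /-- return to the basic graph by restoring the memory -/
  roll : Bool
  q : ℕ
  S : ℕ
  n₃ : ℕ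
  d : ℕ
  ρ : ℕ
  /-- the word bound of the dynamic algorithm -/
  b : ℕ
  /-- the word bound of the machine -/
  B : ℕ
  tp : ℕ
  tu : ℕ
  tq : ℕ
  /-- a bound for the number of rounds -/
  Rmax : ℕ
  w : ℕ → ℕ
  l : List (ℕ × ℕ)
  /-- the stages whose answer is yes -/
  τ : ℕ → Prop

namespace Job

/-- The first scratch register. -/
def t (J : Job) : ℕ := 40 + 2 * J.ρ

/-- The program for an insertion or a deletion. -/
def updCmd (A : DynAlg) (ins : Bool) : Cmd := if ins then A.onInsert else A.onDelete

/-- The sizes are suitable, and the words are large enough. -/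
structure OK (J : Job) : Prop where
  ρ : 2 ≤ J.ρ
  pre : J.A.preprocess.Below J.ρ
  upd : ∀ ins, (updCmd J.A ins).Below J.ρ
  qry : J.A.onQuery.Below J.ρ
  q : 1 < J.q
  d : J.d ≤ J.S
  b : J.b ≤ J.B
  hub : hub J.q J.S + 4 * J.q + 8 < J.B
  bits : J.n₃ * J.d + J.d < J.B
  w : ∀ i, J.w i ≤ 1
  l : J.l.length < J.B
  stamp : (J.Rmax + 1) * (J.n₃ + 1) < J.B
  timing : J.roll = true → J.M = .worstCase

/-- The bits of the vector of stage `k`. -/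
def bits (J : Job) (k i : ℕ) : ℕ := J.w (k * J.d + i)

/-- The registers and arrays that are set up before the rounds. -/
structure Env (J : Job) (s : Store) : Prop where
  v2 : s.var 2 = J.n₃
  v3 : s.var 3 = J.d
  v4 : s.var 4 = J.S
  v5 : s.var 5 = Gadget.hub J.q J.S
  v8 : s.var 8 = J.l.length
  a2 : s.arr 2 = J.w
  i0 : ∀ i, s.arr 10 i = (J.l.map Prod.fst).getD i 0
  i1 : ∀ i, s.arr 15 i = (J.l.map Prod.snd).getD i 0
  i2 : ∀ a, 2 ≤ a → ∀ i, s.arr (10 + 5 * a) i = 0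

theorem Env.congr {J : Job} {s s' : Store} (h : J.Env s) (hv : ∀ x < 9, s'.var x = s.var x)
    (h2 : s'.arr 2 = s.arr 2) (hi : ∀ a, s'.arr (10 + 5 * a) = s.arr (10 + 5 * a)) : J.Env s' where
  v2 := (hv 2 (by omega)).trans h.v2
  v3 := (hv 3 (by omega)).trans h.v3
  v4 := (hv 4 (by omega)).trans h.v4
  v5 := (hv 5 (by omega)).trans h.v5
  v8 := (hv 8 (by omega)).trans h.v8
  a2 := h2.trans h.a2
  i0 i := by have := congrFun (hi 0) i; simp only [mul_zero, add_zero] at this; rw [this, h.i0]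
  i1 i := by have := congrFun (hi 1) i; simp only [mul_one] at this; rw [this, h.i1]
  i2 a ha i := by rw [hi, h.i2 a ha]

theorem Env.of_frame {J : Job} {up : Bool} {s s' : Store} (h : J.Env s)
    (hf : SimFrame up J.ρ s s') : J.Env s' :=
  h.congr (fun x hx => hf.var x (by omega) (by omega)) (hf.low 2 (by omega)) hf.init

/-- The time left over that may still be used. -/
def lv (M : Timing) (b : ℕ) : ℕ := M.grant b 0

theorem lv_le (M : Timing) (b : ℕ) : lv M b ≤ b := by cases M <;> simp [lv, Timing.grant]

theorem grant_eq (M : Timing) (b t : ℕ) : M.grant b t = lv M b + t := by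
  cases M <;> simp [lv, Timing.grant]

/-! ### The operations of a stage -/

/-- The bit of the current vector at the current coordinate. -/
def bitExpr : Expr := .get 2 (.bin .plus (.bin .times (.reg 10) (.reg 3)) (.reg 29))

/-- Issue an operation on the current coordinate. -/
def issueCmd (t ρq : ℕ) (c : Cmd) : Cmd :=
  .seq (.set t 40 (codeExpr (1 * ρq + (ρq - 1)) (.reg 29)))
    (.seq (.set t 41 (codeExpr (3 * ρq + (ρq - 1)) (.reg 29))) (simCmd t true c))

/-- One iteration of the loop over the coordinates. -/
def opsBody (t q : ℕ) (c : Cmd) (on : Bool) : Cmd :=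
  .seq (.cond t bitExpr (if on then issueCmd t q c else .skip)
    (if on then .skip else issueCmd t q c)) (.set t 29 (.bin .plus (.reg 29) (.num 1)))

/-- The loop over the coordinates. -/
def opsCmd (t q : ℕ) (c : Cmd) (on : Bool) : Cmd :=
  .seq (.set t 29 (.num 0)) (.while t (.bin .minus (.reg 3) (.reg 29)) (opsBody t q c on))

variable {J : Job}

theorem reaches_opsBody (hJ : J.OK) {s s₀ : Store} {i : ℕ} {c : Cmd} {on : Bool}
    {k : List Cmd} {w : ℕ} (henv : J.Env s₀) (hw : s₀.var 10 = w) (hwn : w < J.n₃)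
    (hf : SimFrame true J.ρ s₀ s) (hi : s.var 29 = i) (hid : i < J.d) :
    Reaches J.t J.B 14 (opsBody J.t J.q c on :: k) s
      ((if decide (J.bits w i ≠ 0) == on then issueCmd J.t J.q c else .skip) ::
        .set J.t 29 (.bin .plus (.reg 29) (.num 1)) :: k) s := by
  have e3 : s.var 3 = J.d := (hf.var 3 (by omega) (by omega)).trans henv.v3
  have e10 : s.var 10 = w := (hf.var 10 (by omega) (by omega)).trans hw
  have ea : s.arr 2 = J.w := (hf.low 2 (by omega)).trans henv.a2
  have hb := hJ.bits
  have hwd : w * J.d + J.d ≤ J.n₃ * J.d := by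
    have := Nat.mul_le_mul_right J.d (Nat.succ_le_of_lt hwn)
    rwa [Nat.succ_mul] at this
  have hρ := hJ.ρ
  have hwB : w < J.B := by
    have h1 := hJ.stamp
    have h2 : J.n₃ + 1 ≤ (J.Rmax + 1) * (J.n₃ + 1) := Nat.le_mul_of_pos_left _ (by omega)
    omega
  have hbit : Computes J.t J.B s bitExpr (J.bits w i) :=
    .get (.bin (.bin (.reg (by unfold t; omega) e10 hwB) (.reg (by unfold t; omega) e3 (by omega))
      rfl (show w * J.d < J.B by omega)) (.reg (by unfold t; omega) hi (by omega)) rfl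
      (show w * J.d + i < J.B by omega)) (by rw [ea]; rfl)
      (by have := hJ.w (w * J.d + i); unfold bits; omega)
  have h1 := (reaches_seq J.t J.B (.cond J.t bitExpr (if on then issueCmd J.t J.q c else .skip)
    (if on then .skip else issueCmd J.t J.q c)) (.set J.t 29 (.bin .plus (.reg 29) (.num 1))) k
    s).trans (reaches_cond hbit.1 _ _ _)
  rw [hbit.2] at h1
  have e : (if J.bits w i ≠ 0 then (if on = true then issueCmd J.t J.q c else .skip)
      else (if on = true then .skip else issueCmd J.t J.q c)) =
      (if decide (J.bits w i ≠ 0) == on then issueCmd J.t J.q c else .skip) := by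
    cases on <;> by_cases h : J.bits w i = 0 <;> simp [h]
  rw [e] at h1
  exact h1.mono (by simp [bitExpr, Expr.time])

theorem start_switchOp (A : DynAlg) {q S : ℕ} (ins : Bool) (i : ℕ) (s : Store) :
    A.start s (switchOp q S ins i) =
      ⟨[updCmd A ins], (s.setVar 0 (switchTail q S i)).setVar 1 (switchHead q S i)⟩ := by
  cases ins <;> rfl

theorem bound_switchOp {q S : ℕ} (ins : Bool) (i tu tq : ℕ) :
    (switchOp q S ins i).bound tu tq = tu := by
  cases ins <;> rfl

theorem ex_serve_cons (A : DynAlg) (M : Timing) (B tu tq : ℕ) {n : ℕ} (o : Op n) (os : List (Op n))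
    (y : Store × ℕ) (g : Store × ℕ → ℝ≥0∞) :
    ex (A.serve M B tu tq (o :: os) y) g =
      ex (exec B (M.grant y.2 (o.bound tu tq)) (A.start y.1 o))
        fun y' => ex (A.serve M B tu tq os y') g := by
  rw [DynAlg.serve]
  refine ex_bind_option _ (fun y => A.serve M B tu tq os y) ?_ ?_ g
  · rfl
  · exact fun _ => rfl

theorem ex_serve_nil (A : DynAlg) (M : Timing) (B tu tq : ℕ) {n : ℕ}
    (y : Store × ℕ) (g : Store × ℕ → ℝ≥0∞) :
    ex (A.serve M B tu tq ([] : List (Op n)) y) g = g y := ex_pure_some y g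

theorem ex_serve_append (A : DynAlg) (M : Timing) (B tu tq : ℕ) {n : ℕ} (os os' : List (Op n))
    (g : Store × ℕ → ℝ≥0∞) : ∀ y, ex (A.serve M B tu tq (os ++ os') y) g =
      ex (A.serve M B tu tq os y) fun y' => ex (A.serve M B tu tq os' y') g := by
  induction os with
  | nil => intro y; rw [List.nil_append, ex_serve_nil]
  | cons o os ih =>
    intro y
    rw [List.cons_append, ex_serve_cons, ex_serve_cons]
    congr 1
    funext y'
    exact ih y'

/-- The probabilistic behaviour of a stage's operations. -/
abbrev srv (J : Job) (os : List (Op (Gadget.hub J.q J.S + 1))) (y : Store × ℕ)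
    (g : Store × ℕ → ℝ≥0∞) : ℝ≥0∞ :=
  ex (J.A.serve J.M J.b J.tu J.tq os y) g

/-- The loop over the coordinates issues exactly the updates in the filtered list, so its cost is
bounded by serving that list. The budget contains the usable leftover time and one update bound for
each coordinate, 19-fold for the simulation. Coordinates without an update need less than they are
granted, since `costU` decreases with time. -/
theorem costU_ops_tail (hJ : J.OK) {s₀ : Store} {ins on : Bool} {k : List Cmd} {w T₀ : ℕ}
    {f : Store → ℝ≥0∞} {g : Store × ℕ → ℝ≥0∞} (henv : J.Env s₀) (hst : StampsOK true J.B s₀)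
    (hw : s₀.var 10 = w) (hwn : w < J.n₃)
    (hg : ∀ y s, SimRel J.ρ J.B y.1 s → SimFrame true J.ρ s₀ s →
      costU J.t J.B (19 * lv J.M y.2 + T₀) k s f ≤ g y) (m : ℕ) :
    ∀ {i : ℕ} (y : Store × ℕ) (s : Store), i + m = J.d → SimRel J.ρ J.B y.1 s →
      SimFrame true J.ρ s₀ s → s.var 29 = i →
      costU J.t J.B (19 * (lv J.M y.2 + m * J.tu) + m * 60 + 10 + T₀)
        (whileTail J.t (.bin .minus (.reg 3) (.reg 29)) (opsBody J.t J.q (updCmd J.A ins) on) k)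
        s f ≤ J.srv (((List.range' i m).filter fun j => decide (J.bits w j ≠ 0) == on).map
          (switchOp J.q J.S ins)) y g := by
  have hρ := hJ.ρ
  have hbB := hJ.bits
  have ht : ∀ x < 44, x < J.t := fun x hx => by unfold t; omega
  have hcond : ∀ {i : ℕ} {s : Store}, SimFrame true J.ρ s₀ s → s.var 29 = i → i ≤ J.d →
      Computes J.t J.B s (.bin .minus (.reg 3) (.reg 29)) (J.d - i) := fun {i s} hf hi hid =>
    .bin (.reg (ht _ (by omega)) ((hf.var 3 (by omega) (by omega)).trans henv.v3) (by omega))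
      (.reg (ht _ (by omega)) hi (by omega)) rfl (by omega)
  induction m with
  | zero =>
    intro i y s hid hr hf hi
    have hc := hcond hf hi (by omega)
    have h1 := reaches_whileTail_end hc.1 (opsBody J.t J.q (updCmd J.A ins) on) k
      (by rw [hc.2]; omega)
    refine ((h1.mono (n' := 10) (by simp [Expr.time])) (19 * lv J.M y.2 + T₀) f |> le_trans
      (costU_anti (by omega) _ _ _)).trans ?_
    rw [List.range'_zero, List.filter_nil, List.map_nil, srv, ex_serve_nil]
    exact hg y s hr hf
  | succ m ih =>
    intro i y s hid hr hf hi
    have hc := hcond hf hi (by omega)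
    have h1 := reaches_whileTail hc.1 (opsBody J.t J.q (updCmd J.A ins) on) k
      (by rw [hc.2]; omega)
    have h2 := h1.trans (reaches_opsBody (c := updCmd J.A ins) (on := on)
      (k := whileTail J.t (.bin .minus (.reg 3) (.reg 29)) (opsBody J.t J.q (updCmd J.A ins) on) k)
      hJ henv hw hwn hf hi (by omega))
    have hinc : ∀ s', SimFrame true J.ρ s₀ s' → s'.var 29 = i →
        Runs J.t J.B (.set J.t 29 (.bin .plus (.reg 29) (.num 1))) s' 7 (s'.setVar 29 (i + 1)) := by
      intro s' _ hi'
      have c : Computes J.t J.B s' (.bin .plus (.reg 29) (.num 1)) (i + 1) :=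
        .bin (.reg (ht _ (by omega)) hi' (by omega)) (.num _ (by omega)) rfl (by omega)
      have := Runs.set (x := 29) c.1 (by rw [c.2]; omega)
      rwa [c.2] at this
    have hnext : ∀ y' s', SimRel J.ρ J.B y'.1 s' → SimFrame true J.ρ s₀ s' → s'.var 29 = i →
        costU J.t J.B (19 * (lv J.M y'.2 + m * J.tu) + m * 60 + 17 + T₀)
          (.set J.t 29 (.bin .plus (.reg 29) (.num 1)) :: whileTail J.t
            (.bin .minus (.reg 3) (.reg 29)) (opsBody J.t J.q (updCmd J.A ins) on) k) s' f ≤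
        J.srv (((List.range' (i + 1) m).filter fun j => decide (J.bits w j ≠ 0) == on).map
          (switchOp J.q J.S ins)) y' g := by
      intro y' s' hr' hf' hi'
      have h3 := hinc s' hf' hi' (whileTail J.t (.bin .minus (.reg 3) (.reg 29))
        (opsBody J.t J.q (updCmd J.A ins) on) k)
      refine le_trans (costU_anti (T := 19 * (lv J.M y'.2 + m * J.tu) + m * 60 + 10 + T₀ + 7)
        (by omega) _ _ _) ((h3 _ f).trans ?_)
      exact ih y' _ (by omega) (hr'.setVar_low _ (by omega)) (hf'.setVar _ (.inl rfl))
        (by simp [Store.setVar])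
    have hmul : (m + 1) * J.tu = m * J.tu + J.tu := by ring
    rw [hmul, List.range'_succ]
    by_cases hsel : (decide (J.bits w i ≠ 0) == on) = true
    · rw [if_pos hsel] at h2
      rw [List.filter_cons_of_pos (p := fun j => decide (J.bits w j ≠ 0) == on) hsel,
        List.map_cons, srv, ex_serve_cons, start_switchOp, bound_switchOp, grant_eq]
      have hiS : i < J.S := by have := hJ.d; omega
      have hq := hJ.q
      have hcode : ∀ b < 4, code J.q J.S b (J.q - 1) i < J.B := fun b hb =>
        (code_lt_hub hb (by omega) hiS).trans (by have := hJ.hub; omega)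
      have hS : J.S < J.B := by
        have h1 := hJ.hub
        have h2 : J.S ≤ Gadget.hub J.q J.S := Nat.le_mul_of_pos_left _ (by omega)
        omega
      have v4 : s.var 4 = J.S := (hf.var 4 (by omega) (by omega)).trans henv.v4
      have row : ∀ b < 4, b * J.q + (J.q - 1) < J.B := fun b hb => by
        have h1 := hJ.hub
        have : b * J.q ≤ 3 * J.q := Nat.mul_le_mul_right _ (by omega)
        omega
      have c1 : Computes J.t J.B s (codeExpr (1 * J.q + (J.q - 1)) (.reg 29))
          (code J.q J.S 1 (J.q - 1) i) :=
        .code (ht _ (by omega)) v4 (.reg (ht _ (by omega)) hi (by omega)) hS (row 1 (by omega))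
          (hcode 1 (by omega))
      have r1 := Runs.set (x := 40) c1.1 (by rw [c1.2]; exact hcode 1 (by omega))
      rw [c1.2] at r1
      have c2 : Computes J.t J.B (s.setVar 40 (code J.q J.S 1 (J.q - 1) i))
          (codeExpr (3 * J.q + (J.q - 1)) (.reg 29)) (code J.q J.S 3 (J.q - 1) i) :=
        .code (ht _ (by omega)) (by simpa [Store.setVar] using v4)
          (.reg (ht _ (by omega)) (by simpa [Store.setVar] using hi) (by omega)) hS
          (row 3 (by omega)) (hcode 3 (by omega))
      have r2 := Runs.set (x := 41) c2.1 (by rw [c2.2]; exact hcode 3 (by omega))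
      rw [c2.2] at r2
      have h3 := (reaches_seq J.t J.B (.set J.t 40 (codeExpr (1 * J.q + (J.q - 1)) (.reg 29)))
        (.seq (.set J.t 41 (codeExpr (3 * J.q + (J.q - 1)) (.reg 29)))
          (simCmd J.t true (updCmd J.A ins))) _ s).trans ((r1 _).trans
        ((reaches_seq J.t J.B _ (simCmd J.t true (updCmd J.A ins)) (.set J.t 29
          (.bin .plus (.reg 29) (.num 1)) :: whileTail J.t (.bin .minus (.reg 3) (.reg 29))
          (opsBody J.t J.q (updCmd J.A ins) on) k) _).trans (r2 _)))
      have h4 := (h2.trans h3).mono (n' := 53) (by simp [Expr.time, codeExpr])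
      -- Registers 40 and 41 are registers 0 and 1 of the simulated algorithm, where the ends of the
      -- edge are expected. The counter in register 29 lies outside the simulated range and is
      -- carried through as `v₂₉`.
      have hsim := costU_sim_le (t := J.t) (B := J.b) (B' := J.B) (ρ := J.ρ) true (s₀ := s₀)
        (T₀ := 19 * (m * J.tu) + m * 60 + 17 + T₀) (f := f)
        (k := .set J.t 29 (.bin .plus (.reg 29) (.num 1)) :: whileTail J.t
          (.bin .minus (.reg 3) (.reg 29)) (opsBody J.t J.q (updCmd J.A ins) on) k)
        (g := fun y' => J.srv (((List.range' (i + 1) m).filter fun j =>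
          decide (J.bits w j ≠ 0) == on).map (switchOp J.q J.S ins)) y' g) (v₂₉ := i)
        hJ.b (by unfold t; omega) hst ?_ (lv J.M y.2 + J.tu) [updCmd J.A ins]
        ((y.1.setVar 0 (switchTail J.q J.S i)).setVar 1 (switchHead J.q J.S i))
        ((s.setVar 40 (code J.q J.S 1 (J.q - 1) i)).setVar 41 (code J.q J.S 3 (J.q - 1) i))
        (by simpa using hJ.upd ins) ?_ ?_ ?_
      · refine le_trans (costU_anti (T := 19 * (lv J.M y.2 + J.tu) +
          (19 * (m * J.tu) + m * 60 + 17 + T₀) + 53) (by omega) _ _ _) ((h4 _ f).trans ?_)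
        exact hsim
      -- The simulation hands over all `b` unused steps; only `lv J.M b` of them count for the next
      -- operation, namely none in the worst-case setting.
      · intro s₁ b s₁' hr₁ hf₁ hv₁
        exact le_trans (costU_anti (by have := lv_le J.M b; simp only; omega) _ _ _)
          (hnext (s₁, b) s₁' hr₁ hf₁ hv₁)
      · have k1 : (switchTail J.q J.S i : ℕ) = code J.q J.S 1 (J.q - 1) i :=
          vertex_code_val (by omega) (by omega) hiS
        have k2 : (switchHead J.q J.S i : ℕ) = code J.q J.S 3 (J.q - 1) i :=
          vertex_code_val (by omega) (by omega) hiS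
        rw [k1, k2]
        exact (hr.setVar (x := 0) (hcode 1 (by omega))).setVar (x := 1) (hcode 3 (by omega))
      · exact (hf.setVar _ (.inr ⟨le_rfl, by omega⟩)).setVar _ (.inr ⟨by omega, by omega⟩)
      · simpa [Store.setVar] using hi
    · rw [if_neg hsel] at h2
      rw [List.filter_cons_of_neg (p := fun j => decide (J.bits w j ≠ 0) == on) hsel]
      have h3 := h2.trans (Runs.skip J.t J.B s _)
      refine le_trans (costU_anti (T := 19 * (lv J.M y.2 + m * J.tu) + m * 60 + 17 + T₀ + 22)
        (by omega) _ _ _) (((h3.mono (by simp [Expr.time])) _ f).trans ?_)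
      exact hnext y s hr hf hi

end Job

end Gadget

namespace Gadget

namespace Job

variable {J : Job}

theorem costU_ops (hJ : J.OK) {s₀ : Store} {ins on : Bool} {k : List Cmd} {w T₀ : ℕ}
    {f : Store → ℝ≥0∞} {g : Store × ℕ → ℝ≥0∞} (henv : J.Env s₀) (hst : StampsOK true J.B s₀)
    (hw : s₀.var 10 = w) (hwn : w < J.n₃)
    (hg : ∀ y s, SimRel J.ρ J.B y.1 s → SimFrame true J.ρ s₀ s →
      costU J.t J.B (19 * lv J.M y.2 + T₀) k s f ≤ g y)
    (y : Store × ℕ) (hr : SimRel J.ρ J.B y.1 s₀) :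
    costU J.t J.B (19 * (lv J.M y.2 + J.d * J.tu) + J.d * 60 + 20 + T₀)
      (opsCmd J.t J.q (updCmd J.A ins) on :: k) s₀ f ≤
      J.srv ((coords J.d (J.bits w) on).map (switchOp J.q J.S ins)) y g := by
  have hB : 0 < J.B := by have := hJ.hub; omega
  have r := Runs.set (t := J.t) (B := J.B) (x := 29) (e := .num 0) (s := s₀) hB hB
  have h1 := (reaches_seq J.t J.B (.set J.t 29 (.num 0)) (.while J.t (.bin .minus (.reg 3) (.reg 29))
    (opsBody J.t J.q (updCmd J.A ins) on)) k s₀).trans ((r _).trans (reaches_while J.t J.B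
      (.bin .minus (.reg 3) (.reg 29)) (opsBody J.t J.q (updCmd J.A ins) on) k _))
  refine le_trans (costU_anti (T := 19 * (lv J.M y.2 + J.d * J.tu) + J.d * 60 + 10 + T₀ + 10)
    (by omega) _ _ _) (((h1.mono (by simp [Expr.time])) _ f).trans ?_)
  have := costU_ops_tail (ins := ins) (on := on) hJ henv hst hw hwn hg J.d (i := 0) y
    (s₀.setVar 29 0) (by omega) (hr.setVar_low _ (by omega))
    ((SimFrame.refl _ _ _).setVar _ (.inl rfl)) (by simp [Store.setVar])
  rw [coords, List.range_eq_range']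
  exact this

/-! ### Scores -/

/-- The answer of the dynamic algorithm means yes. -/
def Yes (J : Job) (s : Store) : Prop := s.var 0 ≠ 0 ∧ s.var 1 < 2 * J.q

open Classical in
/-- The factor by which an answer changes the score of stage `k`. -/
def factor (J : Job) (k : ℕ) (s : Store) : ℝ≥0∞ := if J.Yes s ↔ J.τ k then 2 / 3 else 3 / 2

open Classical in
/-- The score of stage `k` after the given numbers of positive and negative answers. -/
def score (J : Job) (k yes no : ℕ) : ℝ≥0∞ :=
  if J.τ k then (3 / 2) ^ no * (2 / 3) ^ yes else (3 / 2) ^ yes * (2 / 3) ^ no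

theorem score_yes {k yes no : ℕ} {s : Store} (h : J.Yes s) :
    J.score k (yes + 1) no = J.factor k s * J.score k yes no := by
  unfold score factor
  by_cases hk : J.τ k
  · rw [if_pos hk, if_pos hk, if_pos (iff_of_true h hk)]; ring
  · rw [if_neg hk, if_neg hk, if_neg (fun hi => hk (hi.1 h))]; ring

theorem score_no {k yes no : ℕ} {s : Store} (h : ¬ J.Yes s) :
    J.score k yes (no + 1) = J.factor k s * J.score k yes no := by
  unfold score factor
  by_cases hk : J.τ k
  · rw [if_pos hk, if_pos hk, if_neg (fun hi => h (hi.2 hk))]; ring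
  · rw [if_neg hk, if_neg hk, if_pos (iff_of_false h hk)]; ring

/-- A wrong and a right answer cancel, as 3/2 · 2/3 = 1. A stage in which wrong answers are no
minority therefore keeps a score of at least 1, ties included. -/
theorem one_le_score {k yes no : ℕ} (h : J.τ k → yes ≤ no) (h' : ¬ J.τ k → no ≤ yes) :
    1 ≤ J.score k yes no := by
  have key : ∀ a b : ℕ, b ≤ a → (1 : ℝ≥0∞) ≤ (3 / 2) ^ a * (2 / 3) ^ b := by
    intro a b hab
    obtain ⟨c, rfl⟩ := Nat.exists_eq_add_of_le hab
    have h1 : (3 / 2 : ℝ≥0∞) * (2 / 3) = 1 := by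
      rw [ENNReal.div_eq_inv_mul, ENNReal.div_eq_inv_mul]
      calc (2 : ℝ≥0∞)⁻¹ * 3 * (3⁻¹ * 2) = (2⁻¹ * 2) * (3 * 3⁻¹) := by ring
        _ = 1 := by
          rw [ENNReal.inv_mul_cancel (by simp) (by simp), ENNReal.mul_inv_cancel (by simp) (by simp),
            one_mul]
    have h2 : (1 : ℝ≥0∞) ≤ 3 / 2 := by
      rw [ENNReal.le_div_iff_mul_le (by simp) (by simp)]
      norm_num
    rw [pow_add, mul_right_comm, ← mul_pow, h1, one_pow, one_mul]
    exact one_le_pow₀ h2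
  unfold score
  split_ifs with hk
  · exact key _ _ (h hk)
  · exact key _ _ (h' hk)

/-! ### Stages -/

/-- The operations of stage `k`: switch to the graph of its vector and query the radius. -/
def fwd (J : Job) (k : ℕ) : List (Op (Gadget.hub J.q J.S + 1)) :=
  forth J.q J.S J.d (J.bits k) J.ins ++ [.query]

/-- The operations that return from the graph of stage `k` to the basic graph. -/
def bck (J : Job) (k : ℕ) : List (Op (Gadget.hub J.q J.S + 1)) :=
  if J.roll then [] else back J.q J.S J.d (J.bits k)

/-- The expected sum of the new scores of `m` stages from stage `k` on, if the algorithm is in state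
`y` and was in state `y₀` after the preprocessing. -/
def chain (J : Job) (y₀ : Store × ℕ) (sc : ℕ → ℝ≥0∞) : ℕ → ℕ → Store × ℕ → ℝ≥0∞
  | 0, _, _ => 0
  | m + 1, k, y => J.srv (J.fwd k) y fun y' => J.factor k y'.1 * sc k +
      J.srv (J.bck k) y' fun y'' => J.chain y₀ sc m (k + 1) (if J.roll then y₀ else y'')

/-- Restore the memory after the preprocessing. -/
def restoreCmd (t ρ : ℕ) : Cmd :=
  .seq (.set t 31 (.bin .plus (.reg 31) (.num 1)))
    (Cmd.each (fun x => .copy (x + 40) (x + (40 + ρ))) ρ)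

/-- Increase the counter of the current stage in array `a`. -/
def countCmd (t a : ℕ) : Cmd := .put t a (.reg 10) (.bin .plus (.get a (.reg 10)) (.num 1))

/-- Evaluate the answer to a query. -/
def recordCmd (t q : ℕ) : Cmd :=
  .cond t (.reg 40) (.cond t (.bin .minus (.num (2 * q)) (.reg 41)) (countCmd t 3) (countCmd t 4))
    (countCmd t 4)

/-- One stage. -/
def stageCmd (A : DynAlg) (t q ρ : ℕ) (ins roll : Bool) : Cmd :=
  .seq (if roll then restoreCmd t ρ else .skip) (.seq (opsCmd t q (updCmd A ins) ins)
    (.seq (simCmd t true A.onQuery) (.seq (recordCmd t q)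
      (.seq (if roll then .skip else opsCmd t q (updCmd A false) true)
        (.set t 10 (.bin .plus (.reg 10) (.num 1)))))))

/-- The contents of an array after the preprocessing. -/
def baseView (s : Store) (a i : ℕ) : ℕ :=
  if s.var 32 ≤ s.arr (12 + 5 * a) i then s.arr (11 + 5 * a) i else s.arr (10 + 5 * a) i

/-- The state `y` after the preprocessing is kept in `s`. -/
def BaseRel (J : Job) (y s : Store) : Prop :=
  (∀ x < J.ρ, s.var (x + (40 + J.ρ)) = y.var x ∧ y.var x < J.B) ∧
    ∀ a < J.ρ, ∀ i, baseView s a i = y.arr a i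

/-- The invariant of the loop over the stages, in stage `k` of round `R`. -/
structure Inv (J : Job) (y₀ : Store) (R k h g : ℕ) (yes no : ℕ → ℕ) (s : Store) : Prop where
  env : J.Env s
  st : StampsOK true J.B s
  v9 : s.var 9 = g
  v10 : s.var 10 = k
  v31 : s.var 31 ≤ h
  v32 : s.var 32 = R
  a3 : s.arr 3 = yes
  a4 : s.arr 4 = no
  base : J.BaseRel y₀ s

variable {y₀ : Store} {R k h g : ℕ} {yes no : ℕ → ℕ} {s s' : Store}

theorem Inv.of_frame (hi : J.Inv y₀ R k h g yes no s) (hf : SimFrame true J.ρ s s') :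
    J.Inv y₀ R k h g yes no s' where
  env := hi.env.of_frame hf
  st := hi.st.of_frame hf
  v9 := (hf.var 9 (by omega) (by omega)).trans hi.v9
  v10 := (hf.var 10 (by omega) (by omega)).trans hi.v10
  v31 := (hf.var 31 (by omega) (by omega)).le.trans hi.v31
  v32 := (hf.var 32 (by omega) (by omega)).trans hi.v32
  a3 := (hf.low 3 (by omega)).trans hi.a3
  a4 := (hf.low 4 (by omega)).trans hi.a4
  base := by
    refine ⟨fun x hx => ?_, fun a ha i => ?_⟩
    · rw [hf.var _ (by omega) (by omega)]
      exact hi.base.1 x hx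
    · have h1 := hf.other a
      have h2 := hf.otherStamp a
      simp only [layer, Bool.not_true, Bool.false_eq_true, if_false,
        show 11 + 5 * a + 1 = 12 + 5 * a by omega] at h1 h2
      rw [← hi.base.2 a ha i, baseView, baseView, h1, h2, hf.init, hf.var 32 (by omega) (by omega)]

/-- Changes of other registers do not matter. -/
theorem Inv.congr {k' h' g' : ℕ} (hi : J.Inv y₀ R k h g yes no s) (ha : s'.arr = s.arr)
    (hv : ∀ x, x ≠ 9 → x ≠ 10 → x ≠ 31 → (x < 40 ∨ 40 + J.ρ ≤ x) → s'.var x = s.var x)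
    (h9 : s'.var 9 = g') (h10 : s'.var 10 = k') (h31 : s.var 31 ≤ s'.var 31)
    (h31' : s'.var 31 ≤ h') (hB : s'.var 31 < J.B) : J.Inv y₀ R k' h' g' yes no s' where
  env := hi.env.congr (fun x hx => hv x (by omega) (by omega) (by omega) (by omega)) (by rw [ha])
    fun a => by rw [ha]
  st :=
    { lt31 := hB
      lt32 := by rw [hv 32 (by omega) (by omega) (by omega) (by omega)]; exact hi.st.lt32
      le31 := fun a i => by rw [ha]; exact (hi.st.le31 a i).trans h31
      le32 := fun a i => by
        rw [ha, hv 32 (by omega) (by omega) (by omega) (by omega)]; exact hi.st.le32 a i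
      fresh := fun h => by simp at h }
  v9 := h9
  v10 := h10
  v31 := h31'
  v32 := (hv 32 (by omega) (by omega) (by omega) (by omega)).trans hi.v32
  a3 := by rw [ha, hi.a3]
  a4 := by rw [ha, hi.a4]
  base := by
    refine ⟨fun x hx => ?_, fun a ha' i => ?_⟩
    · rw [hv _ (by omega) (by omega) (by omega) (by omega)]
      exact hi.base.1 x hx
    · rw [← hi.base.2 a ha' i, baseView, baseView, ha,
        hv 32 (by omega) (by omega) (by omega) (by omega)]

theorem Inv.setArr (hi : J.Inv y₀ R k h g yes no s) {a i v : ℕ} (ha : a = 3 ∨ a = 4) :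
    J.Inv y₀ R k h g (if a = 3 then Function.update yes i v else yes)
      (if a = 4 then Function.update no i v else no) (s.setArr a i v) where
  env := hi.env.congr (fun x hx => rfl)
    (by simp [Store.setArr, show 2 ≠ a by omega])
    fun b => by simp [Store.setArr, show 10 + 5 * b ≠ a by omega]
  st :=
    { lt31 := hi.st.lt31
      lt32 := hi.st.lt32
      le31 := fun b i => by
        simpa [Store.setArr, show 14 + 5 * b ≠ a by omega] using hi.st.le31 b i
      le32 := fun b i => by
        simpa [Store.setArr, show 12 + 5 * b ≠ a by omega] using hi.st.le32 b i
      fresh := fun h => by simp at h }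
  v9 := hi.v9
  v10 := hi.v10
  v31 := hi.v31
  v32 := hi.v32
  a3 := by rcases ha with rfl | rfl <;> simp [Store.setArr, hi.a3]
  a4 := by rcases ha with rfl | rfl <;> simp [Store.setArr, hi.a4]
  base := by
    refine ⟨hi.base.1, fun b hb j => ?_⟩
    rw [← hi.base.2 b hb j]
    simp [baseView, Store.setArr, show 12 + 5 * b ≠ a by omega, show 11 + 5 * b ≠ a by omega,
      show 10 + 5 * b ≠ a by omega]

theorem simRel_setArr {ρ B a i v : ℕ} {y : Store} (hr : SimRel ρ B y s) (ha : a < 10) :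
    SimRel ρ B y (s.setArr a i v) := by
  refine ⟨hr.1, fun b hb j => ?_⟩
  rw [← hr.2 b hb j]
  simp [view, Store.setArr, show 14 + 5 * b ≠ a by omega, show 13 + 5 * b ≠ a by omega,
    show 12 + 5 * b ≠ a by omega, show 11 + 5 * b ≠ a by omega, show 10 + 5 * b ≠ a by omega]

theorem OK.lt_t (_ : J.OK) {x : ℕ} (hx : x < 40) : x < J.t := by unfold t; omega

theorem OK.n₃_lt (hJ : J.OK) : J.n₃ + 1 < J.B := by
  have h1 := hJ.stamp
  have h2 : J.n₃ + 1 ≤ (J.Rmax + 1) * (J.n₃ + 1) := Nat.le_mul_of_pos_left _ (by omega)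
  omega

/-- All stamps of the upper layer are at most the old value of register 31, so increasing it voids
every change since the preprocessing, in constant time. Registers are few and are copied back. -/
theorem runs_restore (hJ : J.OK) (hi : J.Inv y₀ R k h g yes no s) (hB : h + 1 < J.B) :
    ∃ s', Runs J.t J.B (restoreCmd J.t J.ρ) s (2 * J.ρ + 10) s' ∧ SimRel J.ρ J.B y₀ s' ∧
      J.Inv y₀ R k (h + 1) g yes no s' := by
  have h31 := hi.v31
  have c : Computes J.t J.B s (.bin .plus (.reg 31) (.num 1)) (s.var 31 + 1) :=
    .bin (.reg (hJ.lt_t (by omega)) rfl (by omega)) (.num _ (by omega)) rfl (by omega)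
  have r1 := Runs.set (x := 31) c.1 (by rw [c.2]; omega)
  rw [c.2] at r1
  have hs31 : ∀ x, x ≠ 31 → (s.setVar 31 (s.var 31 + 1)).var x = s.var x := fun x hx => by
    simp [Store.setVar, hx]
  obtain ⟨s', r2, hv, hv', ha⟩ := runs_each (t := J.t) (B := J.B) (a := 40) (ρ := J.ρ)
    (f := fun x => .copy (x + 40) (x + (40 + J.ρ))) (v := y₀.var)
    (s := s.setVar 31 (s.var 31 + 1)) (by
      intro x hx s₁ h1 h2
      have e : s₁.var (x + (40 + J.ρ)) = y₀.var x := by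
        rw [h1 _ (by omega), hs31 _ (by omega)]
        exact (hi.base.1 x hx).1
      rw [← e]
      exact Runs.copy (by unfold t; omega) (by rw [e]; exact (hi.base.1 x hx).2)) J.ρ le_rfl
  have e31 : s'.var 31 = s.var 31 + 1 := by rw [hv' _ (by omega)]; simp [Store.setVar]
  have ev : ∀ x, x ≠ 31 → (x < 40 ∨ 40 + J.ρ ≤ x) → s'.var x = s.var x := fun x hx hx' => by
    rw [hv' x hx', hs31 x hx]
  have ha' : s'.arr = s.arr := ha
  refine ⟨s', (r1.seq r2).mono (by simp [Expr.time]; omega), ⟨fun x hx => ⟨hv x hx,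
    (hi.base.1 x hx).2⟩, fun a haρ i => ?_⟩, ?_⟩
  · have := hi.st.le31 a i
    rw [← hi.base.2 a haρ i, view, baseView, ha', e31, if_neg (by omega),
      ev 32 (by omega) (by omega)]
  · exact hi.congr ha' (fun x _ _ h3 h4 => ev x h3 h4) ((ev 9 (by omega) (by omega)).trans hi.v9)
      ((ev 10 (by omega) (by omega)).trans hi.v10) (by omega) (by omega) (by omega)

open Classical in
theorem runs_record (hJ : J.OK) {y : Store} (hi : J.Inv y₀ R k h g yes no s) (hk : k < J.n₃)
    (hr : SimRel J.ρ J.B y s) (hy : yes k + 1 < J.B) (hn : no k + 1 < J.B) :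
    Runs J.t J.B (recordCmd J.t J.q) s 25
      (if J.Yes y then s.setArr 3 k (yes k + 1) else s.setArr 4 k (no k + 1)) := by
  have hρ := hJ.ρ
  have hkB : k < J.B := by have := hJ.n₃_lt; omega
  have c10 : Computes J.t J.B s (.reg 10) k := .reg (hJ.lt_t (by omega)) hi.v10 hkB
  have count : ∀ a v, s.arr a k = v → v + 1 < J.B →
      Runs J.t J.B (countCmd J.t a) s 11 (s.setArr a k (v + 1)) := by
    intro a v hv hvB
    have c : Computes J.t J.B s (.bin .plus (.get a (.reg 10)) (.num 1)) (v + 1) :=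
      .bin (.get c10 hv (by omega)) (.num _ (by omega)) rfl hvB
    have := Runs.put (a := a) c10.1 c.1
    rw [c.2, c10.2] at this
    exact this.mono (by simp [Expr.time])
  have k3 := count 3 (yes k) (by rw [hi.a3]) hy
  have k4 := count 4 (no k) (by rw [hi.a4]) hn
  have h0 := hr.1 0 (by omega)
  have h1 := hr.1 1 (by omega)
  simp only [zero_add, Nat.reduceAdd] at h0 h1
  have c40 : Computes J.t J.B s (.reg 40) (y.var 0) := .reg (by unfold t; omega) h0.1 h0.2
  have hq2 : 2 * J.q < J.B := by have := hJ.hub; omega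
  have c41 : Computes J.t J.B s (.bin .minus (.num (2 * J.q)) (.reg 41)) (2 * J.q - y.var 1) :=
    .bin (.num _ hq2) (.reg (by unfold t; omega) h1.1 h1.2) rfl (by omega)
  unfold recordCmd Yes
  by_cases hy0 : y.var 0 = 0
  · rw [if_neg (by simp [hy0])]
    exact (Runs.cond_false c40.1 (by rw [c40.2, hy0]) k4).mono (by simp [Expr.time])
  · by_cases hy1 : y.var 1 < 2 * J.q
    · rw [if_pos ⟨hy0, hy1⟩]
      exact (Runs.cond_true c40.1 (by rw [c40.2]; exact hy0)
        (Runs.cond_true c41.1 (by rw [c41.2]; omega) k3)).mono (by simp [Expr.time])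
    · rw [if_neg (by simp [hy1])]
      exact (Runs.cond_true c40.1 (by rw [c40.2]; exact hy0)
        (Runs.cond_false c41.1 (by rw [c41.2]; omega) k4)).mono (by simp [Expr.time])

/-- The number of positive and negative answers in round `R`, before stage `k`, is possible. -/
def Counts (R k : ℕ) (yes no : ℕ → ℕ) : Prop :=
  (∀ i, yes i + no i ≤ R) ∧ ∀ i, k ≤ i → yes i + no i + 1 ≤ R

/-- The time that the dynamic algorithm may use in a stage. -/
def stageTime (J : Job) : ℕ := 2 * (J.d * J.tu) + J.tq

/-- The additional time of a stage. -/
def stageCost (J : Job) : ℕ := 2 * (J.d * 60) + 2 * J.ρ + 150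

/-- The loop over the stages follows the recursion of `chain`. The sum over i < k holds the scores
already updated in this round, while `sc` still describes the stages to come. With rollback the
state at the head of the loop counts as `y₀`, although the memory is restored only at the beginning
of the next stage; for this reason `SimRel` is demanded only without rollback. -/
theorem costU_stages (hJ : J.OK) {y₀ : Store × ℕ} {kk : List Cmd} {T₀ : ℕ} {f : Store → ℝ≥0∞}
    {c : ℝ≥0∞} (hc : c ≠ 0) {sc : ℕ → ℝ≥0∞} (hR : R ≤ J.Rmax)
    (hend : ∀ s yes no, J.Inv y₀.1 R J.n₃ (R * (J.n₃ + 1) + J.n₃) g yes no s →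
      Counts R J.n₃ yes no → costU J.t J.B T₀ kk s f ≤
        c * ∑ i ∈ Finset.range J.n₃, J.score i (yes i) (no i)) (m : ℕ) :
    ∀ {k : ℕ} {yes no : ℕ → ℕ} (y : Store × ℕ) (s : Store), k + m = J.n₃ →
      J.Inv y₀.1 R k (R * (J.n₃ + 1) + k) g yes no s → Counts R k yes no →
      (∀ i, k ≤ i → sc i = J.score i (yes i) (no i)) →
      (if J.roll then y = y₀ else SimRel J.ρ J.B y.1 s) →
      costU J.t J.B (19 * (lv J.M y.2 + m * J.stageTime) + m * J.stageCost + 10 + T₀)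
        (whileTail J.t (.bin .minus (.reg 2) (.reg 10))
          (stageCmd J.A J.t J.q J.ρ J.ins J.roll) kk) s f ≤
        c * (∑ i ∈ Finset.range k, J.score i (yes i) (no i) + J.chain y₀ sc m k y) := by
  have hn₃ := hJ.n₃_lt
  have hρ := hJ.ρ
  have hcond : ∀ {k h : ℕ} {yes no : ℕ → ℕ} {s : Store}, J.Inv y₀.1 R k h g yes no s → k ≤ J.n₃ →
      Computes J.t J.B s (.bin .minus (.reg 2) (.reg 10)) (J.n₃ - k) := fun hi hk =>
    .bin (.reg (hJ.lt_t (by omega)) hi.env.v2 (by omega))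
      (.reg (hJ.lt_t (by omega)) hi.v10 (by omega)) rfl (by omega)
  induction m with
  | zero =>
    intro k yes no y s hkm hi hcnt _ _
    have hk : k = J.n₃ := by omega
    subst hk
    have hc := hcond hi le_rfl
    have h1 := reaches_whileTail_end hc.1 (stageCmd J.A J.t J.q J.ρ J.ins J.roll) kk
      (by rw [hc.2]; omega)
    rw [chain, add_zero]
    exact le_trans (costU_anti (T := T₀ + 10) (by omega) _ _ _)
      (((h1.mono (by simp [Expr.time])) _ f).trans (hend s yes no hi hcnt))
  | succ m ih =>
    intro k yes no y s hkm hi hcnt hsc hy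
    have hk : k < J.n₃ := by omega
    set tail := whileTail J.t (.bin .minus (.reg 2) (.reg 10))
      (stageCmd J.A J.t J.q J.ρ J.ins J.roll) kk with htail
    have hc1 := hcond hi hk.le
    have h1 := reaches_whileTail hc1.1 (stageCmd J.A J.t J.q J.ρ J.ins J.roll) kk
      (by rw [hc1.2]; omega)
    rw [← htail] at h1
    have hRk : R * (J.n₃ + 1) + k + 1 < J.B := by
      have h2 := hJ.stamp
      have h3 : (R + 1) * (J.n₃ + 1) ≤ (J.Rmax + 1) * (J.n₃ + 1) :=
        Nat.mul_le_mul_right _ (by omega)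
      have h4 : (R + 1) * (J.n₃ + 1) = R * (J.n₃ + 1) + (J.n₃ + 1) := by ring
      omega
    -- the end of the stage
    have hinc : ∀ {yes' no' : ℕ → ℕ} (y' : Store × ℕ) (s' : Store),
        J.Inv y₀.1 R k (R * (J.n₃ + 1) + k + 1) g yes' no' s' → Counts R (k + 1) yes' no' →
        (∀ i, k + 1 ≤ i → sc i = J.score i (yes' i) (no' i)) →
        (if J.roll then y' = y₀ else SimRel J.ρ J.B y'.1 s') →
        costU J.t J.B (19 * (lv J.M y'.2 + m * J.stageTime) + m * J.stageCost + 20 + T₀)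
          (.set J.t 10 (.bin .plus (.reg 10) (.num 1)) :: tail) s' f ≤
          c * (∑ i ∈ Finset.range (k + 1), J.score i (yes' i) (no' i) +
            J.chain y₀ sc m (k + 1) y') := by
      intro yes' no' y' s' hi' hcnt' hsc' hy'
      have c10 : Computes J.t J.B s' (.bin .plus (.reg 10) (.num 1)) (k + 1) :=
        .bin (.reg (hJ.lt_t (by omega)) hi'.v10 (by omega)) (.num _ (by omega)) rfl (by omega)
      have r := Runs.set (x := 10) c10.1 (by rw [c10.2]; omega)
      rw [c10.2] at r
      have hsv : ∀ x, x ≠ 10 → (s'.setVar 10 (k + 1)).var x = s'.var x := fun x hx => by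
        simp [Store.setVar, hx]
      have hi'' : J.Inv y₀.1 R (k + 1) (R * (J.n₃ + 1) + (k + 1)) g yes' no'
          (s'.setVar 10 (k + 1)) :=
        hi'.congr rfl (fun x _ h10 _ _ => hsv x h10) ((hsv 9 (by omega)).trans hi'.v9)
          (by simp [Store.setVar]) (hsv 31 (by omega)).ge
          ((hsv 31 (by omega)).le.trans (by have := hi'.v31; omega))
          ((hsv 31 (by omega)).trans_lt hi'.st.lt31)
      refine le_trans (costU_anti (T := 19 * (lv J.M y'.2 + m * J.stageTime) + m * J.stageCost +
        10 + T₀ + 10) (by omega) _ _ _) ((((r tail).mono (by simp [Expr.time])) _ f).trans ?_)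
      refine ih y' _ (by omega) hi'' hcnt' hsc' ?_
      split_ifs at hy' ⊢
      · exact hy'
      · exact hy'.setVar_low _ (by omega)
    -- returning to the basic graph
    have hafter : ∀ {yes' no' : ℕ → ℕ} (y' : Store × ℕ) (s' : Store),
        J.Inv y₀.1 R k (R * (J.n₃ + 1) + k + 1) g yes' no' s' → Counts R (k + 1) yes' no' →
        (∀ i, k + 1 ≤ i → sc i = J.score i (yes' i) (no' i)) → SimRel J.ρ J.B y'.1 s' →
        costU J.t J.B (19 * (lv J.M y'.2 + J.d * J.tu + m * J.stageTime) + J.d * 60 +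
            m * J.stageCost + 41 + T₀)
          (.seq (if J.roll then .skip else opsCmd J.t J.q (updCmd J.A false) true)
            (.set J.t 10 (.bin .plus (.reg 10) (.num 1))) :: tail) s' f ≤
          J.srv (J.bck k) y' fun y'' => c * (∑ i ∈ Finset.range (k + 1), J.score i (yes' i) (no' i) +
            J.chain y₀ sc m (k + 1) (if J.roll then y₀ else y'')) := by
      intro yes' no' y' s' hi' hcnt' hsc' hr'
      have r1 := reaches_seq J.t J.B
        (if J.roll then .skip else opsCmd J.t J.q (updCmd J.A false) true)
        (.set J.t 10 (.bin .plus (.reg 10) (.num 1))) tail s'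
      refine le_trans (costU_anti (T := 19 * (lv J.M y'.2 + J.d * J.tu + m * J.stageTime) +
        J.d * 60 + m * J.stageCost + 40 + T₀ + 1) (by omega) _ _ _) ((r1 _ f).trans ?_)
      by_cases hroll : J.roll = true
      · simp only [hroll, if_true, bck, srv] at hinc ⊢
        rw [ex_serve_nil]
        -- The budget of the next stage refers to the leftover of `y₀`, not of `y'`; this is
        -- harmless as worst-case bounds carry nothing over.
        have hlv : ∀ b, lv J.M b = 0 := fun b => by rw [hJ.timing hroll]; rfl
        refine le_trans (costU_anti (T := 19 * (lv J.M y₀.2 + m * J.stageTime) +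
          m * J.stageCost + 20 + T₀ + 1) (by rw [hlv, hlv]; omega) _ _ _)
          ((Runs.skip J.t J.B s' _ _ f).trans ?_)
        exact hinc y₀ s' hi' hcnt' hsc' rfl
      · simp only [hroll, if_false, bck, back, Bool.false_eq_true] at hinc ⊢
        have := costU_ops (ins := false) (on := true) (k := .set J.t 10
          (.bin .plus (.reg 10) (.num 1)) :: tail) (T₀ := 19 * (m * J.stageTime) + m * J.stageCost +
            20 + T₀) (f := f) hJ hi'.env hi'.st hi'.v10 hk
          (g := fun y'' => c * (∑ i ∈ Finset.range (k + 1), J.score i (yes' i) (no' i) +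
            J.chain y₀ sc m (k + 1) y'')) (fun y'' s'' hr'' hf'' =>
              le_trans (costU_anti (by omega) _ _ _)
                (hinc y'' s'' (hi'.of_frame hf'') hcnt' hsc' hr'')) y' hr'
        exact le_trans (costU_anti (by omega) _ _ _) this
    -- recording the answer
    have hrec : ∀ (y' : Store × ℕ) (s' : Store),
        J.Inv y₀.1 R k (R * (J.n₃ + 1) + k + 1) g yes no s' → SimRel J.ρ J.B y'.1 s' →
        costU J.t J.B (19 * (lv J.M y'.2 + J.d * J.tu + m * J.stageTime) + J.d * 60 +
            m * J.stageCost + 70 + T₀)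
          (.seq (recordCmd J.t J.q) (.seq (if J.roll then .skip else
            opsCmd J.t J.q (updCmd J.A false) true)
            (.set J.t 10 (.bin .plus (.reg 10) (.num 1)))) :: tail) s' f ≤
          c * (∑ i ∈ Finset.range k, J.score i (yes i) (no i) + (J.factor k y'.1 * sc k +
            J.srv (J.bck k) y' fun y'' => J.chain y₀ sc m (k + 1) (if J.roll then y₀ else y''))) := by
      intro y' s' hi' hr'
      -- Stage k has not been answered in round R yet, so its counters sum to less than R and remain
      -- words after the increment.
      have hcB : yes k + no k + 1 < J.B := by
        have h2 := hcnt.2 k le_rfl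
        have h3 := hJ.stamp
        have h4 : J.Rmax + 1 ≤ (J.Rmax + 1) * (J.n₃ + 1) := Nat.le_mul_of_pos_right _ (by omega)
        omega
      have r1 := (reaches_seq J.t J.B (recordCmd J.t J.q) (.seq (if J.roll then .skip else
            opsCmd J.t J.q (updCmd J.A false) true)
            (.set J.t 10 (.bin .plus (.reg 10) (.num 1)))) tail s').trans
        (runs_record hJ hi' hk hr' (by omega) (by omega) _)
      refine le_trans (costU_anti (T := 19 * (lv J.M y'.2 + J.d * J.tu + m * J.stageTime) +
        J.d * 60 + m * J.stageCost + 41 + T₀ + 29) (by omega) _ _ _)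
        (((r1.mono (by omega)) _ f).trans ?_)
      have hsum : ∀ yes' no' : ℕ → ℕ, (∀ i, i ≠ k → yes' i = yes i ∧ no' i = no i) →
          J.score k (yes' k) (no' k) = J.factor k y'.1 * J.score k (yes k) (no k) →
          (J.srv (J.bck k) y' fun y'' => c * (∑ i ∈ Finset.range (k + 1), J.score i (yes' i) (no' i) +
            J.chain y₀ sc m (k + 1) (if J.roll then y₀ else y''))) ≤
          c * (∑ i ∈ Finset.range k, J.score i (yes i) (no i) + (J.factor k y'.1 * sc k +
            J.srv (J.bck k) y' fun y'' => J.chain y₀ sc m (k + 1)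
              (if J.roll then y₀ else y''))) := by
        intro yes' no' hne hk'
        -- The updated scores up to stage k no longer depend on the random bits of the operations
        -- that follow, so they leave the expectation.
        refine (ex_affine_le _ hc _ _).trans ?_
        rw [Finset.sum_range_succ, hk', hsc k le_rfl, add_assoc]
        have : ∑ i ∈ Finset.range k, J.score i (yes' i) (no' i) =
            ∑ i ∈ Finset.range k, J.score i (yes i) (no i) := by
          refine Finset.sum_congr rfl fun i hik => ?_
          have := hne i (Finset.mem_range.1 hik).ne
          rw [this.1, this.2]
        rw [this]
      by_cases hyes : J.Yes y'.1
      · rw [if_pos hyes]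
        have hi'' := hi'.setArr (a := 3) (i := k) (v := yes k + 1) (.inl rfl)
        simp only [if_true, Nat.reduceEqDiff, if_false] at hi''
        refine (hafter y' _ hi'' ?_ ?_ (simRel_setArr hr' (by omega))).trans (hsum _ _ ?_ ?_)
        · refine ⟨fun i => ?_, fun i hik => ?_⟩
          · by_cases hik : i = k
            · subst hik; have := hcnt.2 i le_rfl; simp; omega
            · simpa [hik] using hcnt.1 i
          · have : i ≠ k := by omega
            simpa [this] using hcnt.2 i (by omega)
        · intro i hik
          have : i ≠ k := by omega
          simpa [this] using hsc i (by omega)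
        · intro i hik; simp [hik]
        · simpa using score_yes hyes
      · rw [if_neg hyes]
        have hi'' := hi'.setArr (a := 4) (i := k) (v := no k + 1) (.inr rfl)
        simp only [if_true, Nat.reduceEqDiff, if_false] at hi''
        refine (hafter y' _ hi'' ?_ ?_ (simRel_setArr hr' (by omega))).trans (hsum _ _ ?_ ?_)
        · refine ⟨fun i => ?_, fun i hik => ?_⟩
          · by_cases hik : i = k
            · subst hik; have := hcnt.2 i le_rfl; simp; omega
            · simpa [hik] using hcnt.1 i
          · have : i ≠ k := by omega
            simpa [this] using hcnt.2 i (by omega)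
        · intro i hik
          have : i ≠ k := by omega
          simpa [this] using hsc i (by omega)
        · intro i hik; simp [hik]
        · simpa using score_no hyes
    -- the query
    have hqry : ∀ (y' : Store × ℕ) (s' : Store),
        J.Inv y₀.1 R k (R * (J.n₃ + 1) + k + 1) g yes no s' → SimRel J.ρ J.B y'.1 s' →
        costU J.t J.B (19 * (lv J.M y'.2 + J.tq + J.d * J.tu + m * J.stageTime) + J.d * 60 +
            m * J.stageCost + 71 + T₀)
          (.seq (simCmd J.t true J.A.onQuery) (.seq (recordCmd J.t J.q) (.seq (if J.roll then .skip
            else opsCmd J.t J.q (updCmd J.A false) true)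
            (.set J.t 10 (.bin .plus (.reg 10) (.num 1))))) :: tail) s' f ≤
          J.srv [.query] y' fun y' =>
          c * (∑ i ∈ Finset.range k, J.score i (yes i) (no i) + (J.factor k y'.1 * sc k +
            J.srv (J.bck k) y' fun y'' => J.chain y₀ sc m (k + 1)
              (if J.roll then y₀ else y''))) := by
      intro y' s' hi' hr'
      have r1 := reaches_seq J.t J.B (simCmd J.t true J.A.onQuery) (.seq (recordCmd J.t J.q)
        (.seq (if J.roll then .skip else opsCmd J.t J.q (updCmd J.A false) true)
          (.set J.t 10 (.bin .plus (.reg 10) (.num 1))))) tail s'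
      refine le_trans (costU_anti (T := 19 * (lv J.M y'.2 + J.tq) + (19 * (J.d * J.tu +
        m * J.stageTime) + J.d * 60 + m * J.stageCost + 70 + T₀) + 1) (by omega) _ _ _)
        ((r1 _ f).trans ?_)
      rw [srv, ex_serve_cons]
      simp only [ex_serve_nil]
      rw [show (Op.query : Op (Gadget.hub J.q J.S + 1)).bound J.tu J.tq = J.tq from rfl, grant_eq]
      refine costU_sim_le (t := J.t) (B := J.b) (B' := J.B) (ρ := J.ρ) true (s₀ := s')
        (v₂₉ := s'.var 29) hJ.b (by unfold t; omega) hi'.st ?_ _ [J.A.onQuery] y'.1 s'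
        (by simpa using hJ.qry) hr' (SimFrame.refl _ _ _) rfl
      intro s₁ b s₁' hr₁ hf₁ _
      exact le_trans (costU_anti (by have := lv_le J.M b; simp only; omega) _ _ _)
        (hrec (s₁, b) s₁' (hi'.of_frame hf₁) hr₁)
    -- the updates
    have hops : ∀ (s' : Store), J.Inv y₀.1 R k (R * (J.n₃ + 1) + k + 1) g yes no s' →
        SimRel J.ρ J.B y.1 s' →
        costU J.t J.B (19 * (lv J.M y.2 + (m + 1) * J.stageTime) + 2 * (J.d * 60) +
            m * J.stageCost + 110 + T₀)
          (.seq (opsCmd J.t J.q (updCmd J.A J.ins) J.ins) (.seq (simCmd J.t true J.A.onQuery)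
            (.seq (recordCmd J.t J.q) (.seq (if J.roll then .skip
            else opsCmd J.t J.q (updCmd J.A false) true)
            (.set J.t 10 (.bin .plus (.reg 10) (.num 1)))))) :: tail) s' f ≤
          c * (∑ i ∈ Finset.range k, J.score i (yes i) (no i) + J.chain y₀ sc (m + 1) k y) := by
      intro s' hi' hr'
      rw [chain]
      refine le_trans ?_ (ex_affine_le _ hc _ _)
      change _ ≤ J.srv (J.fwd k) y _
      rw [fwd, srv, ex_serve_append]
      have r1 := reaches_seq J.t J.B (opsCmd J.t J.q (updCmd J.A J.ins) J.ins)
        (.seq (simCmd J.t true J.A.onQuery) (.seq (recordCmd J.t J.q)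
        (.seq (if J.roll then .skip else opsCmd J.t J.q (updCmd J.A false) true)
          (.set J.t 10 (.bin .plus (.reg 10) (.num 1)))))) tail s'
      have hmul : (m + 1) * J.stageTime = m * J.stageTime + (2 * (J.d * J.tu) + J.tq) := by
        rw [add_mul, one_mul, stageTime]
      refine le_trans (costU_anti (T := 19 * (lv J.M y.2 + J.d * J.tu) + J.d * 60 + 20 +
        (19 * (J.tq + J.d * J.tu + m * J.stageTime) + J.d * 60 + m * J.stageCost + 71 + T₀) + 1)
        (by omega) _ _ _) ((r1 _ f).trans ?_)
      exact costU_ops hJ hi'.env hi'.st hi'.v10 hk (fun y'' s'' hr'' hf'' =>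
        le_trans (costU_anti (by omega) _ _ _) (hqry y'' s'' (hi'.of_frame hf'') hr'')) y hr'
    have hcost : (m + 1) * J.stageCost = m * J.stageCost + (2 * (J.d * 60) + 2 * J.ρ + 150) := by
      rw [add_mul, one_mul, stageCost]
    by_cases hroll : J.roll = true
    · rw [if_pos hroll] at hy
      subst hy
      obtain ⟨s', r2, hr', hi'⟩ := runs_restore hJ hi hRk
      have h2 := h1.trans ((reaches_seq _ _ _ _ _ _).trans
        ((show Runs J.t J.B (if J.roll then restoreCmd J.t J.ρ else .skip) s _ s' by
          rw [if_pos hroll]; exact r2) _))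
      refine le_trans (costU_anti (T := 19 * (lv J.M y.2 + (m + 1) * J.stageTime) + 2 * (J.d * 60) +
            m * J.stageCost + 110 + T₀ + (2 * J.ρ + 30)) (by omega) _ _ _)
        (((h2.mono (by simp [Expr.time]; omega)) _ f).trans (hops s' hi' hr'))
    · rw [if_neg hroll] at hy
      have hi' : J.Inv y₀.1 R k (R * (J.n₃ + 1) + k + 1) g yes no s :=
        { hi with v31 := hi.v31.trans (Nat.le_succ _) }
      have h2 := h1.trans ((reaches_seq _ _ _ _ _ _).trans
        ((show Runs J.t J.B (if J.roll then restoreCmd J.t J.ρ else .skip) s 1 s by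
          rw [if_neg hroll]; exact Runs.skip _ _ _) _))
      refine le_trans (costU_anti (T := 19 * (lv J.M y.2 + (m + 1) * J.stageTime) + 2 * (J.d * 60) +
            m * J.stageCost + 110 + T₀ + (2 * J.ρ + 30)) (by omega) _ _ _)
        (((h2.mono (by simp [Expr.time])) _ f).trans (hops s hi' hy))

end Job

end Gadget

namespace Gadget

namespace Job

variable {J : Job} {R g : ℕ} {yes no : ℕ → ℕ} {s : Store}

/-! ### Rounds -/

/-- Start the next round with the machine of the dynamic algorithm cleared. -/
def clearCmd (t ρ : ℕ) : Cmd :=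
  .seq (.set t 9 (.bin .quot (.reg 9) (.num 2)))
    (.seq (.set t 32 (.bin .plus (.reg 32) (.num 1)))
      (.seq (.set t 31 (.bin .times (.reg 32) (.bin .plus (.reg 2) (.num 1))))
        (.seq (Cmd.each (fun x => .const (x + 40) 0) ρ)
          (.seq (.set t 40 (.bin .plus (.reg 5) (.num 1))) (.set t 41 (.reg 8))))))

/-- Keep the registers of the dynamic algorithm. -/
def saveCmd (t ρ : ℕ) : Cmd :=
  .seq (Cmd.each (fun x => .copy (x + (40 + ρ)) (x + 40)) ρ) (.set t 10 (.num 0))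

/-- One round. -/
def roundCmd (A : DynAlg) (t q ρ : ℕ) (ins roll : Bool) : Cmd :=
  .seq (clearCmd t ρ) (.seq (simCmd t false A.preprocess) (.seq (saveCmd t ρ)
    (.while t (.bin .minus (.reg 2) (.reg 10)) (stageCmd A t q ρ ins roll))))

/-- The invariant of the loop over the rounds, after round `R`. -/
structure Head (J : Job) (R g : ℕ) (yes no : ℕ → ℕ) (s : Store) : Prop where
  env : J.Env s
  st : StampsOK true J.B s
  v9 : s.var 9 = g
  v31 : s.var 31 ≤ R * (J.n₃ + 1) + J.n₃
  v32 : s.var 32 = R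
  a3 : s.arr 3 = yes
  a4 : s.arr 4 = no

theorem Inv.head {y₀ : Store} {k : ℕ}
    (h : J.Inv y₀ R k (R * (J.n₃ + 1) + J.n₃) g yes no s) : J.Head R g yes no s where
  env := h.env
  st := h.st
  v9 := h.v9
  v31 := h.v31
  v32 := h.v32
  a3 := h.a3
  a4 := h.a4

theorem OK.stamp_lt (hJ : J.OK) (hR : R ≤ J.Rmax) : (R + 1) * (J.n₃ + 1) < J.B :=
  (Nat.mul_le_mul_right _ (by omega)).trans_lt hJ.stamp

/-- The state after `clearCmd`. -/
structure Cleared (J : Job) (R g : ℕ) (yes no : ℕ → ℕ) (s : Store) : Prop where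
  env : J.Env s
  st : StampsOK false J.B s
  v9 : s.var 9 = g
  v31 : s.var 31 = R * (J.n₃ + 1)
  v32 : s.var 32 = R
  a3 : s.arr 3 = yes
  a4 : s.arr 4 = no

/-- Round R + 1 starts with the stamps R + 1 for the lower and (R + 1)(n₃ + 1) for the upper layer.
Both exceed all older stamps, as the upper ones reach at most R(n₃ + 1) + n₃ with one increment per
stage. So the simulated arrays show their initial contents again, which are the edge list built in
place. -/
theorem runs_clear (hJ : J.OK) {L : List (Fin (hub J.q J.S + 1) × Fin (hub J.q J.S + 1))}
    (hL : J.l = L.map fun e => ((e.1 : ℕ), (e.2 : ℕ))) (hR : R + 1 ≤ J.Rmax) (hg : g < J.B)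
    (h : J.Head R g yes no s) :
    ∃ s', Runs J.t J.B (clearCmd J.t J.ρ) s (2 * J.ρ + 60) s' ∧
      SimRel J.ρ J.B (graphStore L) s' ∧ J.Cleared (R + 1) (g / 2) yes no s' := by
  have hρ := hJ.ρ
  have hn₃ := hJ.n₃_lt
  have hst := hJ.stamp_lt hR
  have hst' : R + 1 ≤ (R + 1) * (J.n₃ + 1) := Nat.le_mul_of_pos_right _ (by omega)
  have hst2 : (R + 1 + 1) * (J.n₃ + 1) = (R + 1) * (J.n₃ + 1) + (J.n₃ + 1) := by ring
  have hst3 : (R + 1) * (J.n₃ + 1) = R * (J.n₃ + 1) + (J.n₃ + 1) := by ring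
  have h31 := h.v31
  have c1 : Computes J.t J.B s (.bin .quot (.reg 9) (.num 2)) (g / 2) :=
    .bin (.reg (hJ.lt_t (by omega)) h.v9 hg) (.num _ (by omega)) rfl (by omega)
  have r1 := Runs.set (x := 9) c1.1 (by rw [c1.2]; omega)
  rw [c1.2] at r1
  set s1 := s.setVar 9 (g / 2) with hs1
  have c2 : Computes J.t J.B s1 (.bin .plus (.reg 32) (.num 1)) (R + 1) :=
    .bin (.reg (hJ.lt_t (by omega)) (by simpa [hs1, Store.setVar] using h.v32) (by omega))
      (.num _ (by omega)) rfl (by omega)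
  have r2 := Runs.set (x := 32) c2.1 (by rw [c2.2]; omega)
  rw [c2.2] at r2
  set s2 := s1.setVar 32 (R + 1) with hs2
  have c3 : Computes J.t J.B s2 (.bin .times (.reg 32) (.bin .plus (.reg 2) (.num 1)))
      ((R + 1) * (J.n₃ + 1)) :=
    .bin (.reg (hJ.lt_t (by omega)) (by simp [hs2, Store.setVar]) (by omega))
      (.bin (.reg (hJ.lt_t (by omega)) (by simpa [hs2, hs1, Store.setVar] using h.env.v2)
        (by omega)) (.num _ (by omega)) rfl (show J.n₃ + 1 < J.B by omega)) rfl (by omega)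
  have r3 := Runs.set (x := 31) c3.1 (by rw [c3.2]; omega)
  rw [c3.2] at r3
  set s3 := s2.setVar 31 ((R + 1) * (J.n₃ + 1)) with hs3
  obtain ⟨s4, r4, v4, v4', a4⟩ := runs_each (t := J.t) (B := J.B) (a := 40) (ρ := J.ρ)
    (f := fun x => .const (x + 40) 0) (v := fun _ => 0) (s := s3)
    (fun x _ s₁ _ _ => Runs.const s₁ (by omega)) J.ρ le_rfl
  have e4 : ∀ x, x ≠ 9 → x ≠ 31 → x ≠ 32 → x < 40 → s4.var x = s.var x := by
    intro x h9 h31 h32 hx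
    rw [v4' x (.inl hx)]
    simp [hs3, hs2, hs1, Store.setVar, h9, h31, h32]
  have hhub := hJ.hub
  have c5 : Computes J.t J.B s4 (.bin .plus (.reg 5) (.num 1)) (hub J.q J.S + 1) :=
    .bin (.reg (hJ.lt_t (by omega)) ((e4 5 (by omega) (by omega) (by omega) (by omega)).trans
      h.env.v5) (by omega)) (.num _ (by omega)) rfl (by omega)
  have r5 := Runs.set (x := 40) c5.1 (by rw [c5.2]; omega)
  rw [c5.2] at r5
  have hl := hJ.l
  have c6 : Computes J.t J.B (s4.setVar 40 (hub J.q J.S + 1)) (.reg 8) J.l.length :=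
    .reg (hJ.lt_t (by omega)) (by
      have := (e4 8 (by omega) (by omega) (by omega) (by omega)).trans h.env.v8
      simpa [Store.setVar] using this) hl
  have r6 := Runs.set (x := 41) c6.1 (by rw [c6.2]; exact hl)
  rw [c6.2] at r6
  set s6 := (s4.setVar 40 (hub J.q J.S + 1)).setVar 41 J.l.length with hs6
  have e6 : ∀ x < 40, s6.var x = s4.var x := by
    intro x hx
    simp [hs6, Store.setVar, show x ≠ 40 by omega, show x ≠ 41 by omega]
  have a6 : s6.arr = s.arr := a4
  have v9 : s6.var 9 = g / 2 := by
    rw [e6 9 (by omega), v4' 9 (by omega)]; simp [hs3, hs2, hs1, Store.setVar]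
  have v31 : s6.var 31 = (R + 1) * (J.n₃ + 1) := by
    rw [e6 31 (by omega), v4' 31 (by omega)]; simp [hs3, Store.setVar]
  have v32 : s6.var 32 = R + 1 := by
    rw [e6 32 (by omega), v4' 32 (by omega)]; simp [hs3, hs2, Store.setVar]
  have env : J.Env s6 := h.env.congr (fun x hx => by
    rw [e6 x (by omega), e4 x (by omega) (by omega) (by omega) (by omega)]) (by rw [a6])
    (fun a => by rw [a6])
  have f31 : ∀ a i, s6.arr (14 + 5 * a) i < s6.var 31 := fun a i => by
    have := h.st.le31 a i
    rw [a6, v31]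
    omega
  have f32 : ∀ a i, s6.arr (12 + 5 * a) i < s6.var 32 := fun a i => by
    have h1 := h.st.le32 a i
    have h2 := h.v32
    rw [a6, v32]
    omega
  refine ⟨s6, (r1.seq (r2.seq (r3.seq (r4.seq (r5.seq r6))))).mono
    (by simp [Expr.time]; omega), ⟨fun x hx => ?_, fun a ha i => ?_⟩, ?_⟩
  · match x with
    | 0 => exact ⟨by simp [hs6, Store.setVar, graphStore],
        show hub J.q J.S + 1 < J.B by omega⟩
    | 1 => exact ⟨by simp [hs6, Store.setVar, graphStore, hL],
        show L.length < J.B by rw [hL, List.length_map] at hl; exact hl⟩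
    | x + 2 =>
      refine ⟨?_, show 0 < J.B by omega⟩
      have := v4 (x + 2) hx
      simpa [hs6, Store.setVar, graphStore] using this
  · rw [view, if_neg (by have := f31 a i; omega), if_neg (by have := f32 a i; omega)]
    match a with
    | 0 =>
      have := env.i0 i
      rw [hL, List.map_map] at this
      exact this
    | 1 =>
      have := env.i1 i
      rw [hL, List.map_map] at this
      exact this
    | a + 2 => exact env.i2 (a + 2) (by omega) i
  · exact
      { env := env
        st :=
          { lt31 := by rw [v31]; omega
            lt32 := by rw [v32]; omega
            le31 := fun a i => (f31 a i).le
            le32 := fun a i => (f32 a i).le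
            fresh := fun _ => f31 }
        v9 := v9
        v31 := v31
        v32 := v32
        a3 := by rw [a6, h.a3]
        a4 := by rw [a6, h.a4] }

theorem Cleared.of_frame {s' : Store} (h : J.Cleared R g yes no s)
    (hf : SimFrame false J.ρ s s') : J.Cleared R g yes no s' where
  env := h.env.of_frame hf
  st := h.st.of_frame hf
  v9 := (hf.var 9 (by omega) (by omega)).trans h.v9
  v31 := (hf.var 31 (by omega) (by omega)).trans h.v31
  v32 := (hf.var 32 (by omega) (by omega)).trans h.v32
  a3 := (hf.low 3 (by omega)).trans h.a3
  a4 := (hf.low 4 (by omega)).trans h.a4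

/-- The preprocessing wrote to the lower layer only and the upper layer is stale throughout, so
`view` and `baseView` coincide: the arrays are saved without copying. -/
theorem runs_save (hJ : J.OK) {y₀ : Store} (h : J.Cleared R g yes no s)
    (hr : SimRel J.ρ J.B y₀ s) :
    ∃ s', Runs J.t J.B (saveCmd J.t J.ρ) s (2 * J.ρ + 10) s' ∧
      SimRel J.ρ J.B y₀ s' ∧ J.Inv y₀ R 0 (R * (J.n₃ + 1) + 0) g yes no s' := by
  have hρ := hJ.ρ
  have hB := hJ.n₃_lt
  obtain ⟨s1, r1, v1, v1', a1⟩ := runs_each (t := J.t) (B := J.B) (a := 40 + J.ρ) (ρ := J.ρ)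
    (f := fun x => .copy (x + (40 + J.ρ)) (x + 40)) (v := y₀.var) (s := s) (by
      intro x hx s₁ h1 h2
      have e : s₁.var (x + 40) = y₀.var x := by
        rw [h1 _ (by omega)]
        exact (hr.1 x hx).1
      rw [← e]
      exact Runs.copy (by unfold t; omega) (by rw [e]; exact (hr.1 x hx).2)) J.ρ le_rfl
  have r2 := Runs.set (t := J.t) (B := J.B) (x := 10) (e := .num 0) (s := s1)
    (show 0 < J.B by omega) (show 0 < J.B by omega)
  set s2 := s1.setVar 10 ((Expr.num 0).eval s1) with hs2
  have e2 : ∀ x, x ≠ 10 → s2.var x = s1.var x := fun x hx => by simp [hs2, Store.setVar, hx]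
  have e : ∀ x, x ≠ 10 → x < 40 + J.ρ → s2.var x = s.var x := fun x hx hx' => by
    rw [e2 x hx, v1' x (.inl hx')]
  have a2 : s2.arr = s.arr := a1
  have e31 := e 31 (by omega) (by omega)
  have e32 := e 32 (by omega) (by omega)
  refine ⟨s2, (r1.seq r2).mono (by simp [Expr.time]), ⟨fun x hx => ?_, fun a ha i => ?_⟩, ?_⟩
  · rw [e _ (by omega) (by omega)]
    exact hr.1 x hx
  · rw [← hr.2 a ha i, view, view, e31, e32, a2]
  · exact
      { env := h.env.congr (fun x hx => e x (by omega) (by omega)) (by rw [a2])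
          (fun a => by rw [a2])
        st :=
          { lt31 := by rw [e31]; exact h.st.lt31
            lt32 := by rw [e32]; exact h.st.lt32
            le31 := fun a i => by rw [a2, e31]; exact h.st.le31 a i
            le32 := fun a i => by rw [a2, e32]; exact h.st.le32 a i
            fresh := fun h => by simp at h }
        v9 := (e 9 (by omega) (by omega)).trans h.v9
        v10 := by simp [hs2, Store.setVar, Expr.eval]
        v31 := by rw [e31, h.v31]; rfl
        v32 := e32.trans h.v32
        a3 := by rw [a2, h.a3]
        a4 := by rw [a2, h.a4]
        base := by
          refine ⟨fun x hx => ⟨?_, (hr.1 x hx).2⟩, fun a ha i => ?_⟩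
          · rw [e2 _ (by omega), v1 x hx]
          · rw [← hr.2 a ha i, baseView, view, e32, a2,
              if_neg (show ¬ s.var 31 ≤ s.arr (14 + 5 * a) i from
                not_le.2 (h.st.fresh rfl a i))] }

/-- The time of a round. -/
def roundTime (J : Job) : ℕ :=
  19 * (J.tp + J.n₃ * J.stageTime) + J.n₃ * J.stageCost + 4 * J.ρ + 100

/-- A round decreases the expected sum of scores. -/
def Improves (J : Job) (L : List (Fin (hub J.q J.S + 1) × Fin (hub J.q J.S + 1))) : Prop :=
  ∀ sc : ℕ → ℝ≥0∞, ex (exec J.b J.tp ⟨[J.A.preprocess], graphStore L⟩)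
    (fun y₀ => J.chain y₀ sc J.n₃ 0 y₀) ≤ 17 / 18 * ∑ i ∈ Finset.range J.n₃, sc i

/-- A round is one session from scratch with fresh random bits. Its effect on the scores is `chain`
averaged over the preprocessing, to which `Improves` applies with the scores at the start of the
round. -/
theorem costU_round (hJ : J.OK) {L : List (Fin (hub J.q J.S + 1) × Fin (hub J.q J.S + 1))}
    (hL : J.l = L.map fun e => ((e.1 : ℕ), (e.2 : ℕ))) (himp : J.Improves L) {kk : List Cmd}
    {T₀ : ℕ} {f : Store → ℝ≥0∞} {c : ℝ≥0∞} (hc : c ≠ 0) (hR : R + 1 ≤ J.Rmax) (hg : g < J.B)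
    (h : J.Head R g yes no s) (hcnt : ∀ i, yes i + no i ≤ R)
    (hend : ∀ s yes no, J.Head (R + 1) (g / 2) yes no s → (∀ i, yes i + no i ≤ R + 1) →
      costU J.t J.B T₀ kk s f ≤ c * ∑ i ∈ Finset.range J.n₃, J.score i (yes i) (no i)) :
    costU J.t J.B (J.roundTime + T₀) (roundCmd J.A J.t J.q J.ρ J.ins J.roll :: kk) s f ≤
      c * (17 / 18 * ∑ i ∈ Finset.range J.n₃, J.score i (yes i) (no i)) := by
  obtain ⟨s1, r1, hr1, hc1⟩ := runs_clear hJ hL hR hg h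
  have hrun := ((reaches_seq J.t J.B (clearCmd J.t J.ρ) (.seq (simCmd J.t false J.A.preprocess)
    (.seq (saveCmd J.t J.ρ) (.while J.t (.bin .minus (.reg 2) (.reg 10))
      (stageCmd J.A J.t J.q J.ρ J.ins J.roll)))) kk s).trans (r1 _)).trans
    (reaches_seq J.t J.B _ _ _ _)
  refine le_trans (costU_anti (T := 19 * J.tp + (19 * (J.n₃ * J.stageTime) + J.n₃ * J.stageCost +
    2 * J.ρ + 30 + T₀) + (1 + (2 * J.ρ + 60) + 1)) (by unfold roundTime; omega) _ _ _)
    ((hrun _ f).trans ?_)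
  refine le_trans ?_ (mul_le_mul_right (himp fun i => J.score i (yes i) (no i)) c)
  rw [← ex_const_mul _ hc]
  refine costU_sim_le (t := J.t) (B := J.b) (B' := J.B) (ρ := J.ρ) false (s₀ := s1)
    (v₂₉ := s1.var 29) hJ.b (by unfold t; omega) hc1.st ?_ _ [J.A.preprocess] _ s1
    (by simpa using hJ.pre) hr1 (SimFrame.refl _ _ _) rfl
  intro y b s2 hr2 hf2 _
  have hc2 := hc1.of_frame hf2
  obtain ⟨s3, r3, hr3, hi3⟩ := runs_save hJ hc2 hr2
  have hrun' := ((reaches_seq J.t J.B (saveCmd J.t J.ρ) (.while J.t (.bin .minus (.reg 2) (.reg 10))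
      (stageCmd J.A J.t J.q J.ρ J.ins J.roll)) kk s2).trans (r3 _)).trans
    (reaches_while J.t J.B _ _ _ _)
  have hst := costU_stages hJ (y₀ := (y, b)) (kk := kk) (T₀ := T₀) (f := f) hc
    (sc := fun i => J.score i (yes i) (no i)) hR
    (fun s yes no hi hcnt => hend s yes no hi.head hcnt.1) J.n₃ (k := 0) (y, b) s3 (by omega) hi3
    ⟨fun i => (hcnt i).trans (by omega), fun i _ => by have := hcnt i; omega⟩ (fun _ _ => rfl)
    (by split_ifs; exacts [rfl, hr3])
  rw [Finset.sum_range_zero, zero_add] at hst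
  refine le_trans (costU_anti (T := 19 * (lv J.M b + J.n₃ * J.stageTime) + J.n₃ * J.stageCost + 10 +
    T₀ + (1 + (2 * J.ρ + 10) + 1)) (by have := lv_le J.M b; omega) _ _ _)
    ((hrun' _ f).trans hst)

/-- Halving register 9 in each round makes the number of rounds the binary length of its initial
value. -/
theorem size_eq_succ {g : ℕ} (hg : g ≠ 0) : Nat.size g = Nat.size (g / 2) + 1 := by
  refine le_antisymm (Nat.size_le.2 ?_) ?_
  · have := Nat.lt_size_self (g / 2)
    rw [pow_succ]
    omega
  · have h0 : 0 < Nat.size g := Nat.size_pos.2 (Nat.pos_of_ne_zero hg)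
    obtain ⟨m, hm⟩ := Nat.exists_eq_add_of_lt h0
    rw [zero_add] at hm
    have h1 := Nat.lt_size_self g
    rw [hm, pow_succ] at h1
    rw [hm]
    have := (Nat.size_le (m := g / 2) (n := m)).2 (by omega)
    omega

/-- Induction on the rounds to come. The constant `c` in `costU_round` is the factor (17/18)^m that
the later rounds contribute. -/
theorem costU_rounds (hJ : J.OK) {L : List (Fin (hub J.q J.S + 1) × Fin (hub J.q J.S + 1))}
    (hL : J.l = L.map fun e => ((e.1 : ℕ), (e.2 : ℕ))) (himp : J.Improves L) {kk : List Cmd}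
    {T₀ : ℕ} {f : Store → ℝ≥0∞}
    (hend : ∀ s R yes no, J.Head R 0 yes no s → R ≤ J.Rmax → (∀ i, yes i + no i ≤ R) →
      costU J.t J.B T₀ kk s f ≤ ∑ i ∈ Finset.range J.n₃, J.score i (yes i) (no i)) (m : ℕ) :
    ∀ {g R : ℕ} {yes no : ℕ → ℕ} {s : Store}, Nat.size g = m → R + m ≤ J.Rmax → g < J.B →
      J.Head R g yes no s → (∀ i, yes i + no i ≤ R) →
      costU J.t J.B (m * (J.roundTime + 3) + 3 + T₀) (whileTail J.t (.reg 9)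
        (roundCmd J.A J.t J.q J.ρ J.ins J.roll) kk) s f ≤
        (17 / 18) ^ m * ∑ i ∈ Finset.range J.n₃, J.score i (yes i) (no i) := by
  induction m with
  | zero =>
    intro g R yes no s hm hR hg h hcnt
    have hg0 : g = 0 := Nat.size_eq_zero.1 hm
    subst hg0
    have c : Computes J.t J.B s (.reg 9) 0 := .reg (hJ.lt_t (by omega)) h.v9 hg
    have h1 := reaches_whileTail_end c.1 (roundCmd J.A J.t J.q J.ρ J.ins J.roll) kk c.2
    rw [pow_zero, one_mul]
    exact le_trans (costU_anti (T := T₀ + 3) (by omega) _ _ _)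
      (((h1.mono (by simp [Expr.time])) _ f).trans (hend s R yes no h (by omega) hcnt))
  | succ m ih =>
    intro g R yes no s hm hR hg h hcnt
    have hg0 : g ≠ 0 := by rintro rfl; simp at hm
    have hm' : Nat.size (g / 2) = m := by have := size_eq_succ hg0; omega
    have c : Computes J.t J.B s (.reg 9) g := .reg (hJ.lt_t (by omega)) h.v9 hg
    have h1 := reaches_whileTail c.1 (roundCmd J.A J.t J.q J.ρ J.ins J.roll) kk
      (by rw [c.2]; exact hg0)
    refine le_trans (costU_anti (T := J.roundTime + (m * (J.roundTime + 3) + 3 + T₀) + 3)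
      (by rw [add_mul]; omega) _ _ _) (((h1.mono (by simp [Expr.time])) _ f).trans ?_)
    have := costU_round hJ hL himp (f := f) (T₀ := m * (J.roundTime + 3) + 3 + T₀)
      (c := (17 / 18) ^ m) (by simp [ENNReal.div_eq_zero_iff]) (by omega) hg h hcnt
      fun s' yes' no' h' hcnt' => ih hm' (by omega) (by omega) h' hcnt'
    rwa [pow_succ, mul_assoc]

/-! ### The answer -/

/-- Some stage has more positive than negative answers. -/
def finishCmd (t : ℕ) : Cmd :=
  .seq (.set t 12 (.num 0)) (.seq (.set t 10 (.num 0))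
    (.seq (.while t (.bin .minus (.reg 2) (.reg 10))
      (.seq (.cond t (.bin .minus (.get 3 (.reg 10)) (.get 4 (.reg 10))) (.set t 12 (.num 1)) .skip)
        (.set t 10 (.bin .plus (.reg 10) (.num 1))))) (.set t 0 (.reg 12))))

open Classical in
/-- Whether one of the first `i` stages has more positive than negative answers. -/
def found (yes no : ℕ → ℕ) (i : ℕ) : ℕ := if ∃ j < i, no j < yes j then 1 else 0

theorem runs_finish (hJ : J.OK) (h : J.Head R g yes no s) (hR : R < J.B)
    (hcnt : ∀ i, yes i + no i ≤ R) :
    ∃ s', Runs J.t J.B (finishCmd J.t) s (J.n₃ * 50 + 40) s' ∧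
      s'.var 0 = found yes no J.n₃ := by
  have hn₃ := hJ.n₃_lt
  have r1 := Runs.set (t := J.t) (B := J.B) (x := 12) (e := .num 0) (s := s)
    (show 0 < J.B by omega) (show 0 < J.B by omega)
  have r2 := Runs.set (t := J.t) (B := J.B) (x := 10) (e := .num 0) (s := s.setVar 12 0)
    (show 0 < J.B by omega) (show 0 < J.B by omega)
  set st : ℕ → Store := fun i => (s.setVar 12 (found yes no i)).setVar 10 i with hst
  have hf : ∀ i, found yes no i ≤ 1 := fun i => by unfold found; split_ifs <;> omega
  have hv : ∀ i x, x ≠ 10 → x ≠ 12 → (st i).var x = s.var x := fun i x h1 h2 => by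
    simp [hst, Store.setVar, h1, h2]
  have c : ∀ i ≤ J.n₃, Computes J.t J.B (st i) (.bin .minus (.reg 2) (.reg 10)) (J.n₃ - i) :=
    fun i hi => .bin (.reg (hJ.lt_t (by omega)) ((hv i 2 (by omega) (by omega)).trans h.env.v2)
      (by omega)) (.reg (hJ.lt_t (by omega)) (by simp [hst, Store.setVar]) (by omega)) rfl (by omega)
  have r3 := Runs.while (t := J.t) (B := J.B) (n := 40) (m := J.n₃)
    (e := .bin .minus (.reg 2) (.reg 10))
    (c := .seq (.cond J.t (.bin .minus (.get 3 (.reg 10)) (.get 4 (.reg 10)))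
      (.set J.t 12 (.num 1)) .skip) (.set J.t 10 (.bin .plus (.reg 10) (.num 1)))) st
    (fun i hi => (c i hi).1) (fun i hi => by rw [(c i hi.le).2]; omega)
    (by rw [(c _ le_rfl).2]; omega) (by
      intro i hi
      have c10 : Computes J.t J.B (st i) (.reg 10) i :=
        .reg (hJ.lt_t (by omega)) (by simp [hst, Store.setVar]) (by omega)
      have hci := hcnt i
      have c1 : Computes J.t J.B (st i) (.bin .minus (.get 3 (.reg 10)) (.get 4 (.reg 10)))
          (yes i - no i) :=
        .bin (.get c10 (show s.arr 3 i = yes i by rw [h.a3]) (by omega))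
          (.get c10 (show s.arr 4 i = no i by rw [h.a4]) (by omega)) rfl (by omega)
      have hinc : ∀ s' : Store, s'.var 10 = i → Runs J.t J.B
          (.set J.t 10 (.bin .plus (.reg 10) (.num 1))) s' 7 (s'.setVar 10 (i + 1)) := by
        intro s' hs'
        have c2 : Computes J.t J.B s' (.bin .plus (.reg 10) (.num 1)) (i + 1) :=
          .bin (.reg (hJ.lt_t (by omega)) hs' (by omega)) (.num _ (by omega)) rfl (by omega)
        have := Runs.set (x := 10) c2.1 (by rw [c2.2]; omega)
        rwa [c2.2] at this
      by_cases hyn : no i < yes i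
      · have r := Runs.cond_true (d := .skip) c1.1 (by rw [c1.2]; omega)
          (Runs.set (t := J.t) (B := J.B) (x := 12) (e := .num 1) (s := st i)
            (show 1 < J.B by omega) (show 1 < J.B by omega))
        have := (r.seq (hinc _ (by simp [hst, Store.setVar]))).mono (n' := 40)
          (by simp [Expr.time])
        convert this using 1
        have : found yes no (i + 1) = 1 := if_pos ⟨i, by omega, hyn⟩
        refine Store.ext' (fun x => ?_) fun a i => rfl
        by_cases h10 : x = 10 <;> by_cases h12 : x = 12 <;>
          simp [hst, Store.setVar, h10, h12, this, Expr.eval]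
      · have r := Runs.cond_false (c := .set J.t 12 (.num 1)) c1.1 (by rw [c1.2]; omega)
          (Runs.skip J.t J.B (st i))
        have := (r.seq (hinc _ (by simp [hst, Store.setVar]))).mono (n' := 40)
          (by simp [Expr.time])
        convert this using 1
        have : found yes no (i + 1) = found yes no i := by
          have : (∃ j < i + 1, no j < yes j) ↔ ∃ j < i, no j < yes j := by
            refine ⟨fun ⟨j, hj, h⟩ => ⟨j, ?_, h⟩, fun ⟨j, hj, h⟩ => ⟨j, by omega, h⟩⟩
            rcases Nat.lt_succ_iff_lt_or_eq.1 hj with h' | rfl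
            exacts [h', absurd h hyn]
          simp only [found, this]
        refine Store.ext' (fun x => ?_) fun a i => rfl
        by_cases h10 : x = 10 <;> by_cases h12 : x = 12 <;>
          simp [hst, Store.setVar, h10, h12, this])
  have c4 : Computes J.t J.B (st J.n₃) (.reg 12) (found yes no J.n₃) :=
    .reg (hJ.lt_t (by omega)) (by simp [hst, Store.setVar]) (by have := hf J.n₃; omega)
  have r4 := Runs.set (x := 0) c4.1 (by rw [c4.2]; have := hf J.n₃; omega)
  rw [c4.2] at r4
  have h0 : st 0 = (s.setVar 12 0).setVar 10 0 := by simp [hst, found]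
  rw [h0] at r3
  exact ⟨_, (r1.seq (r2.seq (r3.seq r4))).mono (by simp [Expr.time]; omega),
    by simp [Store.setVar]⟩

open Classical in
/-- The indicator of a wrong final answer. -/
def wrong (J : Job) (s : Store) : ℝ≥0∞ := if s.var 0 ≠ 0 ↔ ∃ k < J.n₃, J.τ k then 0 else 1

/-- A wrong answer is caused by one stage: a no-stage with a positive majority, or a yes-stage
without one. By `one_le_score` its score is at least 1, so the sum of scores dominates the indicator
of error. -/
theorem costU_finish (hJ : J.OK) (h : J.Head R g yes no s) (hR : R < J.B)
    (hcnt : ∀ i, yes i + no i ≤ R) :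
    costU J.t J.B (J.n₃ * 50 + 40) [finishCmd J.t] s J.wrong ≤
      ∑ i ∈ Finset.range J.n₃, J.score i (yes i) (no i) := by
  obtain ⟨s', r, hs'⟩ := runs_finish hJ h hR hcnt
  refine le_trans (costU_anti (T := 0 + (J.n₃ * 50 + 40)) (by omega) _ _ _)
    ((r [] 0 J.wrong).trans (costU_le fun s₁ hs₁ => ?_))
  rw [cost_nil, wrong]
  split_ifs with hw
  · exact zero_le
  · have hv : s₁.var 0 = found yes no J.n₃ := (hs₁.2 0 (hJ.lt_t (by omega))).trans hs'
    rw [hv] at hw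
    have key : ∃ k < J.n₃, 1 ≤ J.score k (yes k) (no k) := by
      by_cases hf : ∃ j < J.n₃, no j < yes j
      · obtain ⟨j, hj, hlt⟩ := hf
        have h1 : found yes no J.n₃ = 1 := if_pos ⟨j, hj, hlt⟩
        rw [h1] at hw
        simp only [ne_eq, one_ne_zero, not_false_eq_true, true_iff] at hw
        exact ⟨j, hj, one_le_score (fun hτ => absurd ⟨j, hj, hτ⟩ hw) fun _ => hlt.le⟩
      · have h1 : found yes no J.n₃ = 0 := if_neg hf
        rw [h1] at hw
        simp only [ne_eq, not_true, false_iff, not_not] at hw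
        obtain ⟨j, hj, hτ⟩ := hw
        exact ⟨j, hj, one_le_score (fun _ => not_lt.1 fun h => hf ⟨j, hj, h⟩) fun h => absurd hτ h⟩
    obtain ⟨k, hk, h1⟩ := key
    exact h1.trans (Finset.single_le_sum (f := fun i => J.score i (yes i) (no i))
      (fun _ _ => zero_le) (Finset.mem_range.2 hk))

end Job

end Gadget

/-! ### The complete program and its error probability -/

namespace Gadget

namespace Job

variable {J : Job} {g : ℕ} {s : Store}

/-- Before the first round all counters are zero and every score is 1, so the initial sum is n₃. -/
theorem costU_search (hJ : J.OK) {L : List (Fin (hub J.q J.S + 1) × Fin (hub J.q J.S + 1))}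
    (hL : J.l = L.map fun e => ((e.1 : ℕ), (e.2 : ℕ))) (himp : J.Improves L)
    (hg : Nat.size g ≤ J.Rmax) (hgB : g < J.B) (h : J.Head 0 g (fun _ => 0) (fun _ => 0) s) :
    costU J.t J.B (Nat.size g * (J.roundTime + 3) + 3 + (J.n₃ * 50 + 40)) (whileTail J.t (.reg 9)
      (roundCmd J.A J.t J.q J.ρ J.ins J.roll) [finishCmd J.t]) s J.wrong ≤
      (17 / 18) ^ Nat.size g * J.n₃ := by
  refine (costU_rounds hJ hL himp (fun s R yes no h hR hcnt => costU_finish hJ h ?_ hcnt) _ rfl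
    (by omega) hgB h (fun i => le_rfl)).trans (le_of_eq ?_)
  · have h1 := hJ.stamp
    have h2 : J.Rmax + 1 ≤ (J.Rmax + 1) * (J.n₃ + 1) := Nat.le_mul_of_pos_right _ (by omega)
    omega
  · have : ∀ i, J.score i 0 0 = 1 := fun i => by simp [score]
    simp [this]

/-- The expression `(3 n₃) ^ m`. -/
def powExpr : ℕ → Expr
  | 0 => .num 1
  | m + 1 => .bin .times (powExpr m) (.bin .times (.num 3) (.reg 2))

theorem time_powExpr (m : ℕ) : (powExpr m).time = 8 * m + 1 := by
  induction m with
  | zero => rfl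
  | succ m ih => simp only [powExpr, Expr.time, ih]; ring

theorem computes_powExpr {t B n M : ℕ} (ht : 40 ≤ t) (hs : s.var 2 = n) (hn : 0 < n)
    (hM : 0 < M) (hB : (3 * n) ^ M < B) :
    ∀ m ≤ M, Computes t B s (powExpr m) ((3 * n) ^ m) := by
  have hle : ∀ m ≤ M, (3 * n) ^ m < B := fun m hm =>
    (Nat.pow_le_pow_right (by omega) hm).trans_lt hB
  have h3 : 3 * n < B := by simpa using hle 1 hM
  intro m
  induction m with
  | zero => exact fun _ => .num _ (by omega)
  | succ m ih =>
    intro hm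
    exact .bin (ih (by omega)) (.bin (.num _ (by omega)) (.reg (by omega) hs (by omega)) rfl h3)
      (pow_succ _ _).symm (hle _ hm)

/-- The program that decides 3-HS. -/
def solveCmd (A : DynAlg) (q Z ρ : ℕ) (ins roll : Bool) : Cmd :=
  .seq (buildCmd (40 + 2 * ρ) q Z (!ins)) (.seq (.set (40 + 2 * ρ) 9 (powExpr 13))
    (.seq (.while (40 + 2 * ρ) (.reg 9) (roundCmd A (40 + 2 * ρ) q ρ ins roll))
      (finishCmd (40 + 2 * ρ))))

theorem vectorArray_le_one {n d : ℕ} (X : Fin n → Fin d → Bool) (i : ℕ) :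
    vectorArray X i ≤ 1 := by
  unfold vectorArray
  split_ifs <;> omega

theorem edgeList_map {q S n d n₂ : ℕ} {u v : ℕ → ℕ} {full : Bool} (h : Sizes q S n d n₂) :
    edgeCodes q S n d n₂ u v full = (edgeList q S n d n₂ u v full).map
      fun e => ((e.1 : ℕ), (e.2 : ℕ)) := by
  rw [edgeList, List.map_map]
  conv_lhs => rw [← List.map_id (edgeCodes q S n d n₂ u v full)]
  refine List.map_congr_left fun x hx => ?_
  have hx' := edgeCodes_le h.one_lt h.n_le h.d_le h.n₂_le hx
  simp [vertex_val hx'.1, vertex_val hx'.2]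

/-- The list of edges of the basic graph of an instance. -/
def baseList (J : Job) {n n₂ : ℕ} (U : Fin n → Fin J.d → Bool) (V : Fin n₂ → Fin J.d → Bool) :
    List (Fin (hub J.q J.S + 1) × Fin (hub J.q J.S + 1)) :=
  edgeList J.q J.S n J.d n₂ (vectorArray U) (vectorArray V) (!J.ins)

/-- The constant comes from building the edge list and depends only on the program, not on the
instance; the 3-HS Hypothesis needs one program for all instances. -/
theorem exists_cost_solve (q Z ρ : ℕ) (ins : Bool) : ∃ C : ℕ, ∀ (J : Job) {n n₂ : ℕ}
    (U : Fin n → Fin J.d → Bool) (V : Fin n₂ → Fin J.d → Bool) (W : Fin J.n₃ → Fin J.d → Bool),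
    J.OK → J.q = q → J.ρ = ρ → J.ins = ins → Sizes J.q J.S n J.d n₂ → J.S = Z * (n * (J.d + 1)) →
    4 * J.q * J.S + 8 * J.S + 4 * J.q + 8 < J.B → J.w = vectorArray W →
    J.l = edgeCodes J.q J.S n J.d n₂ (vectorArray U) (vectorArray V) (!J.ins) →
    J.Improves (J.baseList U V) → 0 < J.n₃ → (3 * J.n₃) ^ 13 < J.B →
    Nat.size ((3 * J.n₃) ^ 13) ≤ J.Rmax →
    cost J.B (C * (J.S + 1) + 170 + Nat.size ((3 * J.n₃) ^ 13) * (J.roundTime + 3) + J.n₃ * 50)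
      [solveCmd J.A J.q Z J.ρ J.ins J.roll] (hsStore U V W) J.wrong ≤
      (17 / 18) ^ Nat.size ((3 * J.n₃) ^ 13) * J.n₃ := by
  obtain ⟨C, hC⟩ := runs_build q Z (!ins) (40 + 2 * ρ) (by omega)
  refine ⟨C, ?_⟩
  rintro J n n₂ U V W hJ rfl rfl rfl hs hS hB hw hl himp hn₃ hpow hsize
  change ∀ {B S n d n₂ : ℕ} {s : Store}, _ at hC
  obtain ⟨b, e, r1⟩ := hC (s := hsStore U V W) hs hS hB rfl rfl rfl (vectorArray_le_one U)
    (vectorArray_le_one V) rfl rfl rfl rfl rfl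
  set s1 := builtStore (hsStore U V W) J.q J.S (edgeCodes J.q J.S n J.d n₂
    ((hsStore U V W).arr 0) ((hsStore U V W).arr 1) !J.ins) b e with hs1
  have e2 : s1.var 2 = J.n₃ := by
    simp [hs1, builtStore, listStore, Store.setVar, hsStore]
  have c := computes_powExpr (t := 40 + 2 * J.ρ) (s := s1) (by omega) e2 hn₃ (by omega) hpow 13
    le_rfl
  have r2 := Runs.set (x := 9) c.1 (by rw [c.2]; exact hpow)
  rw [c.2, time_powExpr] at r2
  set s2 := s1.setVar 9 ((3 * J.n₃) ^ 13) with hs2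
  have a2 : s2.arr = s1.arr := rfl
  have h0 : ∀ a, 10 ≤ a → a ≠ 10 → a ≠ 15 → ∀ i, s1.arr a i = 0 := by
    intro a ha h10 h15 i
    have : ∃ a', a = a' + 3 := ⟨a - 3, by omega⟩
    obtain ⟨a', rfl⟩ := this
    simp only [hs1, builtStore, listStore, h10, h15, if_false]
    rfl
  have v0 : ∀ x, 31 ≤ x → s2.var x = 0 := by
    intro x hx
    obtain ⟨x', rfl⟩ : ∃ x', x = x' + 4 := ⟨x - 4, by omega⟩
    simp only [hs2, hs1, builtStore, listStore, Store.setVar,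
      Function.update_of_ne (show x' + 4 ≠ 9 by omega),
      Function.update_of_ne (show x' + 4 ≠ 4 by omega),
      Function.update_of_ne (show x' + 4 ≠ 5 by omega), if_neg (show x' + 4 ≠ 6 by omega),
      if_neg (show x' + 4 ≠ 7 by omega), if_neg (show x' + 4 ≠ 8 by omega)]
    rfl
  have hBpos : 0 < J.B := by omega
  -- This is the fictitious round 0: all stamps and both stamp registers are zero. The first
  -- `clearCmd` raises the registers before anything is simulated.
  have h : J.Head 0 ((3 * J.n₃) ^ 13) (fun _ => 0) (fun _ => 0) s2 :=
    { env :=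
        { v2 := by simpa [hs2, Store.setVar] using e2
          v3 := by simp [hs2, hs1, builtStore, listStore, Store.setVar, hsStore]
          v4 := by simp [hs2, hs1, builtStore, listStore, Store.setVar]
          v5 := by simp [hs2, hs1, builtStore, listStore, Store.setVar]
          v8 := by rw [hl]; simp [hs2, hs1, builtStore, listStore, Store.setVar, hsStore]
          a2 := by
            rw [hw]
            funext i
            simp [hs2, hs1, builtStore, listStore, Store.setVar, hsStore]
          i0 := fun i => by rw [hl]; simp [hs2, hs1, builtStore, listStore, Store.setVar, hsStore]
          i1 := fun i => by rw [hl]; simp [hs2, hs1, builtStore, listStore, Store.setVar, hsStore]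
          i2 := fun a ha i => h0 _ (by omega) (by omega) (by omega) i }
      st :=
        { lt31 := by rw [v0 31 (by omega)]; exact hBpos
          lt32 := by rw [v0 32 (by omega)]; exact hBpos
          le31 := fun a i => by rw [a2, h0 _ (by omega) (by omega) (by omega)]; omega
          le32 := fun a i => by rw [a2, h0 _ (by omega) (by omega) (by omega)]; omega
          fresh := fun h => by simp at h }
      v9 := by simp [hs2, Store.setVar]
      v31 := by rw [v0 31 (by omega)]; omega
      v32 := v0 32 (by omega)
      a3 := by
        funext i
        simp [hs2, hs1, builtStore, listStore, Store.setVar, hsStore]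
      a4 := by
        funext i
        simp [hs2, hs1, builtStore, listStore, Store.setVar, hsStore] }
  have hmain := costU_search hJ (hl.trans (edgeList_map hs)) himp hsize hpow h
  have hrun := (reaches_seq J.t J.B (buildCmd (40 + 2 * J.ρ) J.q Z (!J.ins)) _ [] _).trans
    ((r1 _).trans ((reaches_seq J.t J.B (.set (40 + 2 * J.ρ) 9 (powExpr 13)) _ [] _).trans
      ((r2 _).trans ((reaches_seq J.t J.B (.while (40 + 2 * J.ρ) (.reg 9)
        (roundCmd J.A (40 + 2 * J.ρ) J.q J.ρ J.ins J.roll)) (finishCmd (40 + 2 * J.ρ)) [] _).trans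
        (reaches_while J.t J.B _ _ _ _)))))
  refine (cost_le_costU (Agree.refl J.t _)).trans (le_trans (costU_anti ?_ _ _ _)
    ((hrun _ J.wrong).trans hmain))
  omega

/-- The exponent 13 is chosen since (17/18)^13 ≤ 1/2. With m the binary length of (3n)^13, the 13th
power of (17/18)^m · 3n is at most 2^(-m) · (3n)^13 ≤ 1. -/
theorem pow_mul_le_third {n : ℕ} (hn : 0 < n) :
    (17 / 18 : ℝ≥0∞) ^ Nat.size ((3 * n) ^ 13) * n ≤ 1 / 3 := by
  set m := Nat.size ((3 * n) ^ 13) with hm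
  have hn' : (0 : ℝ) < n := by exact_mod_cast hn
  have hx : (17 / 18 : ℝ) ^ m * (3 * n) ≤ 1 := by
    refine (pow_le_one_iff_of_nonneg (by positivity) (show (13 : ℕ) ≠ 0 by omega)).1 ?_
    have h2 : ((3 * n : ℝ)) ^ 13 ≤ 2 ^ m := by
      exact_mod_cast (Nat.lt_size_self ((3 * n) ^ 13)).le
    calc ((17 / 18 : ℝ) ^ m * (3 * n)) ^ 13 = ((17 / 18) ^ 13) ^ m * (3 * n) ^ 13 := by
          rw [mul_pow, ← pow_mul, ← pow_mul, mul_comm m]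
      _ ≤ (1 / 2) ^ m * 2 ^ m := by
          gcongr
          norm_num
      _ = 1 := by rw [← mul_pow]; norm_num
  have h3 : (17 / 18 : ℝ) ^ m * n ≤ 1 / 3 := by linarith
  have e1 : (17 / 18 : ℝ≥0∞) = ENNReal.ofReal (17 / 18) := by
    rw [ENNReal.ofReal_div_of_pos (by norm_num)]; norm_num
  have e2 : (1 / 3 : ℝ≥0∞) = ENNReal.ofReal (1 / 3) := by
    rw [ENNReal.ofReal_div_of_pos (by norm_num)]; norm_num
  rw [e1, e2, ← ENNReal.ofReal_pow (by norm_num), ← ENNReal.ofReal_natCast,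
    ← ENNReal.ofReal_mul (by positivity)]
  exact ENNReal.ofReal_le_ofReal h3

/-- Markov's inequality: outside `G` the integrand is at least 1, and at `none` it is infinite, so a
small expectation gives halting and the success probability together. -/
theorem two_thirds_le {X : Type*} {μ : PMF (Option X)} {G : Set (Option X)} {g : X → ℝ≥0∞}
    (hg : ∀ x, some x ∉ G → 1 ≤ g x) (h : ex μ g ≤ 1 / 3) :
    none ∉ μ.support ∧ 2 / 3 ≤ μ.toOuterMeasure G := by
  have hfin : ex μ g < ⊤ := h.trans_lt (ENNReal.div_lt_top (by simp) (by simp))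
  refine ⟨none_notMem_of_ex_lt_top hfin, ?_⟩
  have h1 : (1 : ℝ≥0∞) ≤ μ.toOuterMeasure G + 1 / 3 := by
    calc (1 : ℝ≥0∞) = ∑' r, μ r := μ.tsum_coe.symm
      _ ≤ ∑' r, (G.indicator μ r + μ r * r.elim ⊤ g) := by
          refine ENNReal.tsum_le_tsum fun r => ?_
          by_cases hr : r ∈ G
          · rw [Set.indicator_of_mem hr]; exact le_self_add
          · refine le_add_left (le_mul_of_one_le_right zero_le ?_)
            cases r with
            | none => exact le_top
            | some x => exact hg x hr
      _ = μ.toOuterMeasure G + ex μ g := by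
          rw [ENNReal.tsum_add, PMF.toOuterMeasure_apply]; rfl
      _ ≤ _ := by gcongr
  have h3 : (2 / 3 : ℝ≥0∞) + 1 / 3 = 1 := by
    rw [← ENNReal.add_div, show (2 : ℝ≥0∞) + 1 = 3 by norm_num, ENNReal.div_self] <;> simp
  exact (ENNReal.add_le_add_iff_right (by simp)).1 (h3.le.trans h1)

theorem decidesHS_of_cost {P : Cmd} {B T n n₂ : ℕ} {U : Fin n → Fin J.d → Bool}
    {V : Fin n₂ → Fin J.d → Bool} {W : Fin J.n₃ → Fin J.d → Bool}
    (hτ : (∃ k < J.n₃, J.τ k) ↔ HasHittingSet U V W)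
    (h : cost B T [P] (hsStore U V W) J.wrong ≤ 1 / 3) : DecidesHS P B T U V W := by
  refine two_thirds_le (g := fun x => J.wrong x.1) (fun x hx => ?_) h
  rw [wrong, if_neg]
  rw [hτ]
  exact fun h => hx ⟨x.1, x.2, rfl, h⟩

end Job

end Gadget

/-! ## The answers of the dynamic algorithm -/

theorem LegalSeq.append {N : ℕ} {S : Setting} {c : ℝ} {k : ℕ} {os os' : List (Op N)} :
    ∀ {E : Finset (Fin N × Fin N)}, LegalSeq S c k E os →
      LegalSeq S c k (os.foldl Op.apply E) os' → LegalSeq S c k E (os ++ os') := by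
  induction os with
  | nil => exact fun _ h => h
  | cons o os ih => exact fun h h' => ⟨h.1, h.2.1, ih h.2.2 h'⟩

/-- On `G` the bound 3/2 improves by 5/6 to 2/3, and `G` has probability at least 2/3; so the
expectation is at most 3/2 - 5/6 · 2/3 = 17/18. -/
theorem ex_le_of_two_thirds {X : Type*} {μ : PMF (Option X)} {G : Set (Option X)} {g : X → ℝ≥0∞}
    (h0 : none ∉ μ.support) (hG : 2 / 3 ≤ μ.toOuterMeasure G) (hg : ∀ x, g x ≤ 3 / 2)
    (hg' : ∀ x, some x ∈ G → g x ≤ 2 / 3) : ex μ g ≤ 17 / 18 := by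
  have e1 : (2 / 3 : ℝ≥0∞) = ENNReal.ofReal (2 / 3) := by
    rw [ENNReal.ofReal_div_of_pos (by norm_num)]; norm_num
  have e2 : (3 / 2 : ℝ≥0∞) = ENNReal.ofReal (3 / 2) := by
    rw [ENNReal.ofReal_div_of_pos (by norm_num)]; norm_num
  have e3 : (5 / 6 : ℝ≥0∞) = ENNReal.ofReal (5 / 6) := by
    rw [ENNReal.ofReal_div_of_pos (by norm_num)]; norm_num
  have e4 : (17 / 18 : ℝ≥0∞) = ENNReal.ofReal (17 / 18) := by
    rw [ENNReal.ofReal_div_of_pos (by norm_num)]; norm_num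
  have h23 : (2 / 3 : ℝ≥0∞) + 5 / 6 = 3 / 2 := by
    rw [e1, e2, e3, ← ENNReal.ofReal_add (by norm_num) (by norm_num)]; norm_num
  have hsum : (17 / 18 : ℝ≥0∞) + 5 / 6 * (2 / 3) = 3 / 2 := by
    rw [e1, e2, e3, e4, ← ENNReal.ofReal_mul (by norm_num),
      ← ENNReal.ofReal_add (by norm_num) (by norm_num)]
    norm_num
  have hne : (5 / 6 * (2 / 3) : ℝ≥0∞) ≠ ⊤ := by
    rw [e1, e3]; exact ENNReal.mul_ne_top ENNReal.ofReal_ne_top ENNReal.ofReal_ne_top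
  have hn : μ none = 0 := by simpa [PMF.mem_support_iff] using h0
  have h1 : ex μ g + 5 / 6 * (2 / 3) ≤ 3 / 2 := by
    calc ex μ g + 5 / 6 * (2 / 3) ≤ ex μ g + 5 / 6 * μ.toOuterMeasure G := by gcongr
      _ = ∑' r, (μ r * r.elim ⊤ g + 5 / 6 * G.indicator μ r) := by
          rw [ENNReal.tsum_add, PMF.toOuterMeasure_apply, ENNReal.tsum_mul_left]; rfl
      _ ≤ ∑' r, μ r * (3 / 2) := by
          refine ENNReal.tsum_le_tsum fun r => ?_
          cases r with
          | none => by_cases hr : none ∈ G <;> simp [hn, hr]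
          | some x =>
            by_cases hr : some x ∈ G
            · rw [Set.indicator_of_mem hr, mul_comm (5 / 6), ← mul_add, ← h23]
              exact mul_le_mul_right (add_le_add (hg' x hr) le_rfl) _
            · rw [Set.indicator_of_notMem hr, mul_zero, add_zero]
              exact mul_le_mul_right (hg x) _
      _ = 3 / 2 := by rw [ENNReal.tsum_mul_right, μ.tsum_coe, one_mul]
  rw [← hsum] at h1
  exact (ENNReal.add_le_add_iff_right hne).1 h1

namespace Gadget

namespace Job

variable {J : Job}

/-- The outcome of a session. -/
abbrev ses (J : Job) (L : List (Fin (hub J.q J.S + 1) × Fin (hub J.q J.S + 1)))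
    (os : List (Op (hub J.q J.S + 1))) : PMF (Option (Store × ℕ)) :=
  J.A.session J.M J.b J.tp J.tu J.tq L os

theorem ex_ses (L : List (Fin (hub J.q J.S + 1) × Fin (hub J.q J.S + 1)))
    (os : List (Op (hub J.q J.S + 1))) (g : Store × ℕ → ℝ≥0∞) :
    ex (J.ses L os) g =
      ex (exec J.b J.tp ⟨[J.A.preprocess], graphStore L⟩) fun y => J.srv os y g := by
  rw [ses, DynAlg.session]
  refine ex_bind_option _ (fun y => J.A.serve J.M J.b J.tu J.tq os y) ?_ ?_ g
  · rfl
  · exact fun _ => rfl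

/-- The dynamic algorithm of the job approximates the radius, and the stages are those of a 3-HS
instance given by arrays of bits. -/
structure Sound (J : Job) (St : Setting) (α c : ℝ) (κ n n₂ : ℕ) (u v : ℕ → ℕ)
    (L : List (Fin (hub J.q J.S + 1) × Fin (hub J.q J.S + 1))) : Prop where
  sizes : Sizes J.q J.S n J.d n₂
  pos : 0 < n₂
  roomy : Roomy c κ J.q J.S
  admits : Admits St J.ins
  admits' : J.roll = false → J.ins = true ∧ Admits St false
  gap : α * (J.q + 2) < 2 * J.q
  nodup : L.Nodup
  base : IsBitGraph J.q J.S n J.d n₂ u v (fun _ => J.ins = false) L.toFinset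
  τ : ∀ k < J.n₃, (J.τ k ↔ ∃ x < n, ∀ y < n₂, ∃ i < J.d, u (x * J.d + i) ≠ 0 ∧ J.bits k i ≠ 0 ∧
    v (y * J.d + i) ≠ 0)
  serves : ∀ os : List (Op (hub J.q J.S + 1)), LegalSeq St c κ L.toFinset os →
    none ∉ (J.ses L os).support ∧ 2 / 3 ≤ (J.ses L (os ++ [.query])).toOuterMeasure
      {r | ∃ s b, r = some (s, b) ∧ IsApprox α (radius (os.foldl Op.apply L.toFinset)) (answer s)}

variable {St : Setting} {α c : ℝ} {κ n n₂ : ℕ} {u v : ℕ → ℕ}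
  {L : List (Fin (hub J.q J.S + 1) × Fin (hub J.q J.S + 1))}

/-- A radius of at most q + 2 allows estimates up to α(q + 2) only, which `hgap` puts below the
threshold 2q. -/
theorem yes_of_isApprox {s : Store} {R : ℕ∞} (hq : 1 < J.q) (hgap : α * (J.q + 2) < 2 * J.q)
    (h : IsApprox α R (answer s)) (hR : R ≤ (J.q + 2 : ℕ)) : J.Yes s := by
  have hne : R ≠ ⊤ := ne_top_of_le_ne_top (by simp) hR
  obtain ⟨r, rfl⟩ := ENat.ne_top_iff_exists.1 hne
  obtain ⟨e, he, -, h2⟩ := h.2 r rfl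
  have hr : (r : ℝ) ≤ J.q + 2 := by
    have : r ≤ J.q + 2 := by exact_mod_cast hR
    exact_mod_cast this
  have hlt : (e : ℝ) < 2 * J.q := by
    by_cases hα : 0 ≤ α
    · nlinarith
    · have hr0 : (0 : ℝ) ≤ r := by positivity
      have hq0 : (1 : ℝ) < J.q := by exact_mod_cast hq
      nlinarith
  unfold answer at he
  split_ifs at he with h0
  · simp at he
  · refine ⟨h0, ?_⟩
    have : s.var 1 = e := by exact_mod_cast he
    rw [this]
    exact_mod_cast hlt

/-- Estimates never fall below the radius, and an infinite radius must be reported as infinite. -/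
theorem not_yes_of_isApprox {s : Store} {R : ℕ∞} (h : IsApprox α R (answer s))
    (hR : (2 * J.q : ℕ) ≤ R) : ¬ J.Yes s := by
  rintro ⟨h0, h1⟩
  have ha : answer s = s.var 1 := if_neg h0
  rw [ha] at h
  by_cases hRt : R = ⊤
  · exact absurd (h.1 hRt) (by simp)
  · obtain ⟨r, rfl⟩ := ENat.ne_top_iff_exists.1 hRt
    obtain ⟨e, he, h2, -⟩ := h.2 r rfl
    have h3 : s.var 1 = e := by exact_mod_cast he
    have h4 : 2 * J.q ≤ r := by exact_mod_cast hR
    omega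

/-- After these operations the graph is the basic graph again. -/
def Ready (J : Job) (St : Setting) (c : ℝ) (κ n n₂ : ℕ) (u v : ℕ → ℕ)
    (L : List (Fin (hub J.q J.S + 1) × Fin (hub J.q J.S + 1)))
    (os : List (Op (hub J.q J.S + 1))) : Prop :=
  LegalSeq St c κ L.toFinset os ∧ IsBitGraph J.q J.S n J.d n₂ u v (fun _ => J.ins = false)
    (os.foldl Op.apply L.toFinset)

theorem Sound.forth (h : J.Sound St α c κ n n₂ u v L) {os : List (Op (hub J.q J.S + 1))}
    (hos : J.Ready St c κ n n₂ u v L os) (k : ℕ) :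
    LegalSeq St c κ L.toFinset (os ++ Gadget.forth J.q J.S J.d (J.bits k) J.ins) ∧
    IsBitGraph J.q J.S n J.d n₂ u v (fun i => J.bits k i ≠ 0)
      ((os ++ Gadget.forth J.q J.S J.d (J.bits k) J.ins).foldl Op.apply L.toFinset) := by
  have hE := isBitGraph_forth h.sizes (J.bits k) J.ins hos.2
  refine ⟨hos.1.append ?_, by rwa [List.foldl_append]⟩
  rw [← List.append_nil (Gadget.forth J.q J.S J.d (J.bits k) J.ins)]
  exact legal_forth h.sizes h.roomy h.admits hos.2 (isSparse h.sizes hE h.roomy)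

theorem Sound.fwd (h : J.Sound St α c κ n n₂ u v L) {os : List (Op (hub J.q J.S + 1))}
    (hos : J.Ready St c κ n n₂ u v L os) (k : ℕ) :
    LegalSeq St c κ L.toFinset (os ++ J.fwd k) ∧
    IsBitGraph J.q J.S n J.d n₂ u v (fun i => J.bits k i ≠ 0)
      ((os ++ J.fwd k).foldl Op.apply L.toFinset) := by
  have hf := h.forth hos k
  have hsp := isSparse h.sizes hf.2 h.roomy
  rw [Job.fwd, ← List.append_assoc]
  refine ⟨hf.1.append (legalSeq_query hsp hsp), ?_⟩
  rw [List.foldl_append]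
  exact hf.2

theorem Sound.ready (h : J.Sound St α c κ n n₂ u v L) {os : List (Op (hub J.q J.S + 1))}
    (hos : J.Ready St c κ n n₂ u v L os) (hroll : J.roll = false) (k : ℕ) :
    J.Ready St c κ n n₂ u v L ((os ++ J.fwd k) ++ J.bck k) := by
  have hf := h.fwd hos k
  obtain ⟨hins, had⟩ := h.admits' hroll
  have hE := isBitGraph_back h.sizes (J.bits k) hf.2
  rw [bck, hroll, if_neg (by simp)]
  refine ⟨hf.1.append ?_, by rw [List.foldl_append, hins]; exact hE⟩
  rw [← List.append_nil (back J.q J.S J.d (J.bits k))]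
  exact legal_back h.sizes h.roomy had hf.2 (isSparse h.sizes hE h.roomy)

theorem Sound.yes_iff (h : J.Sound St α c κ n n₂ u v L) {k : ℕ} (hk : k < J.n₃)
    {E : Finset (Fin (hub J.q J.S + 1) × Fin (hub J.q J.S + 1))}
    (hE : IsBitGraph J.q J.S n J.d n₂ u v (fun i => J.bits k i ≠ 0) E) {s : Store}
    (ha : IsApprox α (radius E) (answer s)) : J.Yes s ↔ J.τ k := by
  have hs := h.sizes
  by_cases hτ : J.τ k
  · refine iff_of_true (yes_of_isApprox hs.one_lt h.gap ha ?_) hτ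
    exact radius_le (by have := hs.one_lt; omega) hs.n_le hs.d_le hE ((h.τ k hk).1 hτ)
  · refine iff_of_false (not_yes_of_isApprox ha ?_) hτ
    refine le_radius hs.one_lt hs.n_le hs.d_le hs.n₂_le h.pos hE fun x hx => ?_
    by_contra hc
    push Not at hc
    exact hτ ((h.τ k hk).2 ⟨x, hx, hc⟩)

/-- The history `os` may contain all earlier stages with their queries. It is a fixed sequence, so
the guarantee applies to the query that ends stage k, and `ex_le_of_two_thirds` yields the factor. A
vanishing score is treated apart because of `ex_const_mul`. -/
theorem Sound.ex_factor_le (h : J.Sound St α c κ n n₂ u v L) {os : List (Op (hub J.q J.S + 1))}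
    (hos : J.Ready St c κ n n₂ u v L os) {k : ℕ} (hk : k < J.n₃) (σ : ℝ≥0∞) :
    ex (J.ses L (os ++ J.fwd k)) (fun y => J.factor k y.1 * σ) ≤ 17 / 18 * σ := by
  have h0 := (h.serves _ (h.fwd hos k).1).1
  have hf := h.forth hos k
  have h2 := (h.serves _ hf.1).2
  rw [List.append_assoc] at h2
  change 2 / 3 ≤ (J.ses L (os ++ J.fwd k)).toOuterMeasure _ at h2
  by_cases hσ : σ = 0
  · simp only [hσ, mul_zero, ex_const _ h0, le_refl]
  · simp only [mul_comm _ σ]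
    rw [ex_const_mul _ hσ]
    refine mul_le_mul_right (ex_le_of_two_thirds h0 h2 (fun x => ?_) fun x hx => ?_) _
    · unfold factor
      split_ifs
      · refine le_trans (b := 1) (ENNReal.div_le_of_le_mul (by norm_num)) ?_
        rw [ENNReal.le_div_iff_mul_le (by simp) (by simp)]
        norm_num
      · exact le_rfl
    · obtain ⟨s, b, hx, ha⟩ := hx
      obtain rfl : x = (s, b) := by simpa using hx
      rw [factor, if_pos (h.yes_iff hk hf.2 ha)]

/-- All stages branch off from the same state after the preprocessing and are thus dependent. Yet
each of them, taken alone, is distributed like a session that consists of this stage only, and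
expectations add up. -/
theorem Sound.ex_chain_le_of_roll (h : J.Sound St α c κ n n₂ u v L) (hroll : J.roll = true)
    (sc : ℕ → ℝ≥0∞) (m : ℕ) : ∀ {k : ℕ}, k + m ≤ J.n₃ →
    ex (exec J.b J.tp ⟨[J.A.preprocess], graphStore L⟩) (fun y₀ => J.chain y₀ sc m k y₀) ≤
      17 / 18 * ∑ i ∈ Finset.range m, sc (k + i) := by
  have hready : J.Ready St c κ n n₂ u v L [] := ⟨isSparse h.sizes h.base h.roomy, h.base⟩
  induction m with
  | zero =>
    intro k _
    have := (h.serves [] hready.1).1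
    have h2 := ex_const _ this 0
    rw [ex_ses] at h2
    simp only [srv, ex_serve_nil] at h2
    simp only [chain, h2, zero_le]
  | succ m ih =>
    intro k hk
    have h1 : ∀ y₀, J.chain y₀ sc (m + 1) k y₀ ≤
        J.srv (J.fwd k) y₀ (fun y => J.factor k y.1 * sc k) + J.chain y₀ sc m (k + 1) y₀ := by
      intro y₀
      have := ex_affine_le (J.A.serve J.M J.b J.tu J.tq (J.fwd k) y₀) one_ne_zero
        (J.chain y₀ sc m (k + 1) y₀) fun y => J.factor k y.1 * sc k
      simp only [one_mul] at this
      rw [chain, add_comm]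
      simp only [bck, hroll, if_true, srv, ex_serve_nil]
      simpa only [add_comm] using this
    refine (ex_mono _ h1).trans ?_
    rw [ex_add, ← ex_ses, Finset.sum_range_succ', mul_add, add_comm]
    refine add_le_add ((ih (by omega)).trans (le_of_eq ?_)) (h.ex_factor_le hready (by omega) _)
    simp only [add_assoc, add_comm 1]

/-- Without rollback the stages form one long session; `os` is what has been issued before stage k,
and after it the graph is the basic one again. -/
theorem Sound.ex_chain_le (h : J.Sound St α c κ n n₂ u v L) (hroll : J.roll = false)
    (sc : ℕ → ℝ≥0∞) (y₀ : Store × ℕ) (m : ℕ) : ∀ {k : ℕ} {os : List (Op (hub J.q J.S + 1))},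
    k + m ≤ J.n₃ → J.Ready St c κ n n₂ u v L os →
    ex (J.ses L os) (fun y => J.chain y₀ sc m k y) ≤ 17 / 18 * ∑ i ∈ Finset.range m, sc (k + i) := by
  induction m with
  | zero =>
    intro k os _ hos
    simp only [chain, ex_const _ (h.serves _ hos.1).1, zero_le]
  | succ m ih =>
    intro k os hk hos
    have h1 : ex (J.ses L os) (fun y => J.chain y₀ sc (m + 1) k y) =
        ex (J.ses L (os ++ J.fwd k)) (fun y => J.factor k y.1 * sc k) +
          ex (J.ses L ((os ++ J.fwd k) ++ J.bck k)) fun y => J.chain y₀ sc m (k + 1) y := by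
      simp only [ex_ses, srv, ex_serve_append, chain, hroll, Bool.false_eq_true, if_false, ex_add]
    rw [h1, Finset.sum_range_succ', mul_add, add_comm]
    refine add_le_add ((ih (by omega) (h.ready hos hroll k)).trans (le_of_eq ?_))
      (h.ex_factor_le hos (by omega) _)
    simp only [add_assoc, add_comm 1]

theorem Sound.improves (h : J.Sound St α c κ n n₂ u v L) : J.Improves L := by
  intro sc
  cases hroll : J.roll with
  | true => simpa using h.ex_chain_le_of_roll hroll sc J.n₃ (k := 0) (by omega)
  | false =>
    have hready : J.Ready St c κ n n₂ u v L [] := ⟨isSparse h.sizes h.base h.roomy, h.base⟩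
    -- Without rollback the state after the preprocessing is never used again, so any fixed value
    -- may stand in for it.
    have hind : ∀ m k y₀ y₁ y, J.chain y₀ sc m k y = J.chain y₁ sc m k y := by
      intro m
      induction m with
      | zero => exact fun _ _ _ _ => rfl
      | succ m ih =>
        intro k y₀ y₁ y
        simp only [chain, hroll, Bool.false_eq_true, if_false, ih (k + 1) y₀ y₁]
    have := h.ex_chain_le hroll sc (graphStore L, 0) J.n₃ (k := 0) (by omega) hready
    rw [ex_ses] at this
    simp only [srv, ex_serve_nil, zero_add] at this
    refine le_trans (le_of_eq ?_) this
    congr 1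
    funext y
    exact hind _ _ _ _ _

end Job

end Gadget

/-! ## Estimates -/

namespace Gadget

/-- Everything the program handles is polynomial in n + d, so O(log(n + d)) bits suffice. The last
clause adds the words of the dynamic algorithm, which have O(log N) bits. -/
theorem exists_word_bound (q Z τ : ℕ) (K : ℝ) : ∃ r : ℕ, ∀ n d n₃ S : ℕ, 1 ≤ n →
    S = Z * (n * (d + 1)) → n₃ ≤ n ^ τ →
    4 * q * S + 8 * S + 4 * q + 8 < 2 ^ (r * (Nat.log 2 (n + d) + 1)) ∧
    n₃ * d + d < 2 ^ (r * (Nat.log 2 (n + d) + 1)) ∧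
    ((3 * n₃) ^ 13 + 1) * (n₃ + 1) < 2 ^ (r * (Nat.log 2 (n + d) + 1)) ∧
    ∀ w : ℕ, (w : ℝ) ≤ K * Real.log (hub q S + 1 : ℕ) → w ≤ r * (Nat.log 2 (n + d) + 1) := by
  -- Quantities are compared with powers of β = 2^ℓ > n + d. The exponent b covers a + 2 for the
  -- size of the graph and 14(τ + 3) for the stamps and counters.
  set a := (4 * q + 8) * (Z + 1) with ha
  set b := 2 * a + 30 * (τ + 2) + 10 with hb
  -- The second summand is for the simulated words: K log N ≤ |K| b ℓ.
  refine ⟨b + ⌈|K| * (b + 1)⌉₊, ?_⟩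
  intro n d n₃ S hn hS hn₃
  set ℓ := Nat.log 2 (n + d) + 1 with hℓ
  set β := 2 ^ ℓ with hβ
  have hβ1 : n + d < β := Nat.lt_pow_succ_log_self (by omega) _
  have hβ2 : 2 ≤ β := by omega
  have hB : β ^ b ≤ 2 ^ ((b + ⌈|K| * (b + 1)⌉₊) * ℓ) := by
    rw [hβ, ← pow_mul]
    exact Nat.pow_le_pow_right (by omega) (by rw [mul_comm ℓ b]; exact Nat.mul_le_mul_right _ (by omega))
  have ha' : a < β ^ a := (Nat.lt_pow_self (by omega)).trans_le (Nat.pow_le_pow_left hβ2 a)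
  have hmono : ∀ {x y : ℕ}, x ≤ y → β ^ x ≤ β ^ y := fun h => Nat.pow_le_pow_right (by omega) h
  have hnd : n * (d + 1) ≤ β ^ 2 := by rw [pow_two]; exact Nat.mul_le_mul (by omega) (by omega)
  have h1 : 4 * q * S + 8 * S + 4 * q + 8 < β ^ b := by
    have hpos : 1 ≤ β ^ 2 := Nat.one_le_pow _ _ (by omega)
    calc 4 * q * S + 8 * S + 4 * q + 8 = (4 * q + 8) * (S + 1) := by ring
      _ ≤ (4 * q + 8) * ((Z + 1) * β ^ 2) := by
          gcongr
          rw [hS, add_mul, one_mul]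
          exact add_le_add (Nat.mul_le_mul_left _ hnd) hpos
      _ = a * β ^ 2 := by rw [ha]; ring
      _ < β ^ a * β ^ 2 := by gcongr
      _ = β ^ (a + 2) := (pow_add _ _ _).symm
      _ ≤ β ^ b := hmono (by omega)
  have hn₃' : n₃ ≤ β ^ τ := hn₃.trans (Nat.pow_le_pow_left (by omega) _)
  have h3 : 3 * n₃ + 3 ≤ β ^ (τ + 3) := by
    have : 1 ≤ β ^ τ := Nat.one_le_pow _ _ (by omega)
    have h8 : 8 ≤ β ^ 3 := by
      calc 8 = 2 ^ 3 := rfl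
        _ ≤ _ := Nat.pow_le_pow_left hβ2 3
    calc 3 * n₃ + 3 ≤ β ^ τ * 8 := by omega
      _ ≤ β ^ τ * β ^ 3 := Nat.mul_le_mul_left _ h8
      _ = _ := (pow_add _ _ _).symm
  refine ⟨h1.trans_le hB, lt_of_lt_of_le ?_ hB, lt_of_lt_of_le ?_ hB, fun w hw => ?_⟩
  · calc n₃ * d + d = (n₃ + 1) * d := by ring
      _ < (3 * n₃ + 3) * β := Nat.mul_lt_mul'' (by omega) (by omega)
      _ ≤ β ^ (τ + 3) * β := by gcongr
      _ = β ^ (τ + 3 + 1) := (pow_succ _ _).symm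
      _ ≤ β ^ b := hmono (by omega)
  · calc ((3 * n₃) ^ 13 + 1) * (n₃ + 1) ≤ (3 * n₃ + 1) ^ 13 * (n₃ + 1) := by
          gcongr
          have h := Nat.pow_lt_pow_left (show 3 * n₃ < 3 * n₃ + 1 by omega) (show 13 ≠ 0 by omega)
          omega
      _ < (3 * n₃ + 3) ^ 13 * (3 * n₃ + 3) := by
          refine Nat.mul_lt_mul'' (Nat.pow_lt_pow_left (by omega) (by omega)) (by omega)
      _ ≤ (β ^ (τ + 3)) ^ 13 * β ^ (τ + 3) := by gcongr
      _ = β ^ ((τ + 3) * 14) := by rw [← pow_succ, ← pow_mul]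
      _ ≤ β ^ b := hmono (by omega)
  · have hN : ((hub q S + 1 : ℕ) : ℝ) ≤ (β : ℝ) ^ b := by
      have : hub q S + 1 ≤ β ^ b := by unfold hub; omega
      exact_mod_cast this
    have hlog : Real.log (hub q S + 1 : ℕ) ≤ b * ℓ := by
      calc Real.log (hub q S + 1 : ℕ) ≤ Real.log ((β : ℝ) ^ b) :=
            Real.log_le_log (by positivity) hN
        _ = b * (ℓ * Real.log 2) := by
            rw [Real.log_pow, hβ, Nat.cast_pow, Real.log_pow, Nat.cast_ofNat]
        _ ≤ b * (ℓ * 1) := by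
            gcongr
            have := Real.log_le_sub_one_of_pos (show (0 : ℝ) < 2 by norm_num)
            linarith
        _ = b * ℓ := by ring
    have h0 : 0 ≤ Real.log (hub q S + 1 : ℕ) := Real.log_natCast_nonneg _
    have : (w : ℝ) ≤ ((b + ⌈|K| * (b + 1)⌉₊) * ℓ : ℕ) := by
      calc (w : ℝ) ≤ |K| * (b * ℓ) := hw.trans (mul_le_mul (le_abs_self K) hlog h0 (abs_nonneg K))
        _ = (|K| * b) * ℓ := by ring
        _ ≤ (b + ⌈|K| * (b + 1)⌉₊ : ℕ) * ℓ := by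
            gcongr
            push_cast
            have h1 := Nat.le_ceil (|K| * ((b : ℝ) + 1))
            have h2 : |K| * b ≤ |K| * ((b : ℝ) + 1) :=
              mul_le_mul_of_nonneg_left (by linarith) (abs_nonneg K)
            have h3 : (0 : ℝ) ≤ b := by positivity
            linarith
        _ = _ := by push_cast; ring
    exact_mod_cast this

/-- The binary length is logarithmic in n, and log n ≤ n^δ/δ. With log 2 ≥ 1/2 and log 3 ≤ 2 the
13th power contributes 13 · 2 · (2 + (t/δ) n^δ), and one more bit makes 53. -/
theorem exists_size_le {t δ : ℝ} (ht : 0 < t) (hδ : 0 < δ) : ∃ C : ℝ, 0 ≤ C ∧ ∀ n : ℕ, 1 ≤ n →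
    (Nat.size ((3 * ⌊(n : ℝ) ^ t⌋₊) ^ 13) : ℝ) ≤ C * (n : ℝ) ^ δ := by
  refine ⟨53 + 26 * (t / δ), by positivity, fun n hn => ?_⟩
  have hn1 : (1 : ℝ) ≤ n := by exact_mod_cast hn
  have hx1 : (1 : ℝ) ≤ (n : ℝ) ^ δ := Real.one_le_rpow hn1 hδ.le
  have hfl : 1 ≤ ⌊(n : ℝ) ^ t⌋₊ := Nat.one_le_floor_iff _ |>.2 (Real.one_le_rpow hn1 ht.le)
  set x := (3 * ⌊(n : ℝ) ^ t⌋₊) ^ 13 with hx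
  have hx0 : 0 < x := by positivity
  obtain ⟨m, hm⟩ := Nat.exists_eq_add_of_lt (Nat.size_pos.2 hx0)
  rw [zero_add] at hm
  have hpow : 2 ^ m ≤ x := Nat.lt_size.1 (by omega)
  have hlogx : (m : ℝ) * Real.log 2 ≤ Real.log x := by
    rw [← Real.log_pow]
    refine Real.log_le_log (by positivity) ?_
    exact_mod_cast hpow
  have hxe : Real.log x = 13 * Real.log (3 * ⌊(n : ℝ) ^ t⌋₊) := by
    rw [hx]
    push_cast
    rw [Real.log_pow]
    norm_num
  have hfl' : (⌊(n : ℝ) ^ t⌋₊ : ℝ) ≤ (n : ℝ) ^ t := Nat.floor_le (by positivity)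
  have h3 : Real.log (3 * ⌊(n : ℝ) ^ t⌋₊) ≤ 2 + t * ((n : ℝ) ^ δ / δ) := by
    have hpos : (0 : ℝ) < ⌊(n : ℝ) ^ t⌋₊ := by exact_mod_cast hfl
    calc Real.log (3 * ⌊(n : ℝ) ^ t⌋₊) ≤ Real.log (3 * (n : ℝ) ^ t) :=
          Real.log_le_log (by positivity) (by gcongr)
      _ = Real.log 3 + t * Real.log n := by
          rw [Real.log_mul (by norm_num) (by positivity), Real.log_rpow (by linarith)]
      _ ≤ 2 + t * ((n : ℝ) ^ δ / δ) := by
          have h1 := Real.log_le_sub_one_of_pos (show (0 : ℝ) < 3 by norm_num)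
          have h2 := Real.log_le_rpow_div (show (0 : ℝ) ≤ n by linarith) hδ
          exact add_le_add (by linarith) (mul_le_mul_of_nonneg_left h2 ht.le)
  have hl2 : (1 : ℝ) / 2 ≤ Real.log 2 := by
    have := Real.log_two_gt_d9
    linarith
  have hm2 : (m : ℝ) * (1 / 2) ≤ 13 * (2 + t * ((n : ℝ) ^ δ / δ)) := by
    have := mul_le_mul_of_nonneg_left hl2 (show (0 : ℝ) ≤ m by positivity)
    linarith
  rw [hm]
  push_cast
  have e : t * ((n : ℝ) ^ δ / δ) = t / δ * (n : ℝ) ^ δ := by ring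
  rw [e] at hm2
  linarith

/-- The numbers of steps that the reduction takes. -/
theorem exists_time_bound {t δ e K : ℝ} (ht : 0 < t) (hδ : δ = e / 2) (he : 0 < e) (he1 : e ≤ 1)
    (hK : 0 ≤ K) (C q Z ρ : ℕ) : ∃ (C' : ℝ) (k : ℕ), ∀ n d S p u x m n₃ : ℕ, 1 ≤ n →
    S = Z * (n * (d + 1)) → (p : ℝ) ≤ K * (hub q S + 1 : ℕ) ^ t →
    (u : ℝ) ≤ K * (hub q S + 1 : ℕ) ^ (2 - e) → (x : ℝ) ≤ K * (hub q S + 1 : ℕ) ^ (2 - e) →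
    (m : ℝ) ≤ K * (n : ℝ) ^ δ → (n₃ : ℝ) ≤ (n : ℝ) ^ t →
    ((C * (S + 1) + 170 + m * ((19 * (p + n₃ * (2 * (d * u) + x)) +
      n₃ * (2 * (d * 60) + 2 * ρ + 150) + 4 * ρ + 100) + 3) + n₃ * 50 : ℕ) : ℝ) ≤
      C' * (n : ℝ) ^ (1 + 1 + t - δ) * ((d : ℝ) + 1) ^ k := by
  -- The number of vertices is 4qZ · n(d + 1) + 1, hence at most κ n (d + 1).
  set κ : ℝ := 4 * q * Z + 1 with hκ
  -- The preprocessing brings the power t of d + 1, and d updates per stage bring the power 1 + (2 -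
  -- e) ≤ 3.
  set k := ⌈t⌉₊ + 3 with hk
  have hκ0 : 0 < κ := by positivity
  set C₁ : ℝ := 19 * (K * κ ^ t + (2 * (K * κ ^ (2 - e)) + K * κ ^ (2 - e))) +
    (120 + (2 * ρ + 150)) + (4 * ρ + 100) + 3 with hC₁
  refine ⟨C * (Z + 1) + 170 + K * C₁ + 50, k, ?_⟩
  intro n d S p u x m n₃ hn hS hp hu hx hm hn₃
  have hn1 : (1 : ℝ) ≤ n := by exact_mod_cast hn
  have hn0 : (0 : ℝ) < n := by linarith
  set D : ℝ := (d : ℝ) + 1 with hD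
  have hD1 : 1 ≤ D := by rw [hD]; have : (0 : ℝ) ≤ d := by positivity
                         linarith
  have hD0 : (0 : ℝ) < D := by linarith
  have hdD : (d : ℝ) ≤ D := by rw [hD]; linarith
  have hN : ((hub q S + 1 : ℕ) : ℝ) ≤ κ * (n * D) := by
    have h1 : (1 : ℝ) ≤ n * D := by nlinarith
    rw [hub, hS, hκ, hD]
    push_cast
    rw [hD] at h1
    nlinarith
  have hNpow : ∀ s : ℝ, 0 ≤ s → ((hub q S + 1 : ℕ) : ℝ) ^ s ≤ κ ^ s * ((n : ℝ) ^ s * D ^ s) := by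
    intro s hs
    rw [← Real.mul_rpow hn0.le hD0.le, ← Real.mul_rpow hκ0.le (by positivity)]
    exact Real.rpow_le_rpow (by positivity) hN hs
  have hDk : ∀ s : ℝ, s ≤ k → D ^ s ≤ D ^ k := by
    intro s hs
    rw [← Real.rpow_natCast]
    exact Real.rpow_le_rpow_of_exponent_le hD1 hs
  have hnn : ∀ {s s' : ℝ}, s ≤ s' → (n : ℝ) ^ s ≤ (n : ℝ) ^ s' := fun h =>
    Real.rpow_le_rpow_of_exponent_le hn1 h
  have hkt : t ≤ k := by
    rw [hk]; push_cast; have := Nat.le_ceil t; linarith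
  have hk3 : (3 : ℝ) ≤ k := by
    rw [hk]; push_cast; have : (0 : ℝ) ≤ ⌈t⌉₊ := by positivity
    linarith
  set P : ℝ := (n : ℝ) ^ (t + (2 - e)) * D ^ k with hP
  have hP1 : ∀ {s s' : ℝ}, s ≤ t + (2 - e) → s' ≤ k → (n : ℝ) ^ s * D ^ s' ≤ P := by
    intro s s' h h'
    exact mul_le_mul (hnn h) (hDk s' h') (by positivity) (by positivity)
  have p1 : (p : ℝ) ≤ K * κ ^ t * P := by
    calc (p : ℝ) ≤ K * (κ ^ t * ((n : ℝ) ^ t * D ^ t)) :=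
          hp.trans (mul_le_mul_of_nonneg_left (hNpow t ht.le) hK)
      _ = K * κ ^ t * ((n : ℝ) ^ t * D ^ t) := by ring
      _ ≤ _ := mul_le_mul_of_nonneg_left (hP1 (by linarith) hkt) (by positivity)
  have hop : ∀ v : ℕ, (v : ℝ) ≤ K * (hub q S + 1 : ℕ) ^ (2 - e) →
      (n₃ : ℝ) * (D * v) ≤ K * κ ^ (2 - e) * P := by
    intro v hv
    calc (n₃ : ℝ) * (D * v) ≤ (n : ℝ) ^ t *
          (D * (K * (κ ^ (2 - e) * ((n : ℝ) ^ (2 - e) * D ^ (2 - e))))) := by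
          gcongr
          exact hv.trans (mul_le_mul_of_nonneg_left (hNpow _ (by linarith)) hK)
      _ = K * κ ^ (2 - e) * (((n : ℝ) ^ t * (n : ℝ) ^ (2 - e)) * (D ^ (1 : ℝ) * D ^ (2 - e))) := by
          rw [Real.rpow_one]; ring
      _ = K * κ ^ (2 - e) * ((n : ℝ) ^ (t + (2 - e)) * D ^ (1 + (2 - e))) := by
          rw [← Real.rpow_add hn0, ← Real.rpow_add hD0]
      _ ≤ _ := mul_le_mul_of_nonneg_left (hP1 le_rfl (by linarith)) (by positivity)
  have p2 : (n₃ : ℝ) * (d * u) ≤ K * κ ^ (2 - e) * P :=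
    le_trans (by gcongr) (hop u hu)
  have p3 : (n₃ : ℝ) * x ≤ K * κ ^ (2 - e) * P :=
    le_trans (mul_le_mul_of_nonneg_left (le_mul_of_one_le_left (by positivity) hD1)
      (by positivity)) (hop x hx)
  have p4 : (n₃ : ℝ) * D ≤ P := by
    refine le_trans ?_ (hP1 (s := t) (s' := 1) (by linarith) (by linarith))
    rw [Real.rpow_one]
    gcongr
  have p5 : (1 : ℝ) ≤ P := by
    refine le_trans ?_ (hP1 (s := 0) (s' := 0) (by linarith) (by linarith))
    simp
  have p6 : (n₃ : ℝ) ≤ P := le_trans (le_mul_of_one_le_right (by positivity) hD1) p4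
  have p7 : (n₃ : ℝ) * d ≤ P := le_trans (by gcongr) p4
  have hround : (((19 * (p + n₃ * (2 * (d * u) + x)) +
      n₃ * (2 * (d * 60) + 2 * ρ + 150) + 4 * ρ + 100) + 3 : ℕ) : ℝ) ≤ C₁ * P := by
    push_cast
    have hρ : (0 : ℝ) ≤ ρ := by positivity
    have h1 := mul_le_mul_of_nonneg_left p6 (show (0 : ℝ) ≤ 2 * ρ + 150 by positivity)
    have h2 := mul_le_mul_of_nonneg_left p5 (show (0 : ℝ) ≤ 4 * ρ + 100 + 3 by positivity)
    rw [hC₁]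
    linarith
  set G : ℝ := (n : ℝ) ^ (1 + 1 + t - δ) * D ^ k with hG
  have hG1 : ∀ {s s' : ℝ}, s ≤ 1 + 1 + t - δ → s' ≤ k → (n : ℝ) ^ s * D ^ s' ≤ G := by
    intro s s' h h'
    exact mul_le_mul (hnn h) (hDk s' h') (by positivity) (by positivity)
  have hC₁0 : 0 ≤ C₁ := by positivity
  -- The saving e = 2δ is split: the rounds consume n^δ, and t + 2 - e + δ = 1 + 1 + t - δ remains.
  have g1 : (m : ℝ) * (C₁ * P) ≤ K * C₁ * G := by
    calc (m : ℝ) * (C₁ * P) ≤ (K * (n : ℝ) ^ δ) * (C₁ * P) := by gcongr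
      _ = K * C₁ * (((n : ℝ) ^ δ * (n : ℝ) ^ (t + (2 - e))) * D ^ k) := by rw [hP]; ring
      _ = K * C₁ * G := by
          rw [← Real.rpow_add hn0, hG]
          congr 3
          rw [hδ]; ring
  have g2 : (S : ℝ) + 1 ≤ (Z + 1) * G := by
    have h1 : (n : ℝ) * D ≤ G := by
      simpa using hG1 (s := 1) (s' := 1) (by linarith) (by linarith)
    have h2 : (1 : ℝ) ≤ G := by simpa using hG1 (s := 0) (s' := 0) (by linarith) (by linarith)
    have h3 := mul_le_mul_of_nonneg_left h1 (show (0 : ℝ) ≤ Z by positivity)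
    rw [hS]
    push_cast
    rw [← hD]
    linarith
  have g3 : (1 : ℝ) ≤ G := by simpa using hG1 (s := 0) (s' := 0) (by linarith) (by linarith)
  have g4 : (n₃ : ℝ) ≤ G := by
    refine hn₃.trans ?_
    simpa using hG1 (s := t) (s' := 0) (by linarith) (by linarith)
  have g5 := (mul_le_mul_of_nonneg_left hround (show (0 : ℝ) ≤ m by positivity)).trans g1
  have g6 := mul_le_mul_of_nonneg_left g2 (show (0 : ℝ) ≤ C by positivity)
  rw [mul_assoc, ← hG]
  push_cast at g5 ⊢
  linarith

end Gadget

/-! ## The reduction -/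

theorem vectorArray_ne_zero {n d : ℕ} (X : Fin n → Fin d → Bool) (i : Fin n) (j : Fin d) :
    vectorArray X (i * d + j) ≠ 0 ↔ X i j = true := by
  have hd : 0 < d := j.pos
  unfold vectorArray
  constructor
  · intro h
    split_ifs at h with h'
    · obtain ⟨i', j', he, hX⟩ := h'
      have h1 : (i : ℕ) = i' := by
        have := congrArg (· / d) he
        simpa [mul_comm _ d, Nat.mul_add_div hd, Nat.div_eq_of_lt] using this
      have h2 : (j : ℕ) = j' := by rw [h1] at he; omega
      rw [Fin.ext h1, Fin.ext h2]
      exact hX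
    · exact absurd rfl h
  · intro h
    rw [if_pos ⟨i, j, rfl, h⟩]
    exact one_ne_zero

theorem tripleProduct_ne_zero {d : ℕ} (u v w : Fin d → Bool) :
    tripleProduct u v w ≠ 0 ↔ ∃ i, u i = true ∧ w i = true ∧ v i = true := by
  unfold tripleProduct
  rw [Ne, Finset.sum_eq_zero_iff]
  push Not
  refine exists_congr fun i => ?_
  cases u i <;> cases v i <;> cases w i <;> simp

theorem hasHittingSet_iff {n n₂ n₃ d : ℕ} (U : Fin n → Fin d → Bool) (V : Fin n₂ → Fin d → Bool)
    (W : Fin n₃ → Fin d → Bool) :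
    (∃ k < n₃, ∃ x < n, ∀ y < n₂, ∃ i < d, vectorArray U (x * d + i) ≠ 0 ∧
      vectorArray W (k * d + i) ≠ 0 ∧ vectorArray V (y * d + i) ≠ 0) ↔ HasHittingSet U V W := by
  constructor
  · rintro ⟨k, hk, x, hx, h⟩
    refine ⟨⟨x, hx⟩, ⟨k, hk⟩, fun y => ?_⟩
    obtain ⟨i, hi, h1, h2, h3⟩ := h y y.2
    exact (tripleProduct_ne_zero _ _ _).2 ⟨⟨i, hi⟩,
      (vectorArray_ne_zero U ⟨x, hx⟩ ⟨i, hi⟩).1 h1, (vectorArray_ne_zero W ⟨k, hk⟩ ⟨i, hi⟩).1 h2,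
      (vectorArray_ne_zero V y ⟨i, hi⟩).1 h3⟩
  · rintro ⟨x, k, h⟩
    refine ⟨k, k.2, x, x.2, fun y hy => ?_⟩
    obtain ⟨i, h1, h2, h3⟩ := (tripleProduct_ne_zero _ _ _).1 (h ⟨y, hy⟩)
    exact ⟨i, i.2, (vectorArray_ne_zero U x i).2 h1, (vectorArray_ne_zero W k i).2 h2,
      (vectorArray_ne_zero V ⟨y, hy⟩ i).2 h3⟩

namespace Gadget

/-- Edges number at most three times the vertices. As k ≥ 1 and c > 0, the factor c log^k N exceeds
3 once the graph is large, which padding ensures. -/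
theorem exists_roomy {c : ℝ} (hc : 0 < c) {k q : ℕ} (hk : 1 ≤ k) (hq : 1 ≤ q) :
    ∃ Z : ℕ, ∀ S, Z ≤ S → Roomy c k q S := by
  have h1 : Tendsto (fun n : ℕ => Real.log n) atTop atTop :=
    Real.tendsto_log_atTop.comp tendsto_natCast_atTop_atTop
  obtain ⟨Z, hZ⟩ := eventually_atTop.1 (h1.eventually_ge_atTop (max 1 (3 / c)))
  refine ⟨Z, fun S hS => ?_⟩
  have hSN : S ≤ hub q S + 1 := by
    have : S ≤ hub q S := Nat.le_mul_of_pos_left _ (by omega)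
    omega
  have hlog := hZ (hub q S + 1) (hS.trans hSN)
  have hl1 := (le_max_left _ _).trans hlog
  have hl2 := (le_max_right _ _).trans hlog
  have hpow : 3 / c ≤ Real.log (hub q S + 1 : ℕ) ^ k :=
    hl2.trans (le_self_pow₀ hl1 (by omega))
  have hc3 : 3 ≤ c * Real.log (hub q S + 1 : ℕ) ^ k := by
    have := mul_le_mul_of_nonneg_left hpow hc.le
    rwa [mul_div_cancel₀ _ hc.ne'] at this
  have hcount : 4 * q * S + 8 * S ≤ 3 * (hub q S + 1) := by
    unfold hub
    have : S ≤ q * S := Nat.le_mul_of_pos_left _ (by omega)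
    have e : 4 * q * S = 4 * (q * S) := mul_assoc _ _ _
    omega
  calc ((4 * q * S + 8 * S : ℕ) : ℝ) ≤ (3 * (hub q S + 1) : ℕ) := by exact_mod_cast hcount
    _ = 3 * (hub q S + 1 : ℕ) := by push_cast; ring
    _ ≤ (c * Real.log (hub q S + 1 : ℕ) ^ k) * (hub q S + 1 : ℕ) := by gcongr
    _ = _ := by ring

/-- The job of deciding an instance of 3-HS. -/
abbrev hsJob (A : DynAlg) (M : Timing) (ins roll : Bool) (q S ρ b B tp tu tq Rmax : ℕ)
    {n n₂ n₃ d : ℕ} (U : Fin n → Fin d → Bool) (V : Fin n₂ → Fin d → Bool)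
    (W : Fin n₃ → Fin d → Bool) : Job where
  A := A
  M := M
  ins := ins
  roll := roll
  q := q
  S := S
  n₃ := n₃
  d := d
  ρ := ρ
  b := b
  B := B
  tp := tp
  tu := tu
  tq := tq
  Rmax := Rmax
  w := vectorArray W
  l := edgeCodes q S n d n₂ (vectorArray U) (vectorArray V) (!ins)
  τ k := ∃ x < n, ∀ y < n₂, ∃ i < d, vectorArray U (x * d + i) ≠ 0 ∧
    vectorArray W (k * d + i) ≠ 0 ∧ vectorArray V (y * d + i) ≠ 0

theorem exists_eventually_le {f g : ℕ → ℝ} (h : f =O[atTop] g) :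
    ∃ K : ℝ, 0 ≤ K ∧ ∀ᶠ n in atTop, f n ≤ K * |g n| := by
  obtain ⟨K, hK, hb⟩ := h.exists_nonneg
  exact ⟨K, hK, hb.bound.mono fun n hn => (le_abs_self _).trans (by simpa using hn)⟩

theorem exists_below_all (A : DynAlg) : ∃ ρ, 2 ≤ ρ ∧ A.preprocess.Below ρ ∧ A.onInsert.Below ρ ∧
    A.onDelete.Below ρ ∧ A.onQuery.Below ρ := by
  obtain ⟨a, ha⟩ := A.preprocess.exists_below
  obtain ⟨b, hb⟩ := A.onInsert.exists_below
  obtain ⟨c, hc⟩ := A.onDelete.exists_below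
  obtain ⟨d, hd⟩ := A.onQuery.exists_below
  exact ⟨a + b + c + d + 2, by omega, ha.mono (by omega), hb.mono (by omega), hc.mono (by omega),
    hd.mono (by omega)⟩

/-- All settings at once: `ins` tells whether a stage switches by insertions or by deletions, `roll`
whether it is undone by restoring the memory or by updates. -/
theorem not_existsDynamicRadius {St : Setting} {M : Timing} (ins roll : Bool) {t ε ε' c : ℝ}
    {k : ℕ} (ht : 0 < t) (hε : 0 < ε) (hε' : 0 < ε') (hc : 0 < c) (hk : 1 ≤ k)
    (hins : Admits St ins) (hroll : roll = false → ins = true ∧ Admits St false)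
    (hM : roll = true → M = .worstCase) (h3HS : ThreeHSHypothesis) :
    ¬ ExistsDynamicRadius St M (2 - ε) c k t (2 - ε') := by
  rintro ⟨A, w, p, u, x, hw, hp, hu, hx, hA⟩
  -- A smaller saving is still a saving, and e ≤ 1 keeps the exponent 2 - e at least 1.
  set e := min ε' 1 with he
  have he0 : 0 < e := lt_min hε' one_pos
  have he1 : e ≤ 1 := min_le_right _ _
  have hee : e ≤ ε' := min_le_left _ _
  -- The gap (2 - ε)(q + 2) < 2q amounts to 4 < ε(q + 2).
  obtain ⟨q, hq⟩ := exists_nat_gt (4 / ε + 2)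
  have hq2 : 1 < q := by
    have : (1 : ℝ) < q := by have : 0 < 4 / ε := by positivity
                             linarith
    exact_mod_cast this
  have hgap : (2 - ε) * ((q : ℝ) + 2) < 2 * q := by
    have h1 : 4 / ε < q + 2 := by linarith
    rw [div_lt_iff₀ hε] at h1
    linarith
  obtain ⟨ρ, hρ, hpre, hInsert, hDelete, hqry⟩ := exists_below_all A
  obtain ⟨Kw, hKw, hw⟩ := exists_eventually_le hw
  obtain ⟨Kp, hKp, hp⟩ := exists_eventually_le hp
  obtain ⟨Ku, hKu, hu⟩ := exists_eventually_le hu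
  obtain ⟨Kx, hKx, hx⟩ := exists_eventually_le hx
  obtain ⟨Z₁, hZ₁⟩ := eventually_atTop.1 (hw.and (hp.and (hu.and hx)))
  obtain ⟨Z₂, hZ₂⟩ := exists_roomy hc hk hq2.le
  -- Padding by Z makes the asymptotic bounds (Z₁) and the room for edges (Z₂) valid even for the
  -- smallest instances, and 1 keeps S positive.
  set Z := Z₁ + Z₂ + 1 with hZ
  obtain ⟨C, hC⟩ := Job.exists_cost_solve q Z ρ ins
  obtain ⟨Km, hKm, hm⟩ := exists_size_le ht (half_pos he0)
  set K := Kp + Ku + Kx + Km with hK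
  obtain ⟨r, hr⟩ := exists_word_bound q Z ⌈t⌉₊ Kw
  obtain ⟨C', k', htime⟩ := exists_time_bound (K := K) ht rfl he0 he1 (by positivity) C q Z ρ
  -- With |W| = n^t the stages take at least as much of the time bound as the preprocessing does, so
  -- one preprocessing per round is affordable for any t.
  refine h3HS 1 t (e / 2) one_pos ht (half_pos he0) C' k' r
    ⟨Job.solveCmd A q Z ρ ins roll, fun n d hn U V W _ _ _ => ?_⟩
  have hn1 : (1 : ℝ) ≤ n := by exact_mod_cast hn
  have hn₂ : ⌊(n : ℝ) ^ (1 : ℝ)⌋₊ = n := by rw [Real.rpow_one, Nat.floor_natCast]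
  generalize ⌊(n : ℝ) ^ (1 : ℝ)⌋₊ = n₂ at V hn₂
  obtain rfl := hn₂
  have hn₃ : (⌊(n₂ : ℝ) ^ t⌋₊ : ℝ) ≤ (n₂ : ℝ) ^ t := Nat.floor_le (by positivity)
  have hn₃1 : 1 ≤ ⌊(n₂ : ℝ) ^ t⌋₊ := (Nat.one_le_floor_iff _).2 (Real.one_le_rpow hn1 ht.le)
  have hmn := hm n₂ hn
  generalize ⌊(n₂ : ℝ) ^ t⌋₊ = n₃ at W hn₃ hn₃1 hmn
  set S := Z * (n₂ * (d + 1)) with hS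
  have hnd : n₂ * (d + 1) ≤ S := Nat.le_mul_of_pos_left _ (by omega)
  have hnd' : n₂ * (d + 1) = n₂ * d + n₂ := by ring
  have hdn : d ≤ n₂ * d := Nat.le_mul_of_pos_left _ hn
  have hZS : Z ≤ S := Nat.le_mul_of_pos_right _ (by positivity)
  have hsizes : Sizes q S n₂ d n₂ :=
    { one_lt := hq2
      pos := by omega
      n_le := by omega
      d_le := by omega
      n₂_le := by omega
      nd_le := by omega
      n₂d_le := by omega }
  have hSN : S ≤ hub q S := Nat.le_mul_of_pos_left _ (by omega)
  obtain ⟨bw, bp, bu, bx⟩ := hZ₁ (hub q S + 1) (by omega)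
  have hN1 : (1 : ℝ) ≤ (hub q S + 1 : ℕ) := by exact_mod_cast Nat.succ_pos _
  have hexp : ((hub q S + 1 : ℕ) : ℝ) ^ (2 - ε') ≤ ((hub q S + 1 : ℕ) : ℝ) ^ (2 - e) :=
    Real.rpow_le_rpow_of_exponent_le hN1 (by linarith)
  rw [abs_of_nonneg (by positivity)] at bp bu bx
  rw [abs_of_nonneg (Real.log_nonneg hN1)] at bw
  have bound : ∀ {a y z : ℝ} {i : ℕ}, 0 ≤ a → (i : ℝ) ≤ a * y → y ≤ z → 0 ≤ z → a ≤ K →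
      (i : ℝ) ≤ K * z := fun ha h1 h2 h3 h4 =>
    h1.trans ((mul_le_mul_of_nonneg_left h2 ha).trans (mul_le_mul_of_nonneg_right h4 h3))
  have hn₃t : n₃ ≤ n₂ ^ ⌈t⌉₊ := by
    have : (n₃ : ℝ) ≤ (n₂ : ℝ) ^ ((⌈t⌉₊ : ℕ) : ℝ) :=
      hn₃.trans (Real.rpow_le_rpow_of_exponent_le hn1 (Nat.le_ceil t))
    rw [Real.rpow_natCast] at this
    exact_mod_cast this
  obtain ⟨hB1, hB2, hB3, hB4⟩ := hr n₂ d n₃ S hn hS hn₃t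
  have hT := htime n₂ d S (p (hub q S + 1)) (u (hub q S + 1)) (x (hub q S + 1))
    (Nat.size ((3 * n₃) ^ 13)) n₃ hn hS
    (bound hKp bp le_rfl (by positivity) (by rw [hK]; linarith))
    (bound hKu bu hexp (by positivity) (by rw [hK]; linarith))
    (bound hKx bx hexp (by positivity) (by rw [hK]; linarith))
    (bound hKm hmn le_rfl (by positivity) (by rw [hK]; linarith)) hn₃
  set B := 2 ^ (r * (Nat.log 2 (n₂ + d) + 1)) with hB
  have hsize : Nat.size ((3 * n₃) ^ 13) ≤ (3 * n₃) ^ 13 := Nat.size_le.2 Nat.lt_two_pow_self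
  have hpowB : (3 * n₃) ^ 13 < B :=
    ((Nat.le_succ _).trans (Nat.le_mul_of_pos_right _ (Nat.succ_pos _))).trans_lt hB3
  have hhub : hub q S = 4 * q * S := rfl
  let J := hsJob A M ins roll q S ρ (2 ^ w (hub q S + 1)) B (p (hub q S + 1)) (u (hub q S + 1))
    (x (hub q S + 1)) (Nat.size ((3 * n₃) ^ 13)) U V W
  have hJ : J.OK :=
    { ρ := hρ
      pre := hpre
      upd := fun i => by cases i; exacts [hDelete, hInsert]
      qry := hqry
      q := hq2
      d := hsizes.d_le
      b := Nat.pow_le_pow_right (by omega) (hB4 _ bw)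
      hub := show hub q S + 4 * q + 8 < B by omega
      bits := hB2
      w := Job.vectorArray_le_one W
      l := (length_edgeCodes_le hsizes.nd_le hsizes.d_le hsizes.n₂d_le).trans_lt
        (show 4 * q * S + 8 * S < B by omega)
      stamp := (Nat.mul_le_mul_right _ (Nat.succ_le_succ hsize)).trans_lt hB3
      timing := hM }
  have hsound : J.Sound St (2 - ε) c k n₂ n₂ (vectorArray U) (vectorArray V) (J.baseList U V) :=
    { sizes := hsizes
      pos := hn
      roomy := hZ₂ S (by omega)
      admits := hins
      admits' := hroll
      gap := hgap
      nodup := nodup_edgeList hq2 hsizes.pos hsizes.n_le hsizes.d_le hsizes.n₂_le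
      base := by
        have := isGraph_edgeList (u := vectorArray U) (v := vectorArray V) (full := !ins) hq2
          hsizes.n_le hsizes.d_le hsizes.n₂_le
        simp only [Bool.not_eq_true'] at this
        exact this
      τ := fun _ _ => Iff.rfl
      serves := hA (hub q S + 1) (Nat.succ_pos _) _
        (nodup_edgeList hq2 hsizes.pos hsizes.n_le hsizes.d_le hsizes.n₂_le) }
  have hcost := hC J U V W hJ rfl rfl rfl hsizes hS hB1 rfl rfl hsound.improves hn₃1 hpowB le_rfl
  refine Job.decidesHS_of_cost (J := J) (hasHittingSet_iff U V W)
    (le_trans (cost_anti ?_ _ _ _) (hcost.trans (Job.pow_mul_le_third hn₃1)))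
  exact Nat.le_floor hT

end Gadget

end

/-- The fully dynamic case deletes what it inserted, so each round is one genuine session and
amortized bounds suffice. The partially dynamic cases restore the memory, which needs worst-case
bounds; in the decremental one all switch edges are present at first, and those at the zeros of w
are deleted. -/
theorem mainTheorem6 (t ε ε' : ℝ) (ht : 0 < t) (hε : 0 < ε) (hε' : 0 < ε')
    (c : ℝ) (k : ℕ) (hc : 0 < c) (hk : 1 ≤ k) (h3HS : ThreeHSHypothesis) :
    ¬ ExistsDynamicRadius .fullyDynamic .amortized (2 - ε) c k t (2 - ε') ∧
    ¬ ExistsDynamicRadius .incremental .worstCase (2 - ε) c k t (2 - ε') ∧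
    ¬ ExistsDynamicRadius .decremental .worstCase (2 - ε) c k t (2 - ε') :=
  ⟨Gadget.not_existsDynamicRadius true false ht hε hε' hc hk (by simp [Gadget.Admits])
      (fun _ => ⟨rfl, by simp [Gadget.Admits]⟩) (by simp) h3HS,
    Gadget.not_existsDynamicRadius true true ht hε hε' hc hk (by simp [Gadget.Admits])
      (by simp) (fun _ => rfl) h3HS,
    Gadget.not_existsDynamicRadius false true ht hε hε' hc hk (by simp [Gadget.Admits])
      (by simp) (fun _ => rfl) h3HS⟩
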